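/- Let $\lambda\ge -\frac1\pi$ be real and $\mu>0$. Put $\alpha_\lambda=\frac{\arcsin(\lambda\pi)}{\pi}$ if $|\lambda|\le\frac1\pi$ and $\alpha_\lambda=\frac12+\mathrm i\,\frac{\operatorname{arcosh}(\lambda\pi)}{\pi}$ if $\lambda\ge\frac1\pi$, and let ${}_2F_1(a,b;c;\cdot)$ be the Gauss hypergeometric function, analytically continued to $\mathbb C\setminus[1,\infty)$. Define $$\varrho_\lambda(x)=x\;{}_2F_1\Big(\alpha_\lambda,\,1-\alpha_\lambda;\,2;\,-\frac{x}{\mu^2}\Big)\qquad(x\ge 0).$$ 1. The function $\varrho_\lambda$ is real-valued on $[0,\infty)$ and solves the Fredholm equation for the deformed measure of the quartic matrix field theory on the $4$-dimensional Moyal space: for all $x\ge0$ the following integral converges absolutely and $$\varrho_\lambda(x)=x-\lambda x^2\int_0^\infty\frac{\varrho_\lambda(t)\,dt}{(t+\mu^2)^2\,(t+\mu^2+x)}.$$ 2. Let moreover $\lambda\ne0$. Then $\frac{\alpha_\lambda(1-\alpha_\lambda)}{\lambda}>0$, so that the choice $\mu^2=\frac{\alpha_\lambda(1-\alpha_\lambda)}{\lambda}$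 is possible. For $z\in\mathbb C\setminus(-\infty,-\mu^2)$ put $$R_4(z)=z-\lambda z^2\int_0^\infty\frac{\varrho_\lambda(t)\,dt}{(t+\mu^2)^2(t+\mu^2+z)}.$$ This choice is the natural one for the boundary condition in the following sense: for every $\mu>0$, the integral in $R_4(-\mu^2)$ and the integral $\int_0^\infty\frac{\varrho_\lambda(t)\,dt}{(t+\mu^2)^3}$ converge absolutely, and each of the two conditions $$R_4(-\mu^2)=-1,\qquad \int_0^\infty\frac{\varrho_\lambda(t)\,dt}{(t+\mu^2)^3}=\frac12$$ holds if and only if $\mu^2=\frac{\alpha_\lambda(1-\alpha_\lambda)}{\lambda}$. 3. This choice differs from the boundary condition $\frac{\partial}{\partial a}G(a,0)|_{a=0}=-1$ induced by Zimmermann's forest formula. Here $G$ is the planar two-point function $$G(a,b)=\frac{\mu^2\,e^{N(a,b)}}{\mu^2+a+b},\qquad N(a,b)=\frac1{2\pi\mathrm i}\int_{-\infty}^\infty\!\big\{L_{R_4}(a,b;t)-L_{\mathrm{id}}(a,b;t)-L_{R_4}(0,0;t)+L_{\mathrm{id}}(0,0;t)\big\}\,dt,$$ $$L_f(a,b;t)=\log\!\big(a-f(-\tfrac{\mu^2}{2}-\mathrm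 it)\big)\,\frac{d}{dt}\log\!\big(b-f(-\tfrac{\mu^2}{2}+\mathrm it)\big),$$ with principal logarithms. That is, for all sufficiently small $|\lambda|\neq0$ and $\mu^2=\frac{\alpha_\lambda(1-\alpha_\lambda)}{\lambda}$, the integral $N(a,0)$ converges absolutely for all $a\ge0$, and the one-sided derivative $\frac{\partial}{\partial a}G(a,0)|_{a=0}$ exists and is different from $-1$. -/

import Mathlib

open MeasureTheory Set Filter Topology

noncomputable section

namespace MoyalFour

/-- The cut plane `ℂ ∖ [1, ∞)`. -/
def cutPlane : Set ℂ := {z : ℂ | 1 - z ∈ Complex.slitPlane}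

/-- `F` is the principal branch of the Gauss hypergeometric function: it is holomorphic on
`ℂ ∖ [1, ∞)` and is given by the hypergeometric series on the open unit disc. -/
def IsHyp2F1 (a b c : ℂ) (F : ℂ → ℂ) : Prop :=
  DifferentiableOn ℂ F cutPlane ∧ ∀ z : ℂ, ‖z‖ < 1 → F z = ordinaryHypergeometric a b c z

open Classical in
/-- The Gauss hypergeometric function `₂F₁(a, b; c; z)` on `ℂ ∖ [1, ∞)`, i.e. the analytic
continuation of the hypergeometric series (which by itself has radius of convergence one). -/
def hyp2F1 (a b c z : ℂ) : ℂ :=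
  if h : ∃ F : ℂ → ℂ, IsHyp2F1 a b c F then h.choose z else 0

theorem isOpen_cutPlane : IsOpen cutPlane :=
  Complex.isOpen_slitPlane.preimage (continuous_const.sub continuous_id)

theorem zero_mem_cutPlane : (0 : ℂ) ∈ cutPlane := by
  simp [cutPlane]

theorem isPreconnected_cutPlane : IsPreconnected cutPlane := by
  have h : cutPlane = (fun w : ℂ => 1 - w) '' Complex.slitPlane := by
    ext z
    constructor
    · intro hz
      exact ⟨1 - z, hz, by ring⟩
    · rintro ⟨w, hw, rfl⟩
      simpa [cutPlane] using hw
  rw [h]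
  exact (Complex.starConvex_one_slitPlane.isPathConnected
    Complex.one_mem_slitPlane).isConnected.isPreconnected.image _ (by fun_prop)

/-- The continuation is unique, so `hyp2F1` does not depend on the choice made. -/
theorem hyp2F1_eq {a b c : ℂ} {F : ℂ → ℂ} (hF : IsHyp2F1 a b c F) {z : ℂ}
    (hz : z ∈ cutPlane) : hyp2F1 a b c z = F z := by
  have hex : ∃ F : ℂ → ℂ, IsHyp2F1 a b c F := ⟨F, hF⟩
  have hG := hex.choose_spec
  have h1 : hyp2F1 a b c z = hex.choose z := by simp only [hyp2F1, dif_pos hex]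
  rw [h1]
  refine AnalyticOnNhd.eqOn_of_preconnected_of_eventuallyEq
    (hG.1.analyticOnNhd isOpen_cutPlane) (hF.1.analyticOnNhd isOpen_cutPlane)
    isPreconnected_cutPlane zero_mem_cutPlane ?_ hz
  filter_upwards [Metric.ball_mem_nhds (0 : ℂ) one_pos] with w hw
  have hw' : ‖w‖ < 1 := by simpa using hw
  rw [hG.2 w hw', hF.2 w hw']

/-- The exponent `α_λ`, for `λ ≥ -1/π`: it is `arcsin(λπ)/π` if `|λ| ≤ 1/π` and
`1/2 + i arcosh(λπ)/π` if `λ ≥ 1/π` (both give `1/2` at `λ = 1/π`). -/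
def alpha (lam : ℝ) : ℂ :=
  if lam ≤ 1 / Real.pi then ((Real.arcsin (lam * Real.pi) / Real.pi : ℝ) : ℂ)
  else 1 / 2 + Complex.I * ((Real.arcosh (lam * Real.pi) / Real.pi : ℝ) : ℂ)

/-- The complex number `x · ₂F₁(α_λ, 1 - α_λ; 2; -x/μ²)`. -/
def hypDensity (lam μ x : ℝ) : ℂ :=
  (x : ℂ) * hyp2F1 (alpha lam) (1 - alpha lam) 2 (-(x : ℂ) / (μ : ℂ) ^ 2)

/-- The real function given by the real part of `hypDensity` (the imaginary part vanishes). -/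
def rho (lam μ x : ℝ) : ℝ := (hypDensity lam μ x).re

/-- `ρ` solves, on `[0, ∞)`, the linear integral equation
`ρ(x) = x - λ x² ∫₀^∞ ρ(t) dt / ((t + μ²)² (t + μ² + x))`, with convergent integrals. -/
def SolvesFredholm (lam μ : ℝ) (ρ : ℝ → ℝ) : Prop :=
  ∀ x : ℝ, 0 ≤ x →
    IntegrableOn (fun t : ℝ => ρ t / ((t + μ ^ 2) ^ 2 * (t + μ ^ 2 + x))) (Ioi 0) ∧
    ρ x = x - lam * x ^ 2 * ∫ t in Ioi (0 : ℝ), ρ t / ((t + μ ^ 2) ^ 2 * (t + μ ^ 2 + x))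

/-- `R₄(z) = z - λ z² ∫₀^∞ ρ(t) dt / ((t + μ²)² (t + μ² + z))`. -/
def R4 (lam μ : ℝ) (ρ : ℝ → ℝ) (z : ℂ) : ℂ :=
  z - (lam : ℂ) * z ^ 2 *
    ∫ t in Ioi (0 : ℝ), (ρ t : ℂ) / (((t : ℂ) + (μ : ℂ) ^ 2) ^ 2 * ((t : ℂ) + (μ : ℂ) ^ 2 + z))

/-- `μ² = α_λ (1 - α_λ) / λ` (for `λ ≠ 0`). -/
def IsNaturalMass (lam μ : ℝ) : Prop :=
  (μ : ℂ) ^ 2 = alpha lam * (1 - alpha lam) / (lam : ℂ)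

/-- The point `-μ²/2 + i t`. -/
def linePoint (μ t : ℝ) : ℂ := -(μ : ℂ) ^ 2 / 2 + Complex.I * (t : ℂ)

/-- `log (a - f(-μ²/2 - i t)) · d/dt log (b - f(-μ²/2 + i t))`. -/
def logTerm (μ : ℝ) (f : ℂ → ℂ) (a b t : ℝ) : ℂ :=
  Complex.log ((a : ℂ) - f (linePoint μ (-t))) *
    deriv (fun s : ℝ => Complex.log ((b : ℂ) - f (linePoint μ s))) t

/-- The integrand of the exponent `N₄(a, b)` of the planar two-point function. -/
def exponentIntegrand (lam μ : ℝ) (ρ : ℝ → ℝ) (a b t : ℝ) : ℂ :=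
  logTerm μ (R4 lam μ ρ) a b t - logTerm μ id a b t
    - logTerm μ (R4 lam μ ρ) 0 0 t + logTerm μ id 0 0 t

/-- The planar two-point function `G(a, b) = μ² exp (N₄(a, b)) / (μ² + a + b)`, where
`N₄(a, b) = (2 π i)⁻¹ ∫_ℝ exponentIntegrand dt`; it is normalised to `G(0, 0) = 1`. -/
def twoPoint (lam μ : ℝ) (ρ : ℝ → ℝ) (a b : ℝ) : ℂ :=
  (μ : ℂ) ^ 2 *
    Complex.exp ((1 / (2 * (Real.pi : ℂ) * Complex.I)) *
      ∫ t : ℝ, exponentIntegrand lam μ ρ a b t) /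
    ((μ : ℂ) ^ 2 + (a : ℂ) + (b : ℂ))

end MoyalFour

end

/-!
Put `κ = α (1 - α)`, a real number with the sign of `λ`, and let `ψ` be the solution of
`t (1 + t) ψ'' = -κ ψ` on the half-line with `ψ 0 = 0` and `ψ' 0 = 1`. Energy and Riccati
comparison bound the growth of `ψ`, and integration by parts turns the equation into a two-term
recursion for the moments `m k = ∫ ψ (t + 1) ^ (-(k + 3))`. The resulting product is Euler's product
for the sine, which gives `2 λ m 0 = κ`. By another integration by parts this is exactly what makes
`Z z = z - λ z² ∫ ψ / ((t + 1)² (t + 1 + z))` solve the same differential equation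
off `(-∞, -1]`; hence `Z` continues `ψ`, its Taylor series at `0` identifies it with
`z ₂F₁(α, 1 - α; 2; -z)`, and the formula for `Z` is the Fredholm equation. Scaling by `μ²` gives
the density for every mass, and both natural boundary conditions become `μ² = 2 m 0 = κ / λ`.

On the critical line the real and imaginary parts of `t ↦ Z (-1 / 2 + i t)` solve
`y'' = -κ y / (t² + 1 / 4)`. If `∂G(a, 0) / ∂a` at `a = 0` were `-1`, its real part would force
`∫₀^∞ Im Z' / |Z|² = π μ²`. Replacing `Re Z` by its value `-c` at the centre of the line turns this
integral into `π / (2 c)`, where `4 c m 0 = 1 - κ δ` with `δ > 0`, so the sign of `κ` decides on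
which side of `π μ²` the true value lies: below for `κ < 0`, and above for small `κ > 0`.
-/

open scoped ComplexConjugate

namespace MoyalFour

/-! ### Power series with coefficients of polynomial growth -/

section PowerSeries

open Asymptotics

theorem isBigO_natCast_pow_of_norm_le {E : Type*} [Norm E] {a : ℕ → E} {c : ℝ} {K : ℕ}
    (h : ∀ n, ‖a n‖ ≤ c * ((n : ℝ) + 1) ^ K) : a =O[atTop] fun n : ℕ => (n : ℝ) ^ K := by
  have hshift : (fun n : ℕ => (n : ℝ) + 1) =O[atTop] fun n : ℕ => (n : ℝ) := by
    refine .of_bound 2 ?_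
    filter_upwards [eventually_ge_atTop 1] with n hn
    have hn' : (1 : ℝ) ≤ n := by exact_mod_cast hn
    rw [Real.norm_of_nonneg (by positivity), Real.norm_of_nonneg (by positivity)]
    linarith
  refine (IsBigO.of_bound c (Eventually.of_forall fun n => ?_)).trans (hshift.pow K)
  rw [Real.norm_of_nonneg (by positivity)]
  exact h n

variable {𝕜 : Type*} {a b : ℕ → 𝕜} {y : 𝕜}

theorem summable_norm_mul_pow_of_isBigO [NormedField 𝕜] {K : ℕ}
    (ha : a =O[atTop] fun n : ℕ => (n : ℝ) ^ K) (hy : ‖y‖ < 1) :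
    Summable fun n => ‖a n * y ^ n‖ := by
  have hg : Summable fun n : ℕ => ‖(n : ℝ) ^ K * ‖y‖ ^ n‖ :=
    summable_norm_pow_mul_geometric_of_norm_lt_one K (by simpa using hy)
  refine summable_of_isBigO_nat hg (ha.mul (g₂ := fun n => ‖y‖ ^ n) ?_).norm_norm
  exact .of_bound 1 (by simp)

theorem hasDerivAt_tsum_mul_pow [RCLike 𝕜] {K : ℕ}
    (ha : a =O[atTop] fun n : ℕ => (n : ℝ) ^ K) (hy : ‖y‖ < 1) :
    HasDerivAt (fun x => ∑' n, a n * x ^ n) (∑' n : ℕ, ((n : 𝕜) + 1) * a (n + 1) * y ^ n) y := by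
  obtain ⟨r, hyr, hr1⟩ := exists_between hy
  have hr0 : 0 < r := (norm_nonneg y).trans_lt hyr
  have hbound (n : ℕ) (x : 𝕜) (hx : x ∈ Metric.ball 0 r) :
      ‖a n * (n * x ^ (n - 1))‖ ≤ ‖a n‖ * (n * r ^ (n - 1)) := by
    rw [norm_mul, norm_mul, norm_pow, RCLike.norm_natCast]
    gcongr
    exact (mem_ball_zero_iff.1 hx).le
  have hsum : Summable fun n : ℕ => ‖a n‖ * (n * r ^ (n - 1)) := by
    have h : (fun n => ‖a n‖ * n) =O[atTop] fun n : ℕ => (n : ℝ) ^ (K + 1) :=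
      ha.norm_left.mul (isBigO_refl _ _)
    refine ((summable_norm_mul_pow_of_isBigO h (y := r) ?_).mul_right r⁻¹).congr fun n => ?_
    · rwa [Real.norm_of_nonneg hr0.le]
    · cases n
      · simp
      · rw [Real.norm_of_nonneg (by positivity), pow_succ, Nat.add_sub_cancel]
        field_simp
  have hzero : Summable fun n => a n * (0 : 𝕜) ^ n :=
    (summable_norm_mul_pow_of_isBigO ha (by simp)).of_norm
  have hterm (n : ℕ) (x : 𝕜) (_ : x ∈ Metric.ball 0 r) :
      HasDerivAt (fun x => a n * x ^ n) (a n * (n * x ^ (n - 1))) x :=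
    (hasDerivAt_pow n x).const_mul (a n)
  refine (hasDerivAt_tsum_of_isPreconnected hsum Metric.isOpen_ball
    (convex_ball (0 : 𝕜) r).isPreconnected hterm
    hbound (Metric.mem_ball_self hr0) hzero (mem_ball_zero_iff.2 hyr)).congr_deriv ?_
  rw [(Summable.of_norm_bounded hsum fun n => hbound n y
    (mem_ball_zero_iff.2 hyr)).tsum_eq_zero_add]
  simp only [Nat.cast_zero, zero_mul, mul_zero, zero_add, Nat.add_sub_cancel, Nat.cast_add_one]
  exact tsum_congr fun n => by ring

theorem one_sub_mul_tsum_mul_pow [NormedField 𝕜] (h0 : b 0 = a 0)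
    (h1 : ∀ n, b (n + 1) = a (n + 1) - a n) (ha : Summable fun n => a n * y ^ n) :
    (1 - y) * ∑' n, a n * y ^ n = ∑' n, b n * y ^ n := by
  have hshift : Summable fun n => a (n + 1) * y ^ (n + 1) :=
    (summable_nat_add_iff (f := fun n => a n * y ^ n) 1).2 ha
  have hb_succ (n : ℕ) : b (n + 1) * y ^ (n + 1) =
      a (n + 1) * y ^ (n + 1) - y * (a n * y ^ n) := by
    rw [h1]; ring
  have hb : Summable fun n => b n * y ^ n :=
    (summable_nat_add_iff (f := fun n => b n * y ^ n) 1).1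
      ((hshift.sub (ha.mul_left y)).congr fun n => (hb_succ n).symm)
  rw [hb.tsum_eq_zero_add, sub_mul, one_mul, ← tsum_mul_left, tsum_congr hb_succ,
    hshift.tsum_sub (ha.mul_left y), ha.tsum_eq_zero_add, h0, add_sub_assoc]

end PowerSeries

/-! ### Comparison on the half line -/

section HalfLine

variable {f f' : ℝ → ℝ} {a l t : ℝ}

theorem monotoneOn_Ioi_of_hasDerivAt (hd : ∀ t, a < t → HasDerivAt f (f' t) t)
    (hn : ∀ t, a < t → 0 ≤ f' t) : MonotoneOn f (Ioi a) :=
  monotoneOn_of_hasDerivWithinAt_nonneg (convex_Ioi a)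
    (fun t ht => (hd t ht).continuousAt.continuousWithinAt)
    (by simpa using fun t ht => (hd t ht).hasDerivWithinAt) (by simpa using hn)

theorem antitoneOn_Ioi_of_hasDerivAt (hd : ∀ t, a < t → HasDerivAt f (f' t) t)
    (hn : ∀ t, a < t → f' t ≤ 0) : AntitoneOn f (Ioi a) :=
  antitoneOn_of_hasDerivWithinAt_nonpos (convex_Ioi a)
    (fun t ht => (hd t ht).continuousAt.continuousWithinAt)
    (by simpa using fun t ht => (hd t ht).hasDerivWithinAt) (by simpa using hn)

theorem le_of_tendsto_of_hasDerivAt_nonneg (hd : ∀ t, a < t → HasDerivAt f (f' t) t)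
    (hn : ∀ t, a < t → 0 ≤ f' t) (hl : Tendsto f (𝓝[>] a) (𝓝 l)) (ht : a < t) : l ≤ f t := by
  refine le_of_tendsto hl ?_
  filter_upwards [Ioo_mem_nhdsGT ht] with s hs
  exact monotoneOn_Ioi_of_hasDerivAt hd hn hs.1 ht hs.2.le

theorem le_of_tendsto_of_hasDerivAt_nonpos (hd : ∀ t, a < t → HasDerivAt f (f' t) t)
    (hn : ∀ t, a < t → f' t ≤ 0) (hl : Tendsto f (𝓝[>] a) (𝓝 l)) (ht : a < t) : f t ≤ l := by
  refine ge_of_tendsto hl ?_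
  filter_upwards [Ioo_mem_nhdsGT ht] with s hs
  exact antitoneOn_Ioi_of_hasDerivAt hd hn hs.1 ht hs.2.le

theorem nonpos_of_hasDerivAt_le_mul {L : ℝ} (hd : ∀ t, a < t → HasDerivAt f (f' t) t)
    (hL : ∀ t, a < t → f' t ≤ L * f t) (hl : Tendsto f (𝓝[>] a) (𝓝 0)) (ht : a < t) :
    f t ≤ 0 := by
  have hexp (t : ℝ) : HasDerivAt (fun t => Real.exp (-(L * t))) (Real.exp (-(L * t)) * -L) t := by
    simpa using ((hasDerivAt_id t).const_mul L).neg.exp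
  have hlim : Tendsto (fun t => Real.exp (-(L * t)) * f t) (𝓝[>] a) (𝓝 0) := by
    simpa using ((hexp a).continuousAt.tendsto.mono_left nhdsWithin_le_nhds).mul hl
  have hle := le_of_tendsto_of_hasDerivAt_nonpos (fun t ht => (hexp t).fun_mul (hd t ht))
    (fun t ht => by nlinarith [Real.exp_pos (-(L * t)), hL t ht]) hlim ht
  exact nonpos_of_mul_nonpos_right hle (Real.exp_pos _)

theorem abs_sub_le_of_hasDerivAt {b B : ℝ} (hab : a ≤ b) (hc : ContinuousOn f (Icc a b))
    (hd : ∀ s ∈ Ioo a b, HasDerivAt f (f' s) s) (hB : ∀ s ∈ Ioo a b, |f' s| ≤ B) :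
    |f b - f a| ≤ B * (b - a) := by
  rcases hab.eq_or_lt with rfl | hab
  · simp
  obtain ⟨c, hc, hslope⟩ := exists_hasDerivAt_eq_slope f f' hab hc hd
  rw [eq_div_iff (sub_pos.2 hab).ne'] at hslope
  rw [← hslope, abs_mul, abs_of_pos (sub_pos.2 hab)]
  exact mul_le_mul_of_nonneg_right (hB c hc) (sub_pos.2 hab).le

end HalfLine

/-! ### Linear second order equations on the half line -/

/-- `y` solves `y'' = -q y` on `(0, ∞)`, where `q` may be singular at the origin but `y` and `y'`
are regular there. -/
structure IsRegularSolution (q y y' : ℝ → ℝ) : Prop where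
  hasDerivAt : ∀ t, 0 ≤ t → HasDerivAt y (y' t) t
  hasDerivAt_deriv : ∀ t, 0 < t → HasDerivAt y' (-(q t) * y t) t
  continuousAt_deriv_zero : ContinuousAt y' 0

namespace IsRegularSolution

variable {q y y' : ℝ → ℝ} {t : ℝ}

theorem continuousAt (S : IsRegularSolution q y y') (ht : 0 ≤ t) : ContinuousAt y t :=
  (S.hasDerivAt t ht).continuousAt

theorem continuousAt_deriv (S : IsRegularSolution q y y') (ht : 0 ≤ t) : ContinuousAt y' t := by
  rcases ht.eq_or_lt with rfl | ht
  · exact S.continuousAt_deriv_zero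
  · exact (S.hasDerivAt_deriv t ht).continuousAt

theorem abs_sub_zero_le (S : IsRegularSolution q y y') {B : ℝ} (ht : 0 ≤ t)
    (hB : ∀ s, 0 < s → s < t → |y' s| ≤ B) : |y t - y 0| ≤ B * t := by
  simpa using abs_sub_le_of_hasDerivAt ht
    (fun s hs => (S.continuousAt hs.1).continuousWithinAt)
    (fun s hs => S.hasDerivAt s hs.1.le) fun s hs => hB s hs.1 hs.2

theorem tendsto_zero (S : IsRegularSolution q y y') : Tendsto y (𝓝[>] 0) (𝓝 (y 0)) :=
  (S.continuousAt le_rfl).tendsto.mono_left nhdsWithin_le_nhds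

theorem tendsto_deriv_zero (S : IsRegularSolution q y y') : Tendsto y' (𝓝[>] 0) (𝓝 (y' 0)) :=
  S.continuousAt_deriv_zero.tendsto.mono_left nhdsWithin_le_nhds

theorem tendsto_div (S : IsRegularSolution q y y') (h0 : y 0 = 0) :
    Tendsto (fun t => y t / t) (𝓝[>] 0) (𝓝 (y' 0)) := by
  simpa [h0, div_eq_inv_mul] using (S.hasDerivAt 0 le_rfl).tendsto_slope_zero_right

theorem tendsto_sq_div (S : IsRegularSolution q y y') (h0 : y 0 = 0) :
    Tendsto (fun t => y t ^ 2 / t) (𝓝[>] 0) (𝓝 0) := by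
  have h := (S.tendsto_div h0).mul S.tendsto_zero
  rw [h0, mul_zero] at h
  exact h.congr fun t => by ring

theorem hasDerivAt_sq (S : IsRegularSolution q y y') (ht : 0 ≤ t) :
    HasDerivAt (fun t => y t ^ 2) (2 * (y t * y' t)) t :=
  ((S.hasDerivAt t ht).fun_pow 2).congr_deriv (by push_cast; ring)

theorem hasDerivAt_energy (S : IsRegularSolution q y y') {p : ℝ → ℝ} {p' : ℝ} (ht : 0 < t)
    (hp : HasDerivAt p p' t) :
    HasDerivAt (fun t => y' t ^ 2 + p t * y t ^ 2)
      (2 * (p t - q t) * (y t * y' t) + p' * y t ^ 2) t :=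
  (((S.hasDerivAt_deriv t ht).fun_pow 2).fun_add (hp.fun_mul (S.hasDerivAt_sq ht.le))).congr_deriv
    (by push_cast; ring)

theorem deriv_sq_le_of_potential_antitone (S : IsRegularSolution q y y') {q' : ℝ → ℝ} {l : ℝ}
    (hq : ∀ t, 0 < t → 0 ≤ q t) (hd : ∀ t, 0 < t → HasDerivAt q (q' t) t)
    (hq' : ∀ t, 0 < t → q' t ≤ 0) (hl : Tendsto (fun t => q t * y t ^ 2) (𝓝[>] 0) (𝓝 l))
    (ht : 0 < t) : y' t ^ 2 ≤ y' 0 ^ 2 + l := by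
  have henergy := le_of_tendsto_of_hasDerivAt_nonpos
    (fun t ht => S.hasDerivAt_energy ht (hd t ht))
    (fun t ht => by
      rw [sub_self, mul_zero, zero_mul, zero_add]
      exact mul_nonpos_of_nonpos_of_nonneg (hq' t ht) (sq_nonneg _))
    ((S.tendsto_deriv_zero.pow 2).add hl) ht
  linarith [mul_nonneg (hq t ht) (sq_nonneg (y t))]

theorem mul_sq_div_le (S : IsRegularSolution q y y') (h0 : y 0 = 0) {β : ℝ}
    (hq : ∀ t, 0 < t → q t * t ^ 2 ≤ β * (1 - β)) (ht : 0 < t) :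
    β * (y t ^ 2 / t) ≤ y t * y' t := by
  have hd (t : ℝ) (ht : 0 < t) : HasDerivAt (fun t => y t * y' t - β * (y t ^ 2 / t))
      ((y' t - β * y t / t) ^ 2 + (β * (1 - β) - q t * t ^ 2) * (y t / t) ^ 2) t := by
    refine (((S.hasDerivAt t ht.le).fun_mul (S.hasDerivAt_deriv t ht)).fun_sub
      (((S.hasDerivAt_sq ht.le).fun_div (hasDerivAt_id t) ht.ne').const_mul β)).congr_deriv ?_
    simp only [id]
    field_simp
    ring
  have hl : Tendsto (fun t => y t * y' t - β * (y t ^ 2 / t)) (𝓝[>] 0) (𝓝 0) := by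
    simpa [h0] using
      (S.tendsto_zero.mul S.tendsto_deriv_zero).sub ((S.tendsto_sq_div h0).const_mul β)
  have hle := le_of_tendsto_of_hasDerivAt_nonneg hd (fun t ht =>
    add_nonneg (sq_nonneg _) (mul_nonneg (sub_nonneg.2 (hq t ht)) (sq_nonneg _))) hl ht
  exact sub_nonneg.1 hle

theorem eventually_pos (S : IsRegularSolution q y y') (h0 : y 0 = 0) (h1 : 0 < y' 0) :
    ∀ᶠ t in 𝓝[>] 0, 0 < y t := by
  filter_upwards [(S.tendsto_div h0).eventually_const_lt h1, self_mem_nhdsWithin] with t ht ht0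
  exact (div_pos_iff_of_pos_right ht0).1 ht

theorem pos (S : IsRegularSolution q y y') (h0 : y 0 = 0) (h1 : 0 < y' 0) {β : ℝ} (hβ : 0 ≤ β)
    (hq : ∀ t, 0 < t → q t * t ^ 2 ≤ β * (1 - β)) (ht : 0 < t) : 0 < y t := by
  have hmono : MonotoneOn (fun t => y t ^ 2) (Ioi 0) :=
    monotoneOn_Ioi_of_hasDerivAt (fun t ht => S.hasDerivAt_sq (le_of_lt ht)) fun t ht => by
      have : 0 ≤ β * (y t ^ 2 / t) := mul_nonneg hβ (div_nonneg (sq_nonneg _) ht.le)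
      linarith [S.mul_sq_div_le h0 hq ht]
  obtain ⟨s, hys, hs0, hst⟩ := ((S.eventually_pos h0 h1).and (Ioo_mem_nhdsGT ht)).exists
  by_contra! hneg
  obtain ⟨r, hr, hyr⟩ := intermediate_value_Icc' hst.le
    (fun r hr => (S.continuousAt (hs0.le.trans hr.1)).continuousWithinAt) ⟨hneg, hys.le⟩
  have h : y s ^ 2 ≤ y r ^ 2 := hmono hs0 (hs0.trans_le hr.1) hr.1
  rw [hyr] at h
  nlinarith

theorem mul_div_le (S : IsRegularSolution q y y') (h0 : y 0 = 0) (h1 : 0 < y' 0) {β : ℝ}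
    (hβ : 0 ≤ β) (hq : ∀ t, 0 < t → q t * t ^ 2 ≤ β * (1 - β)) (ht : 0 < t) :
    β * y t / t ≤ y' t := by
  refine le_of_mul_le_mul_left ((le_of_eq ?_).trans (S.mul_sq_div_le h0 hq ht))
    (S.pos h0 h1 hβ hq ht)
  ring

theorem hasDerivAt_mul_rpow (S : IsRegularSolution q y y') (ht : 0 < t) (γ : ℝ) :
    HasDerivAt (fun t => y t * t ^ (-γ)) (t ^ (-γ) * (y' t - γ * y t / t)) t := by
  refine ((S.hasDerivAt t ht.le).mul
    (Real.hasDerivAt_rpow_const (Or.inl ht.ne'))).congr_deriv ?_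
  rw [Real.rpow_sub_one ht.ne']
  ring

theorem monotoneOn_mul_rpow (S : IsRegularSolution q y y') (h0 : y 0 = 0) (h1 : 0 < y' 0) {β : ℝ}
    (hβ : 0 ≤ β) (hq : ∀ t, 0 < t → q t * t ^ 2 ≤ β * (1 - β)) :
    MonotoneOn (fun t => y t * t ^ (-β)) (Ioi 0) :=
  monotoneOn_Ioi_of_hasDerivAt (fun _ ht => S.hasDerivAt_mul_rpow ht β) fun _ ht =>
    mul_nonneg (Real.rpow_nonneg ht.le _) (sub_nonneg.2 (S.mul_div_le h0 h1 hβ hq ht))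

theorem deriv_le_mul_div (S : IsRegularSolution q y y') (h0 : y 0 = 0)
    (hy : ∀ t, 0 < t → 0 ≤ y t) {γ : ℝ} (hγ : 1 ≤ γ)
    (hq : ∀ t, 0 < t → γ * (1 - γ) ≤ q t * t ^ 2) (ht : 0 < t) : y' t ≤ γ * y t / t := by
  have hd (t : ℝ) (ht : 0 < t) : HasDerivAt (fun t => t ^ (γ - 1) * (t * y' t - γ * y t))
      (-(t ^ (γ - 1) / t * y t * (q t * t ^ 2 - γ * (1 - γ)))) t := by
    refine ((Real.hasDerivAt_rpow_const (Or.inl ht.ne')).fun_mul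
      (((hasDerivAt_id t).fun_mul (S.hasDerivAt_deriv t ht)).fun_sub
        ((S.hasDerivAt t ht.le).const_mul γ))).congr_deriv ?_
    rw [Real.rpow_sub_one ht.ne' (γ - 1)]
    simp only [id]
    field_simp
    ring
  have hl : Tendsto (fun t => t ^ (γ - 1) * (t * y' t - γ * y t)) (𝓝[>] 0) (𝓝 0) := by
    have hid : Tendsto (fun t : ℝ => t) (𝓝[>] 0) (𝓝 0) := nhdsWithin_le_nhds
    have hpow := hid.rpow_const (p := γ - 1) (Or.inr (sub_nonneg.2 hγ))
    simpa [h0] using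
      hpow.mul ((hid.mul S.tendsto_deriv_zero).sub (S.tendsto_zero.const_mul γ))
  have hle := le_of_tendsto_of_hasDerivAt_nonpos hd (fun t ht => neg_nonpos.2 <|
    mul_nonneg (mul_nonneg (div_nonneg (Real.rpow_nonneg ht.le _) ht.le) (hy t ht))
      (sub_nonneg.2 (hq t ht))) hl ht
  rw [le_div_iff₀ ht]
  linarith [nonpos_of_mul_nonpos_right hle (Real.rpow_pos_of_pos ht _)]

theorem antitoneOn_mul_rpow (S : IsRegularSolution q y y') (h0 : y 0 = 0)
    (hy : ∀ t, 0 < t → 0 ≤ y t) {γ : ℝ} (hγ : 1 ≤ γ)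
    (hq : ∀ t, 0 < t → γ * (1 - γ) ≤ q t * t ^ 2) :
    AntitoneOn (fun t => y t * t ^ (-γ)) (Ioi 0) :=
  antitoneOn_Ioi_of_hasDerivAt (fun _ ht => S.hasDerivAt_mul_rpow ht γ) fun _ ht =>
    mul_nonpos_of_nonneg_of_nonpos (Real.rpow_nonneg ht.le _)
      (sub_nonpos.2 (S.deriv_le_mul_div h0 hy hγ hq ht))

theorem sub {z z' : ℝ → ℝ} (S : IsRegularSolution q y y') (T : IsRegularSolution q z z') :
    IsRegularSolution q (y - z) (y' - z') where
  hasDerivAt t ht := (S.hasDerivAt t ht).sub (T.hasDerivAt t ht)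
  hasDerivAt_deriv t ht :=
    ((S.hasDerivAt_deriv t ht).sub (T.hasDerivAt_deriv t ht)).congr_deriv
      (by simp only [Pi.sub_apply]; ring)
  continuousAt_deriv_zero := S.continuousAt_deriv_zero.sub T.continuousAt_deriv_zero

theorem eq_zero (S : IsRegularSolution q y y') (h0 : y 0 = 0) (h1 : y' 0 = 0) {A : ℝ}
    (hq : ∀ t, 0 < t → |q t| * t ≤ A) (ht : 0 ≤ t) : y t = 0 := by
  rcases ht.eq_or_lt with rfl | ht
  · exact h0
  have hgronwall (t : ℝ) (ht : 0 < t) : 2 * (t⁻¹ - q t) * (y t * y' t) + -(t ^ 2)⁻¹ * y t ^ 2 ≤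
      (1 + A) ^ 2 * (y' t ^ 2 + t⁻¹ * y t ^ 2) := by
    have hcross : (1 - q t * t) ^ 2 ≤ (1 + A) ^ 2 := by
      refine sq_le_sq' ?_ ?_ <;>
      · have := hq t ht
        rw [← abs_of_pos ht, ← abs_mul, abs_of_pos ht] at this
        linarith [abs_le.1 this]
    have hamgm : 2 * (t⁻¹ - q t) * (y t * y' t) + -(t ^ 2)⁻¹ * y t ^ 2 =
        (1 - q t * t) ^ 2 * y' t ^ 2 - ((1 - q t * t) * y' t - y t / t) ^ 2 := by
      field_simp
      ring
    have hy2 : 0 ≤ t⁻¹ * y t ^ 2 := mul_nonneg (inv_nonneg.2 ht.le) (sq_nonneg _)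
    rw [hamgm]
    nlinarith [mul_le_mul_of_nonneg_right hcross (sq_nonneg (y' t)),
      sq_nonneg ((1 - q t * t) * y' t - y t / t), mul_nonneg (sq_nonneg (1 + A)) hy2]
  have hlim : Tendsto (fun t => y' t ^ 2 + t⁻¹ * y t ^ 2) (𝓝[>] 0) (𝓝 0) := by
    simpa [h1, div_eq_inv_mul] using (S.tendsto_deriv_zero.pow 2).add (S.tendsto_sq_div h0)
  have henergy := nonpos_of_hasDerivAt_le_mul
    (fun t ht => S.hasDerivAt_energy ht (hasDerivAt_inv ht.ne')) hgronwall hlim ht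
  have hy2 : t⁻¹ * y t ^ 2 ≤ 0 := by linarith [sq_nonneg (y' t)]
  exact pow_eq_zero_iff two_ne_zero |>.1
    ((nonpos_of_mul_nonpos_right hy2 (inv_pos.2 ht)).antisymm (sq_nonneg _))

end IsRegularSolution

/-! ### The hypergeometric equation on the half line -/

section Series

open Asymptotics

/-- The Taylor coefficients of `dψ/dy` and of `(1 - y) dψ/dy`, where `ψ` is the solution of
`x (x + 1) ψ'' = -κ ψ` with `ψ(0) = 0` and `ψ'(0) = 1`, written in the variable `y = x / (1 + x)`,
which maps `[0, ∞)` onto `[0, 1)`. -/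
noncomputable def slopeCoeff (κ : ℝ) : ℕ → ℝ × ℝ
  | 0 => (1, 1)
  | n + 1 =>
    let q := (slopeCoeff κ n).2 - κ * (slopeCoeff κ n).1 / ((n : ℝ) + 1) ^ 2
    ((slopeCoeff κ n).1 + q, q)

/-- The Taylor coefficients of the solution `ψ` in the variable `y = x / (1 + x)`. -/
noncomputable def solCoeff (κ : ℝ) : ℕ → ℝ
  | 0 => 0
  | n + 1 => (slopeCoeff κ n).1 / (n + 1)

/-- The Taylor coefficients of `dψ/dx = (1 - y)² dψ/dy` in the variable `y = x / (1 + x)`. -/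
noncomputable def solDerivCoeff (κ : ℝ) : ℕ → ℝ
  | 0 => 1
  | n + 1 => (slopeCoeff κ (n + 1)).2 - (slopeCoeff κ n).2

variable {κ y : ℝ}

theorem slopeCoeff_succ_snd (κ : ℝ) (n : ℕ) : (slopeCoeff κ (n + 1)).2 =
    (slopeCoeff κ n).2 - κ * (slopeCoeff κ n).1 / ((n : ℝ) + 1) ^ 2 := rfl

theorem slopeCoeff_succ_fst (κ : ℝ) (n : ℕ) :
    (slopeCoeff κ (n + 1)).1 = (slopeCoeff κ n).1 + (slopeCoeff κ (n + 1)).2 := rfl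

theorem add_one_mul_solDerivCoeff_succ (κ : ℝ) (n : ℕ) :
    ((n : ℝ) + 1) * solDerivCoeff κ (n + 1) = -κ * solCoeff κ (n + 1) := by
  rw [solDerivCoeff, solCoeff, slopeCoeff_succ_snd]
  field_simp
  ring

theorem abs_slopeCoeff_le {K : ℕ} (hK : |κ| ≤ K) (n : ℕ) :
    |(slopeCoeff κ n).1| ≤ ((n : ℝ) + 1) ^ (K + 1) ∧
      |(slopeCoeff κ n).2| ≤ ((n : ℝ) + 1) ^ K := by
  induction n with
  | zero => simp [slopeCoeff]
  | succ n ih =>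
    obtain ⟨hfst, hsnd⟩ := ih
    have hbernoulli : 1 + (K : ℝ) * (1 / ((n : ℝ) + 1)) ≤ (1 + 1 / ((n : ℝ) + 1)) ^ K :=
      one_add_mul_le_pow (by linarith [show 0 ≤ 1 / ((n : ℝ) + 1) by positivity]) K
    have hsnd' : |(slopeCoeff κ (n + 1)).2| ≤ ((n : ℝ) + 1 + 1) ^ K := by
      calc |(slopeCoeff κ (n + 1)).2|
          ≤ |(slopeCoeff κ n).2| + |κ * (slopeCoeff κ n).1 / ((n : ℝ) + 1) ^ 2| := by
            rw [slopeCoeff_succ_snd]; exact abs_sub _ _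
        _ ≤ ((n : ℝ) + 1) ^ K + K * ((n : ℝ) + 1) ^ (K + 1) / ((n : ℝ) + 1) ^ 2 := by
            rw [abs_div, abs_mul, abs_of_pos (by positivity : 0 < ((n : ℝ) + 1) ^ 2)]
            gcongr
        _ = ((n : ℝ) + 1) ^ K * (1 + K * (1 / ((n : ℝ) + 1))) := by
            field_simp
            ring
        _ ≤ ((n : ℝ) + 1) ^ K * (1 + 1 / ((n : ℝ) + 1)) ^ K := by gcongr
        _ = _ := by rw [← mul_pow, mul_add, mul_one, mul_one_div_cancel (by positivity)]
    push_cast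
    refine ⟨?_, hsnd'⟩
    calc |(slopeCoeff κ (n + 1)).1| ≤ |(slopeCoeff κ n).1| + |(slopeCoeff κ (n + 1)).2| := by
          rw [slopeCoeff_succ_fst]; exact abs_add_le _ _
      _ ≤ ((n : ℝ) + 1) ^ (K + 1) + ((n : ℝ) + 1 + 1) ^ K := add_le_add hfst hsnd'
      _ ≤ ((n : ℝ) + 1) * ((n : ℝ) + 1 + 1) ^ K + ((n : ℝ) + 1 + 1) ^ K := by
          rw [pow_succ']
          gcongr
          linarith
      _ = _ := by ring

theorem slopeCoeff_fst_isBigO {K : ℕ} (hK : |κ| ≤ K) :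
    (fun n => (slopeCoeff κ n).1) =O[atTop] fun n : ℕ => (n : ℝ) ^ (K + 1) :=
  isBigO_natCast_pow_of_norm_le (c := 1) fun n => by simpa using (abs_slopeCoeff_le hK n).1

theorem slopeCoeff_snd_isBigO {K : ℕ} (hK : |κ| ≤ K) :
    (fun n => (slopeCoeff κ n).2) =O[atTop] fun n : ℕ => (n : ℝ) ^ K :=
  isBigO_natCast_pow_of_norm_le (c := 1) fun n => by simpa using (abs_slopeCoeff_le hK n).2

theorem solCoeff_isBigO {K : ℕ} (hK : |κ| ≤ K) :
    solCoeff κ =O[atTop] fun n : ℕ => (n : ℝ) ^ (K + 1) := by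
  refine isBigO_natCast_pow_of_norm_le (c := 1) fun n => ?_
  rw [one_mul, Real.norm_eq_abs]
  cases n with
  | zero => simp [solCoeff]
  | succ n =>
    rw [solCoeff, abs_div, abs_of_pos (by positivity : (0 : ℝ) < n + 1)]
    push_cast
    calc _ ≤ |(slopeCoeff κ n).1| := div_le_self (abs_nonneg _) (by simp)
      _ ≤ ((n : ℝ) + 1) ^ (K + 1) := (abs_slopeCoeff_le hK n).1
      _ ≤ _ := by gcongr; linarith

theorem solDerivCoeff_isBigO {K : ℕ} (hK : |κ| ≤ K) :
    solDerivCoeff κ =O[atTop] fun n : ℕ => (n : ℝ) ^ K := by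
  refine isBigO_natCast_pow_of_norm_le (c := 2) fun n => ?_
  rw [Real.norm_eq_abs]
  cases n with
  | zero => simp [solDerivCoeff]
  | succ n =>
    have hsucc := (abs_slopeCoeff_le hK (n + 1)).2
    push_cast at hsucc ⊢
    have hmono : ((n : ℝ) + 1) ^ K ≤ ((n : ℝ) + 1 + 1) ^ K := by gcongr; linarith
    exact (abs_sub _ _).trans (by linarith [(abs_slopeCoeff_le hK n).2])

theorem tsum_solCoeff_mul_pow (κ : ℝ) (hy : ‖y‖ < 1) :
    ∑' n, solCoeff κ n * y ^ n = y * ∑' n, solCoeff κ (n + 1) * y ^ n := by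
  obtain ⟨K, hK⟩ := exists_nat_ge |κ|
  rw [(summable_norm_mul_pow_of_isBigO (solCoeff_isBigO hK) hy).of_norm.tsum_eq_zero_add,
    ← tsum_mul_left, solCoeff, zero_mul, zero_add]
  exact tsum_congr fun n => by ring

theorem one_sub_sq_mul_tsum_slopeCoeff (κ : ℝ) (hy : ‖y‖ < 1) :
    (1 - y) ^ 2 * ∑' n, (slopeCoeff κ n).1 * y ^ n = ∑' n, solDerivCoeff κ n * y ^ n := by
  obtain ⟨K, hK⟩ := exists_nat_ge |κ|
  have hfst : (1 - y) * ∑' n, (slopeCoeff κ n).1 * y ^ n = ∑' n, (slopeCoeff κ n).2 * y ^ n :=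
    one_sub_mul_tsum_mul_pow rfl (fun n => by rw [slopeCoeff_succ_fst]; ring)
      (summable_norm_mul_pow_of_isBigO (slopeCoeff_fst_isBigO hK) hy).of_norm
  have hsnd : (1 - y) * ∑' n, (slopeCoeff κ n).2 * y ^ n = ∑' n, solDerivCoeff κ n * y ^ n :=
    one_sub_mul_tsum_mul_pow rfl (fun _ => rfl)
      (summable_norm_mul_pow_of_isBigO (slopeCoeff_snd_isBigO hK) hy).of_norm
  rw [← hsnd, ← hfst]
  ring

theorem hasDerivAt_tsum_solCoeff (κ : ℝ) (hy : ‖y‖ < 1) :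
    HasDerivAt (fun y => ∑' n, solCoeff κ n * y ^ n)
      ((∑' n, solDerivCoeff κ n * y ^ n) / (1 - y) ^ 2) y := by
  obtain ⟨K, hK⟩ := exists_nat_ge |κ|
  refine (hasDerivAt_tsum_mul_pow (solCoeff_isBigO hK) hy).congr_deriv ?_
  have hy1 : 1 - y ≠ 0 := sub_ne_zero.2 fun h => by simp [← h] at hy
  rw [← one_sub_sq_mul_tsum_slopeCoeff κ hy, mul_div_cancel_left₀ _ (pow_ne_zero 2 hy1)]
  refine tsum_congr fun n => ?_
  rw [solCoeff, mul_div_cancel₀ _ (by positivity : ((n : ℝ) + 1) ≠ 0)]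

theorem hasDerivAt_tsum_solDerivCoeff (κ : ℝ) (hy : ‖y‖ < 1) :
    HasDerivAt (fun y => ∑' n, solDerivCoeff κ n * y ^ n)
      (-κ * ∑' n, solCoeff κ (n + 1) * y ^ n) y := by
  obtain ⟨K, hK⟩ := exists_nat_ge |κ|
  refine (hasDerivAt_tsum_mul_pow (solDerivCoeff_isBigO hK) hy).congr_deriv ?_
  rw [← tsum_mul_left]
  exact tsum_congr fun n => by rw [add_one_mul_solDerivCoeff_succ]; ring

theorem norm_div_one_add_lt_one {x : ℝ} (hx : 0 ≤ x) : ‖x / (1 + x)‖ < 1 := by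
  rw [Real.norm_of_nonneg (by positivity), div_lt_one (by positivity)]
  linarith

theorem hasDerivAt_div_one_add {x : ℝ} (hx : 0 ≤ x) :
    HasDerivAt (fun x : ℝ => x / (1 + x)) (1 / (1 + x) ^ 2) x := by
  refine ((hasDerivAt_id x).fun_div ((hasDerivAt_id x).const_add 1)
    (by simp only [id]; positivity)).congr_deriv ?_
  simp only [id]
  ring

theorem exists_isRegularSolution (κ : ℝ) : ∃ ψ ψ' : ℝ → ℝ,
    IsRegularSolution (fun t => κ / (t * (t + 1))) ψ ψ' ∧ ψ 0 = 0 ∧ ψ' 0 = 1 := by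
  have hψ (x : ℝ) (hx : 0 ≤ x) := HasDerivAt.comp x
    (hasDerivAt_tsum_solCoeff κ (norm_div_one_add_lt_one hx)) (hasDerivAt_div_one_add hx)
  have hψ' (x : ℝ) (hx : 0 ≤ x) := HasDerivAt.comp x
    (hasDerivAt_tsum_solDerivCoeff κ (norm_div_one_add_lt_one hx)) (hasDerivAt_div_one_add hx)
  refine ⟨_, _, ⟨fun x hx => (hψ x hx).congr_deriv ?_, fun x hx => (hψ' x hx.le).congr_deriv ?_,
    (hψ' 0 le_rfl).continuousAt⟩, ?_, ?_⟩
  · have h : 1 - x / (1 + x) = 1 / (1 + x) := by field_simp; ring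
    rw [h]
    simp only [Function.comp_apply]
    field_simp
  · simp only [Function.comp_apply]
    rw [tsum_solCoeff_mul_pow κ (norm_div_one_add_lt_one hx.le)]
    field_simp
    ring
  · simp [tsum_solCoeff_mul_pow]
  · simp only [Function.comp_apply, zero_div]
    rw [tsum_eq_single 0 fun n hn => by rw [zero_pow hn, mul_zero], solDerivCoeff, pow_zero,
      mul_one]

end Series

section Growth

variable {κ t : ℝ} {ψ ψ' : ℝ → ℝ}

theorem hyp_potential_mul_sq (κ : ℝ) (ht : 0 < t) :
    κ / (t * (t + 1)) * t ^ 2 = κ * (t / (t + 1)) := by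
  field_simp

theorem div_add_one_le_one (ht : 0 < t) : t / (t + 1) ≤ 1 := by
  rw [div_le_one (by positivity)]; linarith

theorem hyp_potential_mul_sq_le {b : ℝ} (hb : 0 ≤ b) (hκ : κ ≤ b) (ht : 0 < t) :
    κ / (t * (t + 1)) * t ^ 2 ≤ b := by
  rw [hyp_potential_mul_sq κ ht]
  have h0 : 0 ≤ t / (t + 1) := by positivity
  nlinarith [div_add_one_le_one ht]

theorem le_hyp_potential_mul_sq {b : ℝ} (hb : b ≤ 0) (hκ : b ≤ κ) (ht : 0 < t) :
    b ≤ κ / (t * (t + 1)) * t ^ 2 := by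
  have h := hyp_potential_mul_sq_le (neg_nonneg.2 hb) (neg_le_neg hκ) ht
  rw [neg_div, neg_mul] at h
  exact neg_le_neg_iff.1 h

theorem hyp_solution_pos (hκ : κ ≤ 1 / 4)
    (S : IsRegularSolution (fun t => κ / (t * (t + 1))) ψ ψ') (h0 : ψ 0 = 0) (h1 : 0 < ψ' 0)
    (ht : 0 < t) : 0 < ψ t :=
  S.pos h0 h1 (β := 1 / 2) (by norm_num)
    (fun _ ht => hyp_potential_mul_sq_le (by norm_num) (by linarith) ht) ht

theorem abs_deriv_le_of_nonneg (hκ : 0 ≤ κ)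
    (S : IsRegularSolution (fun t => κ / (t * (t + 1))) ψ ψ') (h0 : ψ 0 = 0) (ht : 0 ≤ t) :
    |ψ' t| ≤ |ψ' 0| := by
  rcases ht.eq_or_lt with rfl | ht
  · rfl
  have hd (t : ℝ) (ht : 0 < t) : HasDerivAt (fun t => κ / (t * (t + 1)))
      (-(κ * (2 * t + 1) / (t * (t + 1)) ^ 2)) t := by
    refine ((hasDerivAt_const t κ).fun_div ((hasDerivAt_id t).fun_mul
      ((hasDerivAt_id t).add_const 1)) (by simp only [id]; positivity)).congr_deriv ?_
    simp only [id]
    ring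
  have hl : Tendsto (fun t => κ / (t * (t + 1)) * ψ t ^ 2) (𝓝[>] 0) (𝓝 0) := by
    have hfac : Tendsto (fun t : ℝ => κ / (t + 1)) (𝓝[>] 0) (𝓝 (κ / (0 + 1))) :=
      (continuousAt_const.div (by fun_prop) (by simp)).tendsto.mono_left nhdsWithin_le_nhds
    have h := hfac.mul (S.tendsto_sq_div h0)
    rw [mul_zero] at h
    exact h.congr fun t => by rw [div_mul_div_comm, mul_comm (t + 1), div_mul_eq_mul_div]
  have h := S.deriv_sq_le_of_potential_antitone (fun t ht => by positivity) hd
    (fun t ht => neg_nonpos.2 (by positivity)) hl ht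
  exact sq_le_sq.1 (by linarith)

theorem abs_deriv_le_of_one_le (hκ : -(3 / 4) ≤ κ) (hκ' : κ ≤ 0)
    (S : IsRegularSolution (fun t => κ / (t * (t + 1))) ψ ψ') (h0 : ψ 0 = 0) (h1 : 0 < ψ' 0)
    (ht : 1 ≤ t) : |ψ' t| ≤ 3 / 2 * ψ 1 * √t := by
  have ht0 : 0 < t := one_pos.trans_le ht
  have hpos : ∀ t, 0 < t → 0 ≤ ψ t := fun _ ht =>
    (hyp_solution_pos (by linarith) S h0 h1 ht).le
  have hnonneg : 0 ≤ ψ' t := by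
    simpa using S.mul_div_le h0 h1 (β := 0) le_rfl
      (fun t ht => hyp_potential_mul_sq_le (by norm_num) (by linarith) ht) ht0
  have hpot : ∀ t : ℝ, 0 < t → 3 / 2 * (1 - 3 / 2) ≤ κ / (t * (t + 1)) * t ^ 2 := fun _ ht =>
    le_hyp_potential_mul_sq (by norm_num) (by linarith) ht
  have hgrowth : ψ t * t ^ (-(3 / 2) : ℝ) ≤ ψ 1 := by
    simpa using S.antitoneOn_mul_rpow h0 hpos (by norm_num) hpot (mem_Ioi.2 one_pos) ht0 ht
  have hpow : √t * t = t ^ (3 / 2 : ℝ) := by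
    rw [Real.sqrt_eq_rpow, ← Real.rpow_add_one ht0.ne']
    norm_num
  rw [Real.rpow_neg ht0.le, ← div_eq_mul_inv, div_le_iff₀ (by positivity), ← hpow] at hgrowth
  rw [abs_of_nonneg hnonneg]
  calc ψ' t ≤ 3 / 2 * ψ t / t := S.deriv_le_mul_div h0 hpos (by norm_num) hpot ht0
    _ ≤ 3 / 2 * (ψ 1 * (√t * t)) / t := by gcongr
    _ = 3 / 2 * ψ 1 * √t := by field_simp

theorem exists_abs_deriv_le (hκ : -(3 / 4) ≤ κ)
    (S : IsRegularSolution (fun t => κ / (t * (t + 1))) ψ ψ') (h0 : ψ 0 = 0) (h1 : 0 < ψ' 0) :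
    ∃ C, 0 ≤ C ∧ ∀ t, 0 ≤ t → |ψ' t| ≤ C * √(1 + t) := by
  have hsqrt (t : ℝ) (ht : 0 ≤ t) : 1 ≤ √(1 + t) := Real.one_le_sqrt.2 (by linarith)
  rcases le_total 0 κ with h | h
  · exact ⟨|ψ' 0|, abs_nonneg _, fun t ht => (abs_deriv_le_of_nonneg h S h0 ht).trans
      (le_mul_of_one_le_right (abs_nonneg _) (hsqrt t ht))⟩
  obtain ⟨B, hB⟩ := (isCompact_Icc (a := (0 : ℝ)) (b := 1)).exists_bound_of_continuousOn
    fun t ht => (S.continuousAt_deriv ht.1).continuousWithinAt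
  have hB0 : 0 ≤ B := (norm_nonneg _).trans (hB 0 (by simp))
  have hψ1 := hyp_solution_pos (by linarith) S h0 h1 one_pos
  refine ⟨max B (3 / 2 * ψ 1), le_max_of_le_left hB0, fun t ht => ?_⟩
  rcases le_total t 1 with ht1 | ht1
  · exact (hB t ⟨ht, ht1⟩).trans ((le_mul_of_one_le_right hB0 (hsqrt t ht)).trans
      (by gcongr; exact le_max_left _ _))
  · refine (abs_deriv_le_of_one_le hκ h S h0 h1 ht1).trans ?_
    gcongr
    · exact le_max_right _ _
    · linarith

end Growth

/-- `ψ` is the solution of `t (t + 1) ψ'' = -κ ψ` with `ψ(0) = 0` and `ψ'(0) = 1`, and its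
derivative grows at most like `√t`. -/
structure IsProfile (κ : ℝ) (ψ ψ' : ℝ → ℝ) : Prop where
  sol : IsRegularSolution (fun t => κ / (t * (t + 1))) ψ ψ'
  zero : ψ 0 = 0
  deriv_zero : ψ' 0 = 1
  exists_abs_deriv_le : ∃ C, 0 ≤ C ∧ ∀ t, 0 ≤ t → |ψ' t| ≤ C * √(1 + t)

theorem exists_isProfile {κ : ℝ} (hκ : -(3 / 4) ≤ κ) : ∃ ψ ψ', IsProfile κ ψ ψ' := by
  obtain ⟨ψ, ψ', S, h0, h1⟩ := exists_isRegularSolution κ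
  exact ⟨ψ, ψ', S, h0, h1, exists_abs_deriv_le hκ S h0 (h1 ▸ one_pos)⟩

/-! ### Moments of the profile -/

section InversePowers

theorem integrableOn_sqrt_div_sq :
    IntegrableOn (fun t : ℝ => √(1 + t) / (t + 1) ^ 2) (Ioi 0) := by
  have h := integrableOn_add_rpow_Ioi_of_lt (a := -(3 / 2)) (c := 0) (m := 1) (by norm_num)
    (by norm_num)
  refine h.congr_fun (fun t (ht : 0 < t) => ?_) measurableSet_Ioi
  have ht' : (0 : ℝ) < t + 1 := by linarith
  simp only [add_comm 1 t, Real.sqrt_eq_rpow]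
  rw [← Real.rpow_natCast, ← Real.rpow_sub ht']
  norm_num

theorem sqrt_one_add_div (t : ℝ) : √(1 + t) / (t + 1) = (√(1 + t))⁻¹ := by
  rw [add_comm t 1, Real.sqrt_div_self]

theorem tendsto_inv_sqrt_one_add : Tendsto (fun t : ℝ => (√(1 + t))⁻¹) atTop (𝓝 0) :=
  tendsto_inv_atTop_zero.comp
    (Real.tendsto_sqrt_atTop.comp (tendsto_atTop_add_const_left _ 1 tendsto_id))

theorem hasDerivAt_inv_add_pow {𝕜 : Type*} [NontriviallyNormedField 𝕜] (n : ℕ) {x c : 𝕜}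
    (hx : x + c ≠ 0) :
    HasDerivAt (fun x => ((x + c) ^ n)⁻¹) (-(n : 𝕜) * ((x + c) ^ (n + 1))⁻¹) x := by
  have h := (((hasDerivAt_id x).add_const c).fun_pow n).fun_inv (pow_ne_zero n hx)
  refine h.congr_deriv ?_
  cases n with
  | zero => simp
  | succ n =>
    simp only [id, Nat.add_sub_cancel]
    field_simp
    ring

theorem inv_add_one_pow_anti {t : ℝ} (ht : 0 < t) {m n : ℕ} (h : m ≤ n) :
    ((t + 1) ^ n)⁻¹ ≤ ((t + 1) ^ m)⁻¹ :=
  inv_anti₀ (by positivity) (pow_le_pow_right₀ (by linarith) h)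

theorem continuousOn_inv_add_one_pow (n : ℕ) :
    ContinuousOn (fun t : ℝ => ((t + 1) ^ n)⁻¹) (Ioi 0) :=
  ContinuousOn.inv₀ (by fun_prop) fun t (ht : 0 < t) => by positivity

end InversePowers

namespace IsProfile

section IntegrationByParts

variable {E : Type*} [NormedAddCommGroup E] [NormedSpace ℝ E]
  {κ B : ℝ} {ψ ψ' : ℝ → ℝ} {f f' f'' : ℝ → E}

theorem exists_bounds (P : IsProfile κ ψ ψ') :
    ∃ C, 0 ≤ C ∧ ∀ t, 0 ≤ t → |ψ' t| ≤ C * √(1 + t) ∧ |ψ t| ≤ C * √(1 + t) * t := by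
  obtain ⟨C, hC, hψ'⟩ := P.exists_abs_deriv_le
  refine ⟨C, hC, fun t ht => ⟨hψ' t ht, ?_⟩⟩
  have h := P.sol.abs_sub_zero_le ht (B := C * √(1 + t)) fun s hs hst =>
    (hψ' s hs.le).trans (by gcongr)
  rwa [P.zero, sub_zero] at h

theorem continuousOn (P : IsProfile κ ψ ψ') : ContinuousOn ψ (Ioi 0) :=
  fun _ ht => (P.sol.continuousAt (le_of_lt ht)).continuousWithinAt

theorem integrableOn_smul (P : IsProfile κ ψ ψ') (hf : ContinuousOn f (Ioi 0))
    (hB : ∀ t, 0 < t → ‖f t‖ ≤ B / (t * (t + 1) ^ 2)) :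
    IntegrableOn (fun t => ψ t • f t) (Ioi 0) := by
  obtain ⟨C, hC, hψ⟩ := P.exists_bounds
  refine Integrable.mono' (integrableOn_sqrt_div_sq.const_mul (C * B))
    ((P.continuousOn.smul hf).aestronglyMeasurable measurableSet_Ioi) ?_
  filter_upwards [ae_restrict_mem measurableSet_Ioi] with t (ht : 0 < t)
  rw [norm_smul, Real.norm_eq_abs]
  calc |ψ t| * ‖f t‖ ≤ (C * √(1 + t) * t) * (B / (t * (t + 1) ^ 2)) :=
        mul_le_mul (hψ t ht.le).2 (hB t ht) (norm_nonneg _) (by positivity)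
    _ = _ := by field_simp

theorem integrableOn_smul_of_le_div_cube (P : IsProfile κ ψ ψ') (hf : ContinuousOn f (Ioi 0))
    (hB : ∀ t, 0 < t → ‖f t‖ ≤ B / (t + 1) ^ 3) :
    IntegrableOn (fun t => ψ t • f t) (Ioi 0) := by
  refine P.integrableOn_smul hf (B := B) fun t ht => (hB t ht).trans ?_
  have hB0 : 0 ≤ B := by
    have h := (norm_nonneg _).trans (hB t ht)
    rwa [le_div_iff₀ (by positivity), zero_mul] at h
  rw [pow_succ' (t + 1) 2]
  gcongr
  linarith

theorem integrableOn_smul_potential (P : IsProfile κ ψ ψ') (hf : ContinuousOn f (Ioi 0))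
    (hB : ∀ t, 0 < t → ‖f t‖ ≤ B / (t + 1)) :
    IntegrableOn (fun t => ψ t • ((κ / (t * (t + 1))) • f t)) (Ioi 0) := by
  have hq : ContinuousOn (fun t : ℝ => κ / (t * (t + 1))) (Ioi 0) :=
    ContinuousOn.div (by fun_prop) (by fun_prop) fun t (ht : 0 < t) => by positivity
  refine P.integrableOn_smul (B := |κ| * B) (hq.smul hf) fun t ht => ?_
  rw [norm_smul, Real.norm_eq_abs, abs_div, abs_of_pos (by positivity : 0 < t * (t + 1))]
  calc _ ≤ |κ| / (t * (t + 1)) * (B / (t + 1)) := by gcongr; exact hB t ht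
    _ = _ := by field_simp

theorem tendsto_wronskian_atTop (P : IsProfile κ ψ ψ') (hB : ∀ t, 0 < t → ‖f t‖ ≤ B / (t + 1))
    (hB' : ∀ t, 0 < t → ‖f' t‖ ≤ B / (t + 1) ^ 2) :
    Tendsto (fun t => ψ' t • f t - ψ t • f' t) atTop (𝓝 0) := by
  obtain ⟨C, hC, hψ⟩ := P.exists_bounds
  have hlim := tendsto_inv_sqrt_one_add.const_mul (C * B + C * B)
  rw [mul_zero] at hlim
  refine squeeze_zero_norm' ?_ hlim
  filter_upwards [eventually_gt_atTop (0 : ℝ)] with t ht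
  obtain ⟨hψ'_le, hψ_le⟩ := hψ t ht.le
  have hB0 : 0 ≤ B := by
    have h := (norm_nonneg _).trans (hB t ht)
    rwa [le_div_iff₀ (by positivity), zero_mul] at h
  rw [← sqrt_one_add_div, add_mul]
  refine (norm_sub_le _ _).trans (add_le_add ?_ ?_) <;> rw [norm_smul, Real.norm_eq_abs]
  · calc _ ≤ (C * √(1 + t)) * (B / (t + 1)) :=
          mul_le_mul hψ'_le (hB t ht) (norm_nonneg _) (by positivity)
      _ = _ := by ring
  · calc _ ≤ (C * √(1 + t) * t) * (B / (t + 1) ^ 2) :=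
          mul_le_mul hψ_le (hB' t ht) (norm_nonneg _) (by positivity)
      _ = C * B * (√(1 + t) / (t + 1)) * (t / (t + 1)) := by field_simp
      _ ≤ _ := mul_le_of_le_one_right (by positivity) (div_add_one_le_one ht)

theorem integral_by_parts [CompleteSpace E] (P : IsProfile κ ψ ψ')
    (hd : ∀ t, 0 ≤ t → HasDerivAt f (f' t) t) (hd' : ∀ t, 0 ≤ t → HasDerivAt f' (f'' t) t)
    (hc : ContinuousOn f'' (Ioi 0)) (hB : ∀ t, 0 < t → ‖f t‖ ≤ B / (t + 1))
    (hB' : ∀ t, 0 < t → ‖f' t‖ ≤ B / (t + 1) ^ 2)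
    (hB'' : ∀ t, 0 < t → ‖f'' t‖ ≤ B / (t + 1) ^ 3) :
    ∫ t in Ioi (0 : ℝ), ψ t • ((κ / (t * (t + 1))) • f t + f'' t) = f 0 := by
  have hcf : ContinuousOn f (Ioi 0) := fun t ht =>
    (hd t (le_of_lt ht)).continuousAt.continuousWithinAt
  have hint : IntegrableOn (fun t => ψ t • ((κ / (t * (t + 1))) • f t + f'' t)) (Ioi 0) := by
    simp only [smul_add]
    exact (P.integrableOn_smul_potential hcf hB).add (P.integrableOn_smul_of_le_div_cube hc hB'')
  have hder : ∀ t ∈ Ioi (0 : ℝ), HasDerivAt (fun t => ψ' t • f t - ψ t • f' t)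
      (-(ψ t • ((κ / (t * (t + 1))) • f t + f'' t))) t := fun t ht => by
    have ht0 : 0 ≤ t := le_of_lt ht
    refine (((P.sol.hasDerivAt_deriv t ht).fun_smul (hd t ht0)).fun_sub
      ((P.sol.hasDerivAt t ht0).fun_smul (hd' t ht0))).congr_deriv ?_
    simp only [smul_add, smul_smul, neg_mul, neg_smul, mul_comm (ψ t)]
    abel
  have hcont : ContinuousWithinAt (fun t => ψ' t • f t - ψ t • f' t) (Ici 0) 0 :=
    ((P.sol.continuousAt_deriv_zero.smul (hd 0 le_rfl).continuousAt).sub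
      ((P.sol.continuousAt le_rfl).smul (hd' 0 le_rfl).continuousAt)).continuousWithinAt
  have h := integral_Ioi_of_hasDerivAt_of_tendsto hcont hder hint.neg
    (P.tendsto_wronskian_atTop hB hB')
  simp only [P.zero, P.deriv_zero, one_smul, zero_smul, sub_zero, zero_sub, integral_neg] at h
  exact neg_injective h

end IntegrationByParts

end IsProfile

/-- The moment `∫₀^∞ ψ(t) (t + 1)^{-(k + 3)} dt`; the shift makes `k = 0` the lowest moment that
converges for a profile. -/
noncomputable def moment (ψ : ℝ → ℝ) (k : ℕ) : ℝ :=
  ∫ t in Ioi (0 : ℝ), ψ t • ((t + 1) ^ (k + 3))⁻¹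

namespace IsProfile

variable {κ : ℝ} {ψ ψ' : ℝ → ℝ}

theorem integrableOn_moment (P : IsProfile κ ψ ψ') (k : ℕ) :
    IntegrableOn (fun t => ψ t • ((t + 1) ^ (k + 3))⁻¹) (Ioi 0) := by
  refine P.integrableOn_smul_of_le_div_cube (B := 1) (continuousOn_inv_add_one_pow _)
    fun t ht => ?_
  rw [Real.norm_of_nonneg (by positivity), one_div]
  exact inv_add_one_pow_anti ht (by omega)

theorem integrableOn_div_moment (P : IsProfile κ ψ ψ') (k : ℕ) :
    IntegrableOn (fun t => ψ t • (t * (t + 1) ^ (k + 2))⁻¹) (Ioi 0) := by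
  refine P.integrableOn_smul (B := 1)
    (ContinuousOn.inv₀ (by fun_prop) fun t (ht : 0 < t) => by positivity) fun t ht => ?_
  rw [Real.norm_of_nonneg (by positivity), mul_inv, one_div, mul_inv]
  exact mul_le_mul_of_nonneg_left (inv_add_one_pow_anti ht (by omega)) (by positivity)

theorem integral_by_parts_inv_pow (P : IsProfile κ ψ ψ') (k : ℕ) :
    ∫ t in Ioi (0 : ℝ), ψ t • ((κ / (t * (t + 1))) • ((t + 1) ^ (k + 1))⁻¹ +
      ((k : ℝ) + 1) * (k + 2) * ((t + 1) ^ (k + 3))⁻¹) = 1 := by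
  have hne : ∀ t : ℝ, 0 ≤ t → t + 1 ≠ 0 := fun t ht => by positivity
  have hB' : (k : ℝ) + 1 ≤ ((k : ℝ) + 1) * (k + 2) :=
    le_mul_of_one_le_right (by positivity) (by linarith [(k.cast_nonneg : (0 : ℝ) ≤ k)])
  have hB : (1 : ℝ) ≤ ((k : ℝ) + 1) * (k + 2) := (by simp : (1 : ℝ) ≤ k + 1).trans hB'
  have h := P.integral_by_parts (f := fun t => ((t + 1) ^ (k + 1))⁻¹)
    (f' := fun t => -((k : ℝ) + 1) * ((t + 1) ^ (k + 2))⁻¹)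
    (f'' := fun t => ((k : ℝ) + 1) * (k + 2) * ((t + 1) ^ (k + 3))⁻¹)
    (B := ((k : ℝ) + 1) * (k + 2))
    (fun t ht => by simpa using hasDerivAt_inv_add_pow (k + 1) (hne t ht))
    (fun t ht => ((hasDerivAt_inv_add_pow (k + 2) (hne t ht)).const_mul _).congr_deriv (by
      push_cast; ring))
    ((continuousOn_inv_add_one_pow _).const_mul _)
    (fun t ht => by
      rw [Real.norm_of_nonneg (by positivity), div_eq_mul_inv]
      calc ((t + 1) ^ (k + 1))⁻¹ ≤ ((t + 1) ^ 1)⁻¹ := inv_add_one_pow_anti ht (by omega)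
        _ = 1 * (t + 1)⁻¹ := by rw [pow_one, one_mul]
        _ ≤ _ := by gcongr)
    (fun t ht => by
      rw [norm_mul, norm_neg, Real.norm_of_nonneg (by positivity),
        Real.norm_of_nonneg (by positivity), div_eq_mul_inv]
      exact mul_le_mul hB' (inv_add_one_pow_anti ht (by omega)) (by positivity) (by positivity))
    (fun t ht => by
      rw [Real.norm_of_nonneg (by positivity), div_eq_mul_inv]
      exact mul_le_mul_of_nonneg_left (inv_add_one_pow_anti ht (by omega)) (by positivity))
  rwa [zero_add, one_pow, inv_one] at h

theorem moment_eq (P : IsProfile κ ψ ψ') (k : ℕ) :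
    ((k : ℝ) + 1) * (k + 2) * moment ψ k =
      1 - κ * ∫ t in Ioi (0 : ℝ), ψ t • (t * (t + 1) ^ (k + 2))⁻¹ := by
  rw [moment, ← integral_const_mul, eq_sub_iff_add_eq, ← integral_const_mul, ← integral_add
    ((P.integrableOn_moment k).const_mul _) ((P.integrableOn_div_moment k).const_mul _)]
  refine Eq.trans ?_ (P.integral_by_parts_inv_pow k)
  refine setIntegral_congr_fun measurableSet_Ioi fun t (ht : 0 < t) => ?_
  simp only [smul_eq_mul]
  field_simp
  ring

theorem moment_succ (P : IsProfile κ ψ ψ') (k : ℕ) :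
    ((k : ℝ) + 2) * (k + 3) * moment ψ (k + 1) = (κ + (k + 1) * (k + 2)) * moment ψ k := by
  have hdiff : (∫ t in Ioi (0 : ℝ), ψ t • (t * (t + 1) ^ (k + 2))⁻¹) -
      (∫ t in Ioi (0 : ℝ), ψ t • (t * (t + 1) ^ (k + 1 + 2))⁻¹) = moment ψ k := by
    rw [moment, ← integral_sub (P.integrableOn_div_moment k) (P.integrableOn_div_moment (k + 1))]
    refine setIntegral_congr_fun measurableSet_Ioi fun t (ht : 0 < t) => ?_
    simp only [smul_eq_mul]
    field_simp
    ring
  have hsucc := P.moment_eq (k + 1)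
  push_cast at hsucc
  linear_combination hsucc - P.moment_eq k + κ * hdiff

theorem tendsto_moment (P : IsProfile κ ψ ψ') :
    Tendsto (fun k : ℕ => ((k : ℝ) + 1) * (k + 2) * moment ψ k) atTop (𝓝 1) := by
  simp only [P.moment_eq]
  have h : Tendsto (fun k : ℕ => ∫ t in Ioi (0 : ℝ), ψ t • (t * (t + 1) ^ (k + 2))⁻¹) atTop
      (𝓝 (∫ _ in Ioi (0 : ℝ), (0 : ℝ))) := by
    refine tendsto_integral_of_dominated_convergence
      (fun t => ‖ψ t • (t * (t + 1) ^ (0 + 2))⁻¹‖)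
      (fun k => (P.integrableOn_div_moment k).aestronglyMeasurable)
      (P.integrableOn_div_moment 0).norm (fun k => ?_) ?_
    · filter_upwards [ae_restrict_mem measurableSet_Ioi] with t (ht : 0 < t)
      rw [norm_smul, norm_smul, Real.norm_of_nonneg (by positivity : 0 ≤ (t * (t + 1) ^ (k + 2))⁻¹),
        Real.norm_of_nonneg (by positivity : 0 ≤ (t * (t + 1) ^ (0 + 2))⁻¹), mul_inv, mul_inv]
      gcongr ‖ψ t‖ * (t⁻¹ * ?_)
      exact inv_add_one_pow_anti ht (by omega)
    · filter_upwards [ae_restrict_mem measurableSet_Ioi] with t (ht : 0 < t)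
      have hpow := (tendsto_pow_atTop_nhds_zero_of_lt_one (by positivity)
        (inv_lt_one_of_one_lt₀ (by linarith : 1 < t + 1))).const_mul (ψ t * (t * (t + 1) ^ 2)⁻¹)
      rw [mul_zero] at hpow
      refine hpow.congr fun k => ?_
      rw [smul_eq_mul, inv_pow, mul_assoc, ← mul_inv, mul_assoc, ← pow_add, add_comm 2]
  simpa using (h.const_mul κ).const_sub 1

theorem mul_moment_eq_prod (P : IsProfile κ ψ ψ') {a : ℂ} (ha : (κ : ℂ) = a * (1 - a)) (n : ℕ) :
    (κ : ℂ) * moment ψ n * (n + 1 + a) * (n + 2) =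
      2 * moment ψ 0 * (a * ∏ j ∈ Finset.range (n + 1), (1 - a ^ 2 / ((j : ℂ) + 1) ^ 2)) := by
  induction n with
  | zero =>
    simp only [CharP.cast_eq_zero, zero_add, Finset.range_one, Finset.prod_singleton, one_pow, ha]
    ring
  | succ n ih =>
    have hrec := congrArg (fun x : ℝ => (x : ℂ)) (P.moment_succ n)
    push_cast at hrec
    have hne : (n : ℂ) + 2 ≠ 0 := by exact_mod_cast (by positivity : (n : ℝ) + 2 ≠ 0)
    have hlast : (1 - a ^ 2 / ((n : ℂ) + 1 + 1) ^ 2) * ((n : ℂ) + 2) ^ 2 =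
        (n + 2 - a) * (n + 2 + a) := by
      rw [(by ring : (n : ℂ) + 1 + 1 = n + 2)]
      field_simp
      ring
    have hfactor : (κ : ℂ) + (n + 1) * (n + 2) = (n + 1 + a) * (n + 2 - a) := by rw [ha]; ring
    rw [hfactor] at hrec
    rw [Finset.prod_range_succ]
    push_cast
    refine mul_right_cancel₀ (pow_ne_zero 2 hne) ?_
    calc _ = (κ : ℂ) * (((n : ℂ) + 2) * (n + 3) * moment ψ (n + 1)) * (n + 2 + a) * (n + 2) := by
          ring
      _ = ((κ : ℂ) * moment ψ n * (n + 1 + a) * (n + 2)) * ((n + 2 - a) * (n + 2 + a)) := by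
          rw [hrec]; ring
      _ = _ := by rw [ih, ← hlast]; ring

theorem tendsto_mul_moment (P : IsProfile κ ψ ψ') (a : ℂ) :
    Tendsto (fun n : ℕ => (κ : ℂ) * moment ψ n * (n + 1 + a) * (n + 2)) atTop (𝓝 κ) := by
  have hmoment : Tendsto (fun n : ℕ => ((((n : ℝ) + 1) * (n + 2) * moment ψ n : ℝ) : ℂ)) atTop
      (𝓝 ((1 : ℝ) : ℂ)) := (Complex.continuous_ofReal.tendsto _).comp P.tendsto_moment
  have hratio : Tendsto (fun n : ℕ => 1 + a * (((1 / ((n : ℝ) + 1) : ℝ)) : ℂ)) atTop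
      (𝓝 (1 + a * ((0 : ℝ) : ℂ))) :=
    (((Complex.continuous_ofReal.tendsto _).comp
      tendsto_one_div_add_atTop_nhds_zero_nat).const_mul a).const_add 1
  have h := (hmoment.mul hratio).const_mul (κ : ℂ)
  simp only [Complex.ofReal_one, Complex.ofReal_zero, mul_zero, add_zero, mul_one] at h
  refine h.congr fun n => ?_
  have hne : (n : ℂ) + 1 ≠ 0 := by exact_mod_cast (by positivity : (n : ℝ) + 1 ≠ 0)
  push_cast
  field_simp

theorem two_mul_moment_zero (P : IsProfile κ ψ ψ') {a : ℂ} (ha : (κ : ℂ) = a * (1 - a)) :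
    2 * (moment ψ 0 : ℂ) * Complex.sin (Real.pi * a) = Real.pi * κ := by
  have hsin := ((Complex.tendsto_euler_sin_prod a).comp (tendsto_add_atTop_nat 1)).const_mul
    (2 * (moment ψ 0 : ℂ))
  refine tendsto_nhds_unique hsin (((P.tendsto_mul_moment a).const_mul _).congr fun n => ?_)
  rw [P.mul_moment_eq_prod ha]
  simp only [Function.comp_apply]
  ring

end IsProfile

/-! ### The exponent -/

/-- The number `α_λ (1 - α_λ)`, which is real. -/
noncomputable def kappa (lam : ℝ) : ℝ :=
  if lam ≤ 1 / Real.pi then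
    (Real.arcsin (lam * Real.pi) / Real.pi) * (1 - Real.arcsin (lam * Real.pi) / Real.pi)
  else 1 / 4 + (Real.arcosh (lam * Real.pi) / Real.pi) ^ 2

theorem kappa_eq (lam : ℝ) : (kappa lam : ℂ) = alpha lam * (1 - alpha lam) := by
  unfold kappa alpha
  split_ifs <;> push_cast
  · ring
  · linear_combination ((((Real.arcosh (lam * Real.pi) : ℝ) : ℂ) / Real.pi) ^ 2) * Complex.I_sq

theorem neg_half_le_arcsin_div_pi (x : ℝ) : -(1 / 2) ≤ Real.arcsin x / Real.pi := by
  rw [le_div_iff₀ Real.pi_pos]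
  linarith [Real.neg_pi_div_two_le_arcsin x]

theorem arcsin_div_pi_le_half (x : ℝ) : Real.arcsin x / Real.pi ≤ 1 / 2 := by
  rw [div_le_iff₀ Real.pi_pos]
  linarith [Real.arcsin_le_pi_div_two x]

theorem neg_three_quarters_le_kappa (lam : ℝ) : -(3 / 4) ≤ kappa lam := by
  unfold kappa
  split_ifs
  · nlinarith [neg_half_le_arcsin_div_pi (lam * Real.pi), arcsin_div_pi_le_half (lam * Real.pi)]
  · linarith [sq_nonneg (Real.arcosh (lam * Real.pi) / Real.pi)]

theorem kappa_pos {lam : ℝ} (h : 0 < lam) : 0 < kappa lam := by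
  unfold kappa
  split_ifs
  · exact mul_pos (div_pos (Real.arcsin_pos.2 (mul_pos h Real.pi_pos)) Real.pi_pos)
      (by linarith [arcsin_div_pi_le_half (lam * Real.pi)])
  · positivity

theorem kappa_neg {lam : ℝ} (h : lam < 0) : kappa lam < 0 := by
  rw [kappa, if_pos (h.le.trans (one_div_pos.2 Real.pi_pos).le)]
  exact mul_neg_of_neg_of_pos
    (div_neg_of_neg_of_pos (Real.arcsin_lt_zero.2 (mul_neg_of_neg_of_pos h Real.pi_pos))
      Real.pi_pos)
    (by linarith [arcsin_div_pi_le_half (lam * Real.pi)])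

theorem sin_pi_mul_alpha {lam : ℝ} (h : -(1 / Real.pi) ≤ lam) :
    Complex.sin (Real.pi * alpha lam) = lam * Real.pi := by
  have hpi := Real.pi_pos
  have hpi' : (Real.pi : ℂ) ≠ 0 := Complex.ofReal_ne_zero.2 hpi.ne'
  unfold alpha
  split_ifs with hle
  · have hangle : (Real.pi : ℂ) * ((Real.arcsin (lam * Real.pi) / Real.pi : ℝ) : ℂ) =
        ((Real.arcsin (lam * Real.pi) : ℝ) : ℂ) := by
      push_cast
      field_simp
    rw [← neg_div, div_le_iff₀ hpi] at h
    rw [hangle, ← Complex.ofReal_sin, Real.sin_arcsin h ((le_div_iff₀ hpi).1 hle)]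
    push_cast
    ring
  · have hangle : (Real.pi : ℂ) *
        (1 / 2 + Complex.I * ((Real.arcosh (lam * Real.pi) / Real.pi : ℝ) : ℂ)) =
        ((Real.arcosh (lam * Real.pi) : ℝ) : ℂ) * Complex.I + Real.pi / 2 := by
      push_cast
      field_simp
      ring
    rw [hangle, Complex.sin_add_pi_div_two, Complex.cos_mul_I, ← Complex.ofReal_cosh,
      Real.cosh_arcosh ((div_lt_iff₀ hpi).1 (not_le.1 hle)).le]
    push_cast
    ring

theorem IsProfile.two_mul_mul_moment_zero {lam : ℝ} {ψ ψ' : ℝ → ℝ} (h : -(1 / Real.pi) ≤ lam)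
    (P : IsProfile (kappa lam) ψ ψ') : 2 * lam * moment ψ 0 = kappa lam := by
  have heuler := P.two_mul_moment_zero (kappa_eq lam)
  rw [sin_pi_mul_alpha h] at heuler
  refine mul_left_cancel₀ Real.pi_ne_zero (Complex.ofReal_injective ?_)
  push_cast
  linear_combination heuler

/-! ### Stieltjes transforms and the continuation of the profile -/

/-- The plane cut along `(-∞, -1]`. -/
def shiftedSlitPlane : Set ℂ := {z : ℂ | 1 + z ∈ Complex.slitPlane}

theorem isOpen_shiftedSlitPlane : IsOpen shiftedSlitPlane :=
  Complex.isOpen_slitPlane.preimage (continuous_const.add continuous_id)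

theorem ofReal_mem_shiftedSlitPlane {x : ℝ} (hx : -1 < x) : (x : ℂ) ∈ shiftedSlitPlane := by
  refine Or.inl ?_
  rw [Complex.add_re, Complex.one_re, Complex.ofReal_re]
  linarith

theorem one_add_mul_ne_zero {z : ℂ} (hz : z ∈ shiftedSlitPlane) {r : ℝ} (h0 : 0 ≤ r)
    (h1 : r ≤ 1) : 1 + (r : ℂ) * z ≠ 0 := by
  have h := Complex.starConvex_one_slitPlane hz (sub_nonneg.2 h1) h0 (sub_add_cancel 1 r)
  rw [smul_add, Complex.real_smul, Complex.real_smul, Complex.real_smul] at h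
  push_cast at h
  refine Complex.slitPlane_ne_zero (?_ : _ ∈ Complex.slitPlane)
  convert h using 1
  ring

theorem exists_le_norm_add {z₀ : ℂ} (hz₀ : z₀ ∈ shiftedSlitPlane) : ∃ c : ℝ, 0 < c ∧
    ∀ᶠ z : ℂ in 𝓝 z₀, ∀ t : ℝ, 0 ≤ t → c * (t + 1) ≤ ‖z + (t + 1)‖ := by
  obtain ⟨δ, hδ, hball⟩ :=
    Metric.nhds_basis_closedBall.mem_iff.1 (isOpen_shiftedSlitPlane.mem_nhds hz₀)
  obtain ⟨p, hp, hmin⟩ := ((isCompact_Icc (a := (0 : ℝ)) (b := 1)).prod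
    (isCompact_closedBall z₀ δ)).exists_isMinOn
    (f := fun p : ℝ × ℂ => ‖1 + (p.1 : ℂ) * p.2‖)
    ⟨(0, z₀), by simp [hδ.le]⟩ (by fun_prop)
  refine ⟨‖1 + (p.1 : ℂ) * p.2‖, norm_pos_iff.2
    (one_add_mul_ne_zero (hball hp.2) hp.1.1 hp.1.2), ?_⟩
  filter_upwards [Metric.closedBall_mem_nhds z₀ hδ] with z hz t ht
  have ht1 : (0 : ℝ) < t + 1 := by positivity
  have h := hmin (show ((1 / (t + 1), z) : ℝ × ℂ) ∈ Icc (0 : ℝ) 1 ×ˢ Metric.closedBall z₀ δ from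
    ⟨⟨by positivity, by rw [div_le_one ht1]; linarith⟩, hz⟩)
  simp only [mem_ofPred_eq] at h
  have hscale : z + (t + 1) = (1 + ((1 / (t + 1) : ℝ) : ℂ) * z) * ((t + 1 : ℝ) : ℂ) := by
    have : (t : ℂ) + 1 ≠ 0 := by exact_mod_cast ht1.ne'
    push_cast
    field_simp
    ring
  rw [hscale, norm_mul, Complex.norm_of_nonneg ht1.le]
  exact mul_le_mul_of_nonneg_right h ht1.le

theorem exists_le_norm_add_self {z : ℂ} (hz : z ∈ shiftedSlitPlane) :
    ∃ c : ℝ, 0 < c ∧ ∀ t : ℝ, 0 ≤ t → c * (t + 1) ≤ ‖z + (t + 1)‖ :=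
  (exists_le_norm_add hz).imp fun _ h => ⟨h.1, h.2.self_of_nhds⟩

/-- The kernel `(t + 1)^{-m} (z + t + 1)^{-n}` of the generalised Stieltjes transform. -/
noncomputable def stieltjesKernel (m n : ℕ) (z : ℂ) (t : ℝ) : ℂ :=
  (((t : ℂ) + 1) ^ m)⁻¹ * ((z + ((t : ℂ) + 1)) ^ n)⁻¹

section Kernel

variable {c t : ℝ} {z : ℂ} (m n : ℕ)

theorem ofReal_add_one_ne_zero (ht : 0 ≤ t) : (t : ℂ) + 1 ≠ 0 := by
  exact_mod_cast (by positivity : t + 1 ≠ 0)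

theorem add_ofReal_add_one_ne_zero (hz : z ∈ shiftedSlitPlane) (ht : 0 ≤ t) :
    z + ((t : ℂ) + 1) ≠ 0 := by
  obtain ⟨c, hc, h⟩ := exists_le_norm_add_self hz
  have hpos : 0 < c * (t + 1) := by positivity
  exact norm_pos_iff.1 (hpos.trans_le (h t ht))

theorem continuousOn_stieltjesKernel (hz : z ∈ shiftedSlitPlane) :
    ContinuousOn (stieltjesKernel m n z) (Ioi 0) :=
  (ContinuousOn.inv₀ (by fun_prop) fun _ ht =>
    pow_ne_zero m (ofReal_add_one_ne_zero (le_of_lt ht))).mul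
  (ContinuousOn.inv₀ (by fun_prop) fun _ ht =>
    pow_ne_zero n (add_ofReal_add_one_ne_zero hz (le_of_lt ht)))

theorem norm_stieltjesKernel_le (hc : 0 < c) (ht : 0 ≤ t) (h : c * (t + 1) ≤ ‖z + (t + 1)‖) :
    ‖stieltjesKernel m n z t‖ ≤ (c ^ n)⁻¹ * ((t + 1) ^ (m + n))⁻¹ := by
  have hnorm : ‖(t : ℂ) + 1‖ = t + 1 := by
    rw [← Complex.ofReal_one, ← Complex.ofReal_add, Complex.norm_of_nonneg (by positivity)]
  rw [stieltjesKernel, norm_mul, norm_inv, norm_inv, norm_pow, norm_pow, hnorm, pow_add, mul_inv]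
  calc _ ≤ ((t + 1) ^ m)⁻¹ * ((c * (t + 1)) ^ n)⁻¹ := by gcongr
    _ = _ := by rw [mul_pow, mul_inv]; ring

theorem hasDerivAt_stieltjesKernel (hz : z ∈ shiftedSlitPlane) (ht : 0 ≤ t) :
    HasDerivAt (fun z => stieltjesKernel m n z t) (-(n : ℂ) * stieltjesKernel m (n + 1) z t) z :=
  ((hasDerivAt_inv_add_pow n (add_ofReal_add_one_ne_zero hz ht)).const_mul _).congr_deriv
    (mul_left_comm _ _ _)

theorem hasDerivAt_stieltjesKernel_left (z : ℂ) (ht : 0 ≤ t) :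
    HasDerivAt (fun t => stieltjesKernel m 0 z t) (-(m : ℂ) * stieltjesKernel (m + 1) 0 z t) t := by
  simpa [stieltjesKernel, Function.comp_def] using
    (hasDerivAt_inv_add_pow m (ofReal_add_one_ne_zero ht)).comp_ofReal

theorem hasDerivAt_stieltjesKernel_right (hz : z ∈ shiftedSlitPlane) (ht : 0 ≤ t) :
    HasDerivAt (fun t => stieltjesKernel 0 n z t) (-(n : ℂ) * stieltjesKernel 0 (n + 1) z t) t := by
  have hcomm : ∀ w : ℂ, z + (w + 1) = w + (z + 1) := fun w => by ring
  have hne := add_ofReal_add_one_ne_zero hz ht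
  simp only [stieltjesKernel, hcomm, pow_zero, inv_one, one_mul] at hne ⊢
  exact (hasDerivAt_inv_add_pow n hne).comp_ofReal

end Kernel

/-- The generalised Stieltjes transform `∫₀^∞ ψ(t) (t + 1)^{-m} (z + t + 1)^{-n} dt`. -/
noncomputable def stieltjes (ψ : ℝ → ℝ) (m n : ℕ) (z : ℂ) : ℂ :=
  ∫ t in Ioi (0 : ℝ), ψ t • stieltjesKernel m n z t

/-- The function `z - λ z² ∫₀^∞ ψ(t) dt / ((t + 1)² (t + 1 + z))`, which turns out to continue
`ψ` analytically; it is `R₄` at unit mass. -/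
noncomputable def continuation (lam : ℝ) (ψ : ℝ → ℝ) (z : ℂ) : ℂ :=
  z - lam * z ^ 2 * stieltjes ψ 2 1 z

/-- The derivative of `continuation`. -/
noncomputable def continuationDeriv (lam : ℝ) (ψ : ℝ → ℝ) (z : ℂ) : ℂ :=
  1 - lam * (2 * z * stieltjes ψ 2 1 z - z ^ 2 * stieltjes ψ 2 2 z)

theorem stieltjes_zero_right (ψ : ℝ → ℝ) (k : ℕ) (z : ℂ) :
    stieltjes ψ (k + 3) 0 z = moment ψ k := by
  rw [stieltjes, moment, ← integral_complex_ofReal]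
  simp [stieltjesKernel]

theorem conj_stieltjes (ψ : ℝ → ℝ) (m n : ℕ) (z : ℂ) :
    conj (stieltjes ψ m n z) = stieltjes ψ m n (conj z) := by
  rw [stieltjes, stieltjes, ← integral_conj]
  simp [stieltjesKernel]

theorem conj_continuation (lam : ℝ) (ψ : ℝ → ℝ) (z : ℂ) :
    conj (continuation lam ψ z) = continuation lam ψ (conj z) := by
  simp [continuation, conj_stieltjes]

namespace IsProfile

variable {κ lam : ℝ} {ψ ψ' : ℝ → ℝ} {z : ℂ} {m n : ℕ}

theorem integrableOn_stieltjesKernel (P : IsProfile κ ψ ψ') (hz : z ∈ shiftedSlitPlane)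
    (hmn : 3 ≤ m + n) : IntegrableOn (fun t : ℝ => ψ t • stieltjesKernel m n z t) (Ioi 0) := by
  obtain ⟨c, hc, h⟩ := exists_le_norm_add_self hz
  refine P.integrableOn_smul_of_le_div_cube (B := (c ^ n)⁻¹)
    (continuousOn_stieltjesKernel m n hz) fun t ht => ?_
  refine (norm_stieltjesKernel_le m n hc ht.le (h t ht.le)).trans ?_
  rw [div_eq_mul_inv]
  gcongr (c ^ n)⁻¹ * ?_
  exact inv_add_one_pow_anti ht hmn

theorem hasDerivAt_stieltjes (P : IsProfile κ ψ ψ') {z₀ : ℂ} (hz₀ : z₀ ∈ shiftedSlitPlane)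
    (hmn : 3 ≤ m + n) :
    HasDerivAt (stieltjes ψ m n) (-(n : ℂ) * stieltjes ψ m (n + 1) z₀) z₀ := by
  obtain ⟨c, hc, hc_le⟩ := exists_le_norm_add hz₀
  have hbound : IntegrableOn
      (fun t : ℝ => ‖ψ t • ((n : ℝ) * (c ^ (n + 1))⁻¹ * ((t + 1) ^ (m + (n + 1)))⁻¹)‖) (Ioi 0) := by
    refine (P.integrableOn_smul_of_le_div_cube (B := (n : ℝ) * (c ^ (n + 1))⁻¹)
      ((continuousOn_inv_add_one_pow _).const_mul _) fun t ht => ?_).norm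
    rw [Real.norm_of_nonneg (by positivity), div_eq_mul_inv]
    gcongr _ * ?_
    exact inv_add_one_pow_anti ht (by omega)
  have hregion := isOpen_shiftedSlitPlane.mem_nhds hz₀
  have hint := (P.integrableOn_stieltjesKernel hz₀ (m := m) (n := n + 1) (by omega)).const_mul
    (-(n : ℂ))
  have key := (hasDerivAt_integral_of_dominated_loc_of_deriv_le
    (μ := volume.restrict (Ioi (0 : ℝ))) (F := fun z t => ψ t • stieltjesKernel m n z t)
    (F' := fun z t => -(n : ℂ) * ψ t • stieltjesKernel m (n + 1) z t)
    (hc_le.and hregion)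
    (by filter_upwards [hregion] with z hz using
          (P.integrableOn_stieltjesKernel hz hmn).aestronglyMeasurable)
    (P.integrableOn_stieltjesKernel hz₀ hmn) hint.aestronglyMeasurable ?_ hbound ?_).2
  · rwa [integral_const_mul] at key
  · filter_upwards [ae_restrict_mem measurableSet_Ioi] with t (ht : 0 < t) z hz
    rw [norm_mul, norm_neg, Complex.norm_natCast, norm_smul, norm_smul, mul_left_comm,
      Real.norm_of_nonneg (by positivity : 0 ≤ (n : ℝ) * (c ^ (n + 1))⁻¹ * _), mul_assoc (n : ℝ)]
    gcongr
    exact norm_stieltjesKernel_le m (n + 1) hc ht.le (hz.1 t ht.le)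
  · filter_upwards [ae_restrict_mem measurableSet_Ioi] with t (ht : 0 < t) z hz
    exact ((hasDerivAt_stieltjesKernel m n hz.2 ht.le).const_smul (ψ t)).congr_deriv
      (mul_smul_comm _ _ _).symm

theorem hasDerivAt_continuation (P : IsProfile κ ψ ψ') (lam : ℝ) (hz : z ∈ shiftedSlitPlane) :
    HasDerivAt (continuation lam ψ) (continuationDeriv lam ψ z) z := by
  refine ((hasDerivAt_id z).fun_sub ((((hasDerivAt_id z).fun_pow 2).const_mul (lam : ℂ)).fun_mul
    (P.hasDerivAt_stieltjes (m := 2) (n := 1) hz le_rfl))).congr_deriv ?_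
  simp only [id, continuationDeriv]
  push_cast
  ring

theorem stieltjes_zero_three (P : IsProfile κ ψ ψ') (hz : z ∈ shiftedSlitPlane) :
    stieltjes ψ 2 1 z - 2 * z * stieltjes ψ 2 2 z + z ^ 2 * stieltjes ψ 2 3 z =
      stieltjes ψ 0 3 z := by
  have hint (n : ℕ) (hn : 1 ≤ n) := P.integrableOn_stieltjesKernel hz (m := 2) (n := n) (by omega)
  have hint₁ := hint 1 le_rfl
  have hint₂ := (hint 2 (by norm_num)).const_mul (2 * z)
  have hint₃ := (hint 3 (by norm_num)).const_mul (z ^ 2)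
  simp only [stieltjes]
  rw [← integral_const_mul, ← integral_const_mul, ← integral_sub hint₁ hint₂,
    ← integral_add (hint₁.sub' hint₂) hint₃]
  refine setIntegral_congr_fun measurableSet_Ioi fun t (ht : 0 < t) => ?_
  have hne := add_ofReal_add_one_ne_zero hz ht.le
  have hne' := ofReal_add_one_ne_zero ht.le
  simp only [Complex.real_smul, stieltjesKernel]
  field_simp
  ring

theorem hasDerivAt_continuationDeriv (P : IsProfile κ ψ ψ') (lam : ℝ)
    (hz : z ∈ shiftedSlitPlane) :
    HasDerivAt (continuationDeriv lam ψ) (-(2 * lam) * stieltjes ψ 0 3 z) z := by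
  refine ((((((hasDerivAt_id z).const_mul (2 : ℂ)).fun_mul
    (P.hasDerivAt_stieltjes (m := 2) (n := 1) hz le_rfl)).fun_sub
    (((hasDerivAt_id z).fun_pow 2).fun_mul
      (P.hasDerivAt_stieltjes (m := 2) (n := 2) hz (by norm_num)))).const_mul
    (lam : ℂ)).const_sub 1).congr_deriv ?_
  rw [← P.stieltjes_zero_three hz]
  simp only [id]
  push_cast
  ring

theorem integral_by_parts_stieltjesKernel (P : IsProfile κ ψ ψ') (hz : z ∈ shiftedSlitPlane)
    (u v : ℂ) :
    ∫ t in Ioi (0 : ℝ), ψ t • ((κ / (t * (t + 1))) •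
      (u * stieltjesKernel 1 0 z t + v * stieltjesKernel 0 1 z t) +
        2 * (u * stieltjesKernel 3 0 z t + v * stieltjesKernel 0 3 z t)) = u + v / (z + 1) := by
  obtain ⟨c, hc, hc_le⟩ := exists_le_norm_add_self hz
  let f : ℕ → ℝ → ℂ := fun n t => u * stieltjesKernel n 0 z t + v * stieltjesKernel 0 n z t
  let M : ℕ → ℝ := fun n => ‖u‖ + ‖v‖ * (c ^ n)⁻¹
  have hM (n : ℕ) : 0 ≤ M n := by positivity
  have hderiv (n : ℕ) (t : ℝ) (ht : 0 ≤ t) : HasDerivAt (f n) (-(n : ℂ) * f (n + 1) t) t :=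
    (((hasDerivAt_stieltjesKernel_left n z ht).const_mul u).fun_add
      ((hasDerivAt_stieltjesKernel_right n hz ht).const_mul v)).congr_deriv (by
        simp only [f]; ring)
  have hbound (n : ℕ) (t : ℝ) (ht : 0 < t) : ‖f n t‖ ≤ M n / (t + 1) ^ n := by
    have hleft := norm_stieltjesKernel_le n 0 hc ht.le (hc_le t ht.le)
    have hright := norm_stieltjesKernel_le 0 n hc ht.le (hc_le t ht.le)
    rw [pow_zero, inv_one, one_mul, add_zero] at hleft
    rw [zero_add] at hright
    refine (norm_add_le _ _).trans ?_
    rw [norm_mul, norm_mul, div_eq_mul_inv, add_mul, mul_assoc]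
    gcongr
  have h := P.integral_by_parts (f := f 1) (f' := fun t => -f 2 t) (f'' := fun t => 2 * f 3 t)
    (B := M 1 + M 2 + 2 * M 3) (fun t ht => by simpa using hderiv 1 t ht)
    (fun t ht => (hderiv 2 t ht).fun_neg.congr_deriv (by simp))
    ((((continuousOn_stieltjesKernel 3 0 hz).const_mul u).add
      ((continuousOn_stieltjesKernel 0 3 hz).const_mul v)).const_mul 2)
    (fun t ht => (hbound 1 t ht).trans (by
      rw [pow_one]; gcongr; linarith [hM 2, hM 3]))
    (fun t ht => (norm_neg (f 2 t)).trans_le ((hbound 2 t ht).trans (by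
      gcongr; linarith [hM 1, hM 3])))
    (fun t ht => by
      rw [norm_mul, Complex.norm_ofNat]
      calc 2 * ‖f 3 t‖ ≤ 2 * (M 3 / (t + 1) ^ 3) := by gcongr; exact hbound 3 t ht
        _ ≤ _ := by rw [← mul_div_assoc]; gcongr; linarith [hM 1, hM 2])
  rw [h]
  simp [f, stieltjesKernel, div_eq_mul_inv]

theorem stieltjes_relation (P : IsProfile κ ψ ψ') (hz : z ∈ shiftedSlitPlane) :
    κ * z ^ 2 * stieltjes ψ 2 1 z - 2 * z * moment ψ 0 + 2 * (z * (1 + z)) * stieltjes ψ 0 3 z =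
      0 := by
  have hz1 : z + 1 ≠ 0 := by simpa using add_ofReal_add_one_ne_zero hz le_rfl
  have hboundary : -z + z * (1 + z) / (z + 1) = 0 := by field_simp; ring
  have hint₁ := (P.integrableOn_stieltjesKernel (m := 2) (n := 1) hz le_rfl).const_mul (κ * z ^ 2)
  have hint₂ := (P.integrableOn_stieltjesKernel (m := 0 + 3) (n := 0) hz le_rfl).const_mul (2 * z)
  have hint₃ := (P.integrableOn_stieltjesKernel (m := 0) (n := 3) hz le_rfl).const_mul
    (2 * (z * (1 + z)))
  rw [← stieltjes_zero_right ψ 0 z]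
  simp only [stieltjes]
  rw [← integral_const_mul, ← integral_const_mul, ← integral_const_mul, ← integral_sub hint₁ hint₂,
    ← integral_add (hint₁.sub' hint₂) hint₃]
  refine Eq.trans ?_ ((P.integral_by_parts_stieltjesKernel hz (-z) (z * (1 + z))).trans hboundary)
  refine setIntegral_congr_fun measurableSet_Ioi fun t (ht : 0 < t) => ?_
  have htc : (t : ℂ) ≠ 0 := Complex.ofReal_ne_zero.2 ht.ne'
  have hne := add_ofReal_add_one_ne_zero hz ht.le
  have hne' := ofReal_add_one_ne_zero ht.le
  simp only [Complex.real_smul, stieltjesKernel]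
  push_cast
  field_simp
  ring

theorem continuation_ode (P : IsProfile κ ψ ψ') (hm : 2 * lam * moment ψ 0 = κ)
    (hz : z ∈ shiftedSlitPlane) :
    z * (z + 1) * (-(2 * lam) * stieltjes ψ 0 3 z) = -κ * continuation lam ψ z := by
  have hm' : 2 * (lam : ℂ) * moment ψ 0 = κ := by exact_mod_cast hm
  rw [continuation]
  linear_combination (-(lam : ℂ)) * P.stieltjes_relation hz - z * hm'

theorem isRegularSolution_continuation (P : IsProfile κ ψ ψ') (hm : 2 * lam * moment ψ 0 = κ) :
    IsRegularSolution (fun t => κ / (t * (t + 1))) (fun x => (continuation lam ψ (x : ℂ)).re)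
      (fun x => (continuationDeriv lam ψ (x : ℂ)).re) where
  hasDerivAt t ht :=
    (P.hasDerivAt_continuation lam (ofReal_mem_shiftedSlitPlane (by linarith))).real_of_complex
  hasDerivAt_deriv t ht := by
    have hz := ofReal_mem_shiftedSlitPlane (x := t) (by linarith)
    refine (P.hasDerivAt_continuationDeriv lam hz).real_of_complex.congr_deriv ?_
    have hode := P.continuation_ode hm hz
    rw [← Complex.ofReal_one, ← Complex.ofReal_add, ← Complex.ofReal_mul, ← Complex.ofReal_neg]
      at hode
    have hre := congrArg Complex.re hode
    rw [Complex.re_ofReal_mul, Complex.re_ofReal_mul] at hre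
    refine mul_left_cancel₀ (by positivity : t * (t + 1) ≠ 0) (hre.trans ?_)
    field_simp
  continuousAt_deriv_zero := (P.hasDerivAt_continuationDeriv lam
    (ofReal_mem_shiftedSlitPlane (x := 0) (by norm_num))).real_of_complex.continuousAt

theorem continuation_ofReal (P : IsProfile κ ψ ψ') (hm : 2 * lam * moment ψ 0 = κ) {x : ℝ}
    (hx : 0 ≤ x) : continuation lam ψ x = ψ x := by
  have h : (continuation lam ψ x).re = ψ x := sub_eq_zero.1 <|
    ((P.isRegularSolution_continuation hm).sub P.sol).eq_zero (A := |κ|)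
      (by simp [continuation, P.zero]) (by simp [continuationDeriv, P.deriv_zero])
      (fun t ht => by
        rw [abs_div, abs_of_pos (by positivity : 0 < t * (t + 1)), div_mul_eq_mul_div,
          mul_comm t, mul_div_mul_right _ _ ht.ne']
        exact div_le_self (abs_nonneg _) (by linarith)) hx
  have hreal : conj (continuation lam ψ x) = continuation lam ψ x := by
    rw [conj_continuation, Complex.conj_ofReal]
  rw [← Complex.conj_eq_iff_re.1 hreal, h]

end IsProfile

/-! ### Identification with the hypergeometric function -/

theorem hasSum_stieltjesKernel {z : ℂ} (hz : ‖z‖ < 1) {t : ℝ} (ht : 0 < t) :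
    HasSum (fun n : ℕ => z ^ n * ((((t + 1) ^ (n + 3))⁻¹ : ℝ) : ℂ))
      (stieltjesKernel 2 1 (-z) t) := by
  have hne := ofReal_add_one_ne_zero ht.le
  have hlt : ‖z / ((t : ℂ) + 1)‖ < 1 := by
    rw [norm_div, ← Complex.ofReal_one, ← Complex.ofReal_add,
      Complex.norm_of_nonneg (by positivity), div_lt_one (by positivity)]
    linarith
  have hgeom := (hasSum_geometric_of_norm_lt_one hlt).mul_left (((t : ℂ) + 1) ^ 3)⁻¹
  have hsum : (((t : ℂ) + 1) ^ 3)⁻¹ * (1 - z / ((t : ℂ) + 1))⁻¹ = stieltjesKernel 2 1 (-z) t := by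
    have : 1 - z / ((t : ℂ) + 1) = (-z + (t + 1)) / (t + 1) := by field_simp; ring
    rw [this, stieltjesKernel, inv_div, pow_one]
    field_simp
  rw [hsum] at hgeom
  refine hgeom.congr_fun fun n => ?_
  push_cast
  rw [div_pow]
  field_simp
  ring

theorem hypergeometricCoefficient_succ (a b c : ℂ) (n : ℕ) :
    ordinaryHypergeometricCoefficient a b c (n + 1) =
      ordinaryHypergeometricCoefficient a b c n * ((a + n) * (b + n) / ((n + 1) * (c + n))) := by
  simp only [ordinaryHypergeometricCoefficient, ascPochhammer_succ_eval, Nat.factorial_succ,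
    Nat.cast_mul, Nat.cast_succ, mul_inv, div_eq_mul_inv]
  ring

namespace IsProfile

variable {κ lam : ℝ} {ψ ψ' : ℝ → ℝ} {z a : ℂ}

theorem hasSum_stieltjes (P : IsProfile κ ψ ψ') (hz : ‖z‖ < 1) :
    HasSum (fun n : ℕ => z ^ n * (moment ψ n : ℂ)) (stieltjes ψ 2 1 (-z)) := by
  have hint (n : ℕ) : IntegrableOn
      (fun t : ℝ => z ^ n * ((ψ t • ((t + 1) ^ (n + 3))⁻¹ : ℝ) : ℂ)) (Ioi 0) :=
    (P.integrableOn_moment n).ofReal.const_mul _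
  have hnorm (n : ℕ) : ∫ t in Ioi (0 : ℝ), ‖z ^ n * ((ψ t • ((t + 1) ^ (n + 3))⁻¹ : ℝ) : ℂ)‖ ≤
      (∫ t in Ioi (0 : ℝ), ‖ψ t • ((t + 1) ^ (0 + 3))⁻¹‖) * ‖z‖ ^ n := by
    rw [mul_comm, ← integral_const_mul]
    refine setIntegral_mono_on (hint n).norm ((P.integrableOn_moment 0).norm.const_mul _)
      measurableSet_Ioi fun t (ht : 0 < t) => ?_
    rw [norm_mul, norm_pow, Complex.norm_real, norm_smul, norm_smul,
      Real.norm_of_nonneg (by positivity : 0 ≤ ((t + 1) ^ (n + 3))⁻¹),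
      Real.norm_of_nonneg (by positivity : 0 ≤ ((t + 1) ^ (0 + 3))⁻¹)]
    gcongr ?_ * (?_ * ?_)
    exact inv_add_one_pow_anti ht (by omega)
  have hsum := hasSum_integral_of_summable_integral_norm hint
    (Summable.of_nonneg_of_le (fun n => integral_nonneg fun t => norm_nonneg _) hnorm
      ((summable_geometric_of_lt_one (norm_nonneg z) hz).mul_left _))
  have hstieltjes : ∫ t in Ioi (0 : ℝ), ∑' n : ℕ, z ^ n * ((ψ t • ((t + 1) ^ (n + 3))⁻¹ : ℝ) : ℂ) =
      stieltjes ψ 2 1 (-z) := by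
    refine setIntegral_congr_fun measurableSet_Ioi fun t (ht : 0 < t) => ?_
    simp only [smul_eq_mul, Complex.ofReal_mul, mul_left_comm _ (ψ t : ℂ), Complex.real_smul]
    exact ((hasSum_stieltjesKernel hz ht).mul_left _).tsum_eq
  rw [hstieltjes] at hsum
  refine hsum.congr_fun fun n => ?_
  rw [integral_const_mul, integral_complex_ofReal, moment]

theorem hypergeometricCoefficient_eq (P : IsProfile κ ψ ψ') (hm : 2 * lam * moment ψ 0 = κ)
    (ha : (κ : ℂ) = a * (1 - a)) (n : ℕ) :
    ordinaryHypergeometricCoefficient a (1 - a) 2 (n + 1) = lam * moment ψ n := by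
  induction n with
  | zero =>
    have hm' : 2 * (lam : ℂ) * moment ψ 0 = κ := by exact_mod_cast hm
    simp only [ordinaryHypergeometricCoefficient, zero_add, Nat.factorial_one, Nat.cast_one,
      inv_one, one_mul, ascPochhammer_one, Polynomial.eval_X]
    linear_combination (-1 / 2 : ℂ) * hm' - (1 / 2 : ℂ) * ha
  | succ n ih =>
    have hsucc := congrArg (fun x : ℝ => (x : ℂ)) (P.moment_succ n)
    push_cast at hsucc
    have h2 : (n : ℂ) + 1 + 1 ≠ 0 := by exact_mod_cast (n + 1).succ_ne_zero
    have h3 : (2 : ℂ) + (n + 1) ≠ 0 := by exact_mod_cast (by omega : 2 + (n + 1) ≠ 0)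
    rw [hypergeometricCoefficient_succ, ih]
    push_cast
    field_simp
    linear_combination -(lam : ℂ) * hsucc - lam * moment ψ n * ha

theorem isHyp2F1 (P : IsProfile κ ψ ψ') (hm : 2 * lam * moment ψ 0 = κ)
    (ha : (κ : ℂ) = a * (1 - a)) :
    IsHyp2F1 a (1 - a) 2 (fun z => 1 + lam * z * stieltjes ψ 2 1 (-z)) := by
  refine ⟨fun z hz => ?_, fun z hz => ?_⟩
  · have hz' : -z ∈ shiftedSlitPlane := (sub_eq_add_neg 1 z ▸ hz : 1 + -z ∈ Complex.slitPlane)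
    have h := (P.hasDerivAt_stieltjes hz' (m := 2) (n := 1) le_rfl).differentiableAt
    exact (((differentiableAt_id.const_mul (lam : ℂ)).mul
      (DifferentiableAt.comp z h differentiableAt_id.neg)).const_add 1).differentiableWithinAt
  · have htail : HasSum (fun n => ordinaryHypergeometricCoefficient a (1 - a) 2 (n + 1) *
        z ^ (n + 1)) (lam * z * stieltjes ψ 2 1 (-z)) := by
      refine ((P.hasSum_stieltjes hz).mul_left (lam * z)).congr_fun fun n => ?_
      rw [P.hypergeometricCoefficient_eq hm ha]
      ring
    rw [ordinaryHypergeometric_eq_tsum]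
    refine (HasSum.tsum_eq ?_).symm
    refine (hasSum_nat_add_iff' 1).1 ?_
    simpa using htail

end IsProfile

/-! ### The density, its transform and the natural mass -/

theorem integrableOn_Ioi_inv_sq_smul_comp_inv_mul {E : Type*} [NormedAddCommGroup E]
    [NormedSpace ℝ E] {g : ℝ → E} {m : ℝ} (hm : 0 < m) (hg : IntegrableOn g (Ioi 0)) :
    IntegrableOn (fun t => (m ^ 2)⁻¹ • g (m⁻¹ * t)) (Ioi 0) := by
  refine Integrable.smul _ ?_
  rw [← IntegrableOn, integrableOn_Ioi_comp_mul_left_iff g 0 (inv_pos.2 hm), mul_zero]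
  exact hg

theorem integral_Ioi_inv_sq_smul_comp_inv_mul {E : Type*} [NormedAddCommGroup E]
    [NormedSpace ℝ E] (g : ℝ → E) {m : ℝ} (hm : 0 < m) :
    ∫ t in Ioi (0 : ℝ), (m ^ 2)⁻¹ • g (m⁻¹ * t) = m⁻¹ • ∫ t in Ioi (0 : ℝ), g t := by
  rw [integral_smul, integral_comp_mul_left_Ioi g 0 (inv_pos.2 hm), mul_zero, smul_smul]
  congr 1
  field_simp

theorem isNaturalMass_iff {lam μ : ℝ} : IsNaturalMass lam μ ↔ μ ^ 2 = kappa lam / lam := by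
  rw [IsNaturalMass, ← kappa_eq]
  norm_cast

theorem kappa_div_pos {lam : ℝ} (h0 : lam ≠ 0) : 0 < kappa lam / lam := by
  rcases h0.lt_or_gt with h | h
  · exact div_pos_of_neg_of_neg (kappa_neg h) h
  · exact div_pos (kappa_pos h) h

theorem kappa_ne_zero {lam : ℝ} (h0 : lam ≠ 0) : kappa lam ≠ 0 :=
  (div_ne_zero_iff.1 (kappa_div_pos h0).ne').1

theorem exists_isNaturalMass {lam : ℝ} (h0 : lam ≠ 0) : ∃ μ : ℝ, 0 < μ ∧ IsNaturalMass lam μ :=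
  have h := kappa_div_pos h0
  ⟨√(kappa lam / lam), Real.sqrt_pos.2 h, isNaturalMass_iff.2 (Real.sq_sqrt h.le)⟩

namespace IsProfile

variable {lam μ x t : ℝ} {ψ ψ' : ℝ → ℝ}

theorem hypDensity_eq (P : IsProfile (kappa lam) ψ ψ') (hlam : -(1 / Real.pi) ≤ lam)
    (hμ : 0 < μ) (hx : 0 ≤ x) : hypDensity lam μ x = ((μ ^ 2 * ψ (x / μ ^ 2) : ℝ) : ℂ) := by
  have hm := P.two_mul_mul_moment_zero hlam
  have hx' : 0 ≤ x / μ ^ 2 := by positivity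
  have harg : -(x : ℂ) / (μ : ℂ) ^ 2 = -((x / μ ^ 2 : ℝ) : ℂ) := by push_cast; ring
  have hmem : -((x / μ ^ 2 : ℝ) : ℂ) ∈ cutPlane := by
    change 1 - -((x / μ ^ 2 : ℝ) : ℂ) ∈ Complex.slitPlane
    rw [sub_neg_eq_add]
    exact ofReal_mem_shiftedSlitPlane (by linarith)
  have hμ' : (μ : ℂ) ≠ 0 := Complex.ofReal_ne_zero.2 hμ.ne'
  rw [hypDensity, harg, hyp2F1_eq (P.isHyp2F1 hm (kappa_eq lam)) hmem, neg_neg,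
    Complex.ofReal_mul, ← P.continuation_ofReal hm hx', continuation]
  push_cast
  field_simp
  ring

theorem rho_eq (P : IsProfile (kappa lam) ψ ψ') (hlam : -(1 / Real.pi) ≤ lam) (hμ : 0 < μ)
    (hx : 0 ≤ x) : rho lam μ x = μ ^ 2 * ψ (x / μ ^ 2) := by
  rw [rho, P.hypDensity_eq hlam hμ hx, Complex.ofReal_re]

theorem rho_div_eq (P : IsProfile (kappa lam) ψ ψ') (hlam : -(1 / Real.pi) ≤ lam) (hμ : 0 < μ)
    (w : ℂ) (ht : 0 < t) :
    (rho lam μ t : ℂ) /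
        (((t : ℂ) + (μ : ℂ) ^ 2) ^ 2 * ((t : ℂ) + (μ : ℂ) ^ 2 + (μ : ℂ) ^ 2 * w)) =
      ((μ ^ 2) ^ 2)⁻¹ • ψ ((μ ^ 2)⁻¹ * t) • stieltjesKernel 2 1 w ((μ ^ 2)⁻¹ * t) := by
  have hμ' : (μ : ℂ) ≠ 0 := Complex.ofReal_ne_zero.2 hμ.ne'
  have hadd : (t : ℂ) + (μ : ℂ) ^ 2 = (μ : ℂ) ^ 2 * ((((μ ^ 2)⁻¹ * t : ℝ) : ℂ) + 1) := by
    push_cast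
    field_simp
  rw [P.rho_eq hlam hμ ht.le, div_eq_inv_mul t, hadd, ← mul_add, add_comm _ w, stieltjesKernel]
  simp only [Complex.real_smul, Complex.ofReal_mul, Complex.ofReal_inv, Complex.ofReal_pow,
    div_eq_mul_inv, mul_inv, mul_pow, pow_one]
  field_simp

theorem integrableOn_rho_div (P : IsProfile (kappa lam) ψ ψ') (hlam : -(1 / Real.pi) ≤ lam)
    (hμ : 0 < μ)
    (h : IntegrableOn (fun t : ℝ => ψ t • stieltjesKernel 2 1 ((x / μ ^ 2 : ℝ) : ℂ) t) (Ioi 0)) :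
    IntegrableOn (fun t : ℝ => rho lam μ t / ((t + μ ^ 2) ^ 2 * (t + μ ^ 2 + x))) (Ioi 0) := by
  have hscale := (integrableOn_Ioi_inv_sq_smul_comp_inv_mul (pow_pos hμ 2) h).congr_fun
    (fun t ht => (P.rho_div_eq hlam hμ _ ht).symm) measurableSet_Ioi
  refine hscale.re.congr (ae_of_all _ fun t => ?_)
  have hx : (μ : ℂ) ^ 2 * ((x / μ ^ 2 : ℝ) : ℂ) = x := by
    rw [← Complex.ofReal_pow, ← Complex.ofReal_mul, mul_div_cancel₀ _ (pow_pos hμ 2).ne']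
  simp only [hx]
  norm_cast

theorem integrableOn_rho_div_of_nonneg (P : IsProfile (kappa lam) ψ ψ')
    (hlam : -(1 / Real.pi) ≤ lam) (hμ : 0 < μ) (hx : 0 ≤ x) :
    IntegrableOn (fun t : ℝ => rho lam μ t / ((t + μ ^ 2) ^ 2 * (t + μ ^ 2 + x))) (Ioi 0) :=
  P.integrableOn_rho_div hlam hμ <| P.integrableOn_stieltjesKernel
    (ofReal_mem_shiftedSlitPlane (neg_one_lt_zero.trans_le (by positivity))) le_rfl

theorem integrableOn_rho_div_cube (P : IsProfile (kappa lam) ψ ψ')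
    (hlam : -(1 / Real.pi) ≤ lam) (hμ : 0 < μ) :
    IntegrableOn (fun t : ℝ => rho lam μ t / (t + μ ^ 2) ^ 3) (Ioi 0) := by
  simpa only [add_zero, ← pow_succ] using P.integrableOn_rho_div_of_nonneg hlam hμ le_rfl

theorem smul_stieltjesKernel_neg_one (ψ : ℝ → ℝ) (t : ℝ) :
    ψ t • stieltjesKernel 2 1 (-1) t = ((ψ t • (t * (t + 1) ^ (0 + 2))⁻¹ : ℝ) : ℂ) := by
  simp only [stieltjesKernel, smul_eq_mul, Complex.real_smul, pow_one, mul_inv, zero_add,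
    neg_add_cancel_comm_assoc]
  push_cast
  ring

theorem integrableOn_rho_div_sq_mul_self (P : IsProfile (kappa lam) ψ ψ')
    (hlam : -(1 / Real.pi) ≤ lam) (hμ : 0 < μ) :
    IntegrableOn (fun t : ℝ => rho lam μ t / ((t + μ ^ 2) ^ 2 * t)) (Ioi 0) := by
  have hdiv : ((-μ ^ 2 / μ ^ 2 : ℝ) : ℂ) = -1 := by
    rw [neg_div, div_self (pow_pos hμ 2).ne', Complex.ofReal_neg, Complex.ofReal_one]
  have h := P.integrableOn_rho_div (x := -μ ^ 2) hlam hμ (by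
    simp only [hdiv, smul_stieltjesKernel_neg_one]
    exact (P.integrableOn_div_moment 0).ofReal)
  simpa only [add_neg_cancel_right] using h

theorem integral_rho_div (P : IsProfile (kappa lam) ψ ψ') (hlam : -(1 / Real.pi) ≤ lam)
    (hμ : 0 < μ) (w : ℂ) :
    ∫ t in Ioi (0 : ℝ), (rho lam μ t : ℂ) /
        (((t : ℂ) + (μ : ℂ) ^ 2) ^ 2 * ((t : ℂ) + (μ : ℂ) ^ 2 + (μ : ℂ) ^ 2 * w)) =
      ((μ : ℂ) ^ 2)⁻¹ * stieltjes ψ 2 1 w := by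
  rw [setIntegral_congr_fun measurableSet_Ioi fun t ht => P.rho_div_eq hlam hμ w ht,
    integral_Ioi_inv_sq_smul_comp_inv_mul (fun t => ψ t • stieltjesKernel 2 1 w t) (pow_pos hμ 2),
    stieltjes, Complex.real_smul, Complex.ofReal_inv, Complex.ofReal_pow]

theorem integral_rho_div_cube (P : IsProfile (kappa lam) ψ ψ') (hlam : -(1 / Real.pi) ≤ lam)
    (hμ : 0 < μ) :
    ∫ t in Ioi (0 : ℝ), rho lam μ t / (t + μ ^ 2) ^ 3 = (μ ^ 2)⁻¹ * moment ψ 0 := by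
  have hzero : stieltjes ψ 2 1 0 = moment ψ 0 := by
    rw [← stieltjes_zero_right ψ 0 0]
    simp [stieltjes, stieltjesKernel, ← mul_inv, ← pow_succ]
  have h := P.integral_rho_div hlam hμ 0
  simp only [mul_zero, add_zero, ← pow_succ, hzero] at h
  exact_mod_cast h

theorem R4_eq (P : IsProfile (kappa lam) ψ ψ') (hlam : -(1 / Real.pi) ≤ lam) (hμ : 0 < μ)
    (w : ℂ) :
    R4 lam μ (rho lam μ) ((μ : ℂ) ^ 2 * w) = (μ : ℂ) ^ 2 * continuation lam ψ w := by
  have hμ' : (μ : ℂ) ≠ 0 := Complex.ofReal_ne_zero.2 hμ.ne'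
  rw [R4, P.integral_rho_div hlam hμ, continuation]
  field_simp

theorem solvesFredholm (P : IsProfile (kappa lam) ψ ψ') (hlam : -(1 / Real.pi) ≤ lam)
    (hμ : 0 < μ) : SolvesFredholm lam μ (rho lam μ) := by
  refine fun x hx => ⟨P.integrableOn_rho_div_of_nonneg hlam hμ hx, ?_⟩
  have hR4 := P.R4_eq hlam hμ ((x / μ ^ 2 : ℝ) : ℂ)
  rw [P.continuation_ofReal (P.two_mul_mul_moment_zero hlam) (by positivity),
    ← Complex.ofReal_pow, ← Complex.ofReal_mul, ← Complex.ofReal_mul, ← P.rho_eq hlam hμ hx,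
    mul_div_cancel₀ _ (pow_pos hμ 2).ne', R4] at hR4
  exact_mod_cast hR4.symm

theorem continuation_neg_one (P : IsProfile (kappa lam) ψ ψ') (hlam : -(1 / Real.pi) ≤ lam)
    (h0 : lam ≠ 0) : continuation lam ψ (-1) = ((-(lam / kappa lam) : ℝ) : ℂ) := by
  have hκ := kappa_ne_zero h0
  have hzero := P.two_mul_mul_moment_zero hlam
  have heq := P.moment_eq 0
  simp only [CharP.cast_eq_zero, zero_add, one_mul] at heq
  simp only [continuation, stieltjes, smul_stieltjesKernel_neg_one, integral_complex_ofReal]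
  norm_cast
  rw [zero_add]
  generalize ∫ t in Ioi (0 : ℝ), ψ t • (t * (t + 1) ^ 2)⁻¹ = I at heq ⊢
  push_cast
  field_simp
  linear_combination -lam * heq + hzero

theorem R4_neg_sq_eq_neg_one_iff (P : IsProfile (kappa lam) ψ ψ')
    (hlam : -(1 / Real.pi) ≤ lam) (h0 : lam ≠ 0) (hμ : 0 < μ) :
    R4 lam μ (rho lam μ) (-(μ : ℂ) ^ 2) = -1 ↔ IsNaturalMass lam μ := by
  have hκ := kappa_ne_zero h0
  rw [← mul_neg_one ((μ : ℂ) ^ 2), P.R4_eq hlam hμ, P.continuation_neg_one hlam h0,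
    isNaturalMass_iff, eq_div_iff h0, ← Complex.ofReal_pow, Complex.ofReal_neg, mul_neg, neg_inj,
    ← Complex.ofReal_mul, Complex.ofReal_eq_one, mul_div_assoc', div_eq_one_iff_eq hκ]

theorem integral_rho_div_cube_eq_half_iff (P : IsProfile (kappa lam) ψ ψ')
    (hlam : -(1 / Real.pi) ≤ lam) (h0 : lam ≠ 0) (hμ : 0 < μ) :
    ∫ t in Ioi (0 : ℝ), rho lam μ t / (t + μ ^ 2) ^ 3 = 1 / 2 ↔ IsNaturalMass lam μ := by
  rw [P.integral_rho_div_cube hlam hμ, isNaturalMass_iff, eq_div_iff h0,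
    ← P.two_mul_mul_moment_zero hlam, inv_mul_eq_iff_eq_mul₀ (pow_pos hμ 2).ne',
    ← mul_left_inj' (mul_ne_zero two_ne_zero h0)]
  constructor <;> intro h <;> linear_combination -h

end IsProfile

/-! ### Comparison along the critical line -/

/-- The potential `κ / (t² + 1/4)` of the second order equation satisfied by the continuation along
the line `-1/2 + i t`, with real and imaginary parts of the continuation as solutions. -/
noncomputable def linePotential (κ t : ℝ) : ℝ := κ / (t ^ 2 + 1 / 4)

section LinePotential

variable {κ t : ℝ}

theorem linePotential_zero (κ : ℝ) : linePotential κ 0 = 4 * κ := by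
  unfold linePotential
  ring

theorem linePotential_nonneg (hκ : 0 ≤ κ) (t : ℝ) : 0 ≤ linePotential κ t := by
  unfold linePotential
  positivity

theorem linePotential_le (hκ : 0 ≤ κ) (t : ℝ) : linePotential κ t ≤ 4 * κ := by
  rw [linePotential, div_le_iff₀ (by positivity)]
  nlinarith [mul_nonneg hκ (sq_nonneg t)]

theorem linePotential_mul_sq_le {b : ℝ} (hb : 0 ≤ b) (hκ : κ ≤ b) (t : ℝ) :
    linePotential κ t * t ^ 2 ≤ b := by
  rw [linePotential, div_mul_eq_mul_div, div_le_iff₀ (by positivity)]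
  nlinarith [sq_nonneg t]

theorem hasDerivAt_linePotential (κ t : ℝ) :
    HasDerivAt (linePotential κ) (-(2 * κ * t / (t ^ 2 + 1 / 4) ^ 2)) t := by
  have hsq : HasDerivAt (fun t : ℝ => t ^ 2 + 1 / 4) (2 * t) t := by
    simpa using (hasDerivAt_pow 2 t).add_const (1 / 4 : ℝ)
  refine ((hasDerivAt_const t κ).fun_div hsq (by positivity)).congr_deriv ?_
  ring

theorem continuous_linePotential (κ : ℝ) : Continuous (linePotential κ) :=
  continuous_iff_continuousAt.2 fun t => (hasDerivAt_linePotential κ t).continuousAt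

/-- The growth rate `t ^ (1/4)` of `y'` comes from this bound on the logarithmic derivative of the
energy `y'² + p y²`, where `p` is the potential with parameter `|κ|`; the proof is AM-GM applied to
the cross term `y y'`. -/
theorem energy_deriv_mul_le (hκ : |κ| ≤ 1 / 32) (ht : 0 ≤ t) (u v : ℝ) :
    (2 * (linePotential |κ| t - linePotential κ t) * (u * v) +
      -(2 * |κ| * t / (t ^ 2 + 1 / 4) ^ 2) * u ^ 2) * (2 * t + 1) ≤
      v ^ 2 + linePotential |κ| t * u ^ 2 := by
  have hcoeff : (|κ| - κ) ^ 2 ≤ 4 * |κ| ^ 2 := by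
    nlinarith [sq_abs κ, neg_abs_le κ, abs_nonneg κ]
  have hquad : 4 * |κ| * (2 * t + 1) ^ 2 ≤ t ^ 2 + 1 / 4 := by
    nlinarith [mul_le_mul_of_nonneg_right hκ (sq_nonneg (2 * t + 1)), sq_nonneg (2 * t - 1)]
  have hgap : 0 ≤ |κ| * (t ^ 2 + 1 / 4) - (|κ| - κ) ^ 2 * (2 * t + 1) ^ 2 := by
    nlinarith [mul_le_mul_of_nonneg_right hcoeff (sq_nonneg (2 * t + 1)),
      mul_le_mul_of_nonneg_left hquad (abs_nonneg κ)]
  have hsquare : v ^ 2 + linePotential |κ| t * u ^ 2 -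
      (2 * (linePotential |κ| t - linePotential κ t) * (u * v) +
        -(2 * |κ| * t / (t ^ 2 + 1 / 4) ^ 2) * u ^ 2) * (2 * t + 1) =
      (v - (|κ| - κ) * u * (2 * t + 1) / (t ^ 2 + 1 / 4)) ^ 2 +
        (|κ| * (t ^ 2 + 1 / 4) - (|κ| - κ) ^ 2 * (2 * t + 1) ^ 2) * (u / (t ^ 2 + 1 / 4)) ^ 2 +
        2 * |κ| * t * (2 * t + 1) * (u / (t ^ 2 + 1 / 4)) ^ 2 := by
    unfold linePotential
    field_simp
    ring
  have hdamping : 0 ≤ 2 * |κ| * t * (2 * t + 1) * (u / (t ^ 2 + 1 / 4)) ^ 2 := by positivity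
  linarith [sq_nonneg (v - (|κ| - κ) * u * (2 * t + 1) / (t ^ 2 + 1 / 4)),
    mul_nonneg hgap (sq_nonneg (u / (t ^ 2 + 1 / 4)))]

end LinePotential

namespace IsRegularSolution

variable {κ t : ℝ} {y y' : ℝ → ℝ}

theorem antitoneOn_energy_sq_div (S : IsRegularSolution (linePotential κ) y y')
    (hκ : |κ| ≤ 1 / 32) : AntitoneOn
      (fun t => (y' t ^ 2 + linePotential |κ| t * y t ^ 2) ^ 2 / (2 * t + 1)) (Ici 0) := by
  refine antitoneOn_of_hasDerivWithinAt_nonpos (convex_Ici 0)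
    (f' := fun t => 2 * (y' t ^ 2 + linePotential |κ| t * y t ^ 2) *
      ((2 * (linePotential |κ| t - linePotential κ t) * (y t * y' t) +
        -(2 * |κ| * t / (t ^ 2 + 1 / 4) ^ 2) * y t ^ 2) * (2 * t + 1) -
      (y' t ^ 2 + linePotential |κ| t * y t ^ 2)) / (2 * t + 1) ^ 2)
    (fun t (ht : 0 ≤ t) => ?_) ?_ ?_
  · exact ContinuousAt.continuousWithinAt <| ContinuousAt.div
      ((((S.continuousAt_deriv ht).pow 2).add
        ((continuous_linePotential |κ|).continuousAt.mul ((S.continuousAt ht).pow 2))).pow 2)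
      (by fun_prop) (by positivity)
  · rw [interior_Ici]
    intro t (ht : 0 < t)
    refine HasDerivAt.hasDerivWithinAt (HasDerivAt.congr_deriv (HasDerivAt.fun_div
      ((S.hasDerivAt_energy ht (hasDerivAt_linePotential |κ| t)).fun_pow 2)
      (((hasDerivAt_id t).const_mul 2).add_const 1) (by positivity)) ?_)
    push_cast
    ring
  · rw [interior_Ici]
    intro t (ht : 0 < t)
    refine div_nonpos_of_nonpos_of_nonneg (mul_nonpos_of_nonneg_of_nonpos ?_ ?_) (sq_nonneg _)
    · have := linePotential_nonneg (abs_nonneg κ) t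
      positivity
    · exact sub_nonpos.2 (energy_deriv_mul_le hκ ht.le _ _)

theorem deriv_pow_four_le (S : IsRegularSolution (linePotential κ) y y') (hκ : |κ| ≤ 1 / 32)
    (ht : 0 ≤ t) : y' t ^ 4 ≤ (y' 0 ^ 2 + 4 * |κ| * y 0 ^ 2) ^ 2 * (2 * t + 1) := by
  have henergy := S.antitoneOn_energy_sq_div hκ self_mem_Ici ht ht
  simp only [linePotential_zero, mul_zero, zero_add, div_one] at henergy
  rw [div_le_iff₀ (by positivity)] at henergy
  refine le_trans ?_ henergy
  rw [show y' t ^ 4 = (y' t ^ 2) ^ 2 by ring]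
  gcongr
  exact le_add_of_nonneg_right (mul_nonneg (linePotential_nonneg (abs_nonneg κ) t) (sq_nonneg _))

theorem exists_abs_deriv_le (S : IsRegularSolution (linePotential κ) y y') (hκ : |κ| ≤ 1 / 32) :
    ∃ B, ∀ t, 0 ≤ t → |y' t| ≤ B * (1 + t) ^ (1 / 4 : ℝ) := by
  set M := 2 * (y' 0 ^ 2 + 4 * |κ| * y 0 ^ 2) ^ 2
  refine ⟨M ^ (1 / 4 : ℝ), fun t ht => ?_⟩
  have hpow : |y' t| ^ 4 ≤ M * (1 + t) := by
    rw [Even.pow_abs ⟨2, rfl⟩]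
    refine (S.deriv_pow_four_le hκ ht).trans ?_
    nlinarith [sq_nonneg (y' 0 ^ 2 + 4 * |κ| * y 0 ^ 2)]
  calc |y' t| = (|y' t| ^ 4) ^ (1 / 4 : ℝ) := by
        rw [← Real.rpow_natCast, ← Real.rpow_mul (abs_nonneg _)]
        norm_num
    _ ≤ (M * (1 + t)) ^ (1 / 4 : ℝ) := by gcongr
    _ = M ^ (1 / 4 : ℝ) * (1 + t) ^ (1 / 4 : ℝ) := Real.mul_rpow (by positivity) (by positivity)

theorem deriv_sq_le (S : IsRegularSolution (linePotential κ) y y') (hκ : 0 ≤ κ) (ht : 0 < t) :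
    y' t ^ 2 ≤ y' 0 ^ 2 + 4 * κ * y 0 ^ 2 := by
  refine S.deriv_sq_le_of_potential_antitone (fun t _ => linePotential_nonneg hκ t)
    (fun t _ => hasDerivAt_linePotential κ t) (fun t ht => neg_nonpos.2 (by positivity)) ?_ ht
  rw [← linePotential_zero]
  exact ((continuous_linePotential κ).continuousAt.tendsto.mono_left nhdsWithin_le_nhds).mul
    (S.tendsto_zero.pow 2)

theorem sq_zero_le_sq (S : IsRegularSolution (linePotential κ) y y') (hκ : κ ≤ 0) (h1 : y' 0 = 0)
    (ht : 0 < t) : y 0 ^ 2 ≤ y t ^ 2 := by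
  have hlim : Tendsto (fun t => y t * y' t) (𝓝[>] 0) (𝓝 0) := by
    simpa [h1] using S.tendsto_zero.mul S.tendsto_deriv_zero
  have hcross (t : ℝ) (ht : 0 < t) : 0 ≤ y t * y' t := by
    have hle := le_of_tendsto_of_hasDerivAt_nonneg
      (fun t ht => (S.hasDerivAt t (le_of_lt ht)).fun_mul (S.hasDerivAt_deriv t ht))
      (fun t ht => ?_) hlim ht
    · exact hle
    · have hq : linePotential κ t ≤ 0 := div_nonpos_of_nonpos_of_nonneg hκ (by positivity)
      nlinarith [mul_self_nonneg (y' t), mul_nonneg (neg_nonneg.2 hq) (sq_nonneg (y t))]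
  have hsq := le_of_tendsto_of_hasDerivAt_nonneg (fun t ht => S.hasDerivAt_sq (le_of_lt ht))
    (fun t ht => mul_nonneg zero_le_two (hcross t ht)) (S.tendsto_zero.pow 2) ht
  exact hsq

theorem abs_sub_zero_le_of_deriv_zero (S : IsRegularSolution (linePotential κ) y y') (hκ : 0 ≤ κ)
    (h1 : y' 0 = 0) (ht : 0 ≤ t) : |y t - y 0| ≤ 2 * √κ * |y 0| * t := by
  refine S.abs_sub_zero_le ht fun s hs _ => abs_le_of_sq_le_sq ?_ (by positivity)
  calc y' s ^ 2 ≤ y' 0 ^ 2 + 4 * κ * y 0 ^ 2 := S.deriv_sq_le hκ hs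
    _ = (2 * √κ * |y 0|) ^ 2 := by rw [h1, mul_pow, mul_pow, Real.sq_sqrt hκ, sq_abs]; ring

theorem zero_mul_nonneg (S : IsRegularSolution (linePotential κ) y y') (hκ : 0 ≤ κ)
    (h1 : y' 0 = 0) (ht : 0 ≤ t) (hts : 2 * √κ * t ≤ 1) : 0 ≤ y 0 * y t := by
  have habs : |y t - y 0| ≤ |y 0| :=
    (S.abs_sub_zero_le_of_deriv_zero hκ h1 ht).trans (by nlinarith [abs_nonneg (y 0)])
  nlinarith [sq_le_sq.2 habs, sq_nonneg (y t)]

theorem sq_le_sq_zero (S : IsRegularSolution (linePotential κ) y y') (hκ : 0 ≤ κ)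
    (h1 : y' 0 = 0) (ht : 0 ≤ t) (hts : 2 * √κ * t ≤ 1) : y t ^ 2 ≤ y 0 ^ 2 := by
  have hnonneg (s : ℝ) (hs : s ∈ Ioo 0 t) : 0 ≤ y 0 * y s :=
    S.zero_mul_nonneg hκ h1 hs.1.le (le_trans (by gcongr; exact hs.2.le) hts)
  have hderiv : AntitoneOn (fun s => y 0 * y' s) (Icc 0 t) := by
    refine antitoneOn_of_hasDerivWithinAt_nonpos
      (f' := fun s => y 0 * (-linePotential κ s * y s)) (convex_Icc 0 t)
      (fun s hs => ((S.continuousAt_deriv hs.1).const_mul (y 0)).continuousWithinAt) ?_ ?_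
    · rw [interior_Icc]
      exact fun s hs => ((S.hasDerivAt_deriv s hs.1).const_mul (y 0)).hasDerivWithinAt
    · rw [interior_Icc]
      intro s hs
      nlinarith [mul_nonneg (linePotential_nonneg hκ s) (hnonneg s hs)]
  have hmono : AntitoneOn (fun s => y 0 * y s) (Icc 0 t) := by
    refine antitoneOn_of_hasDerivWithinAt_nonpos (f' := fun s => y 0 * y' s) (convex_Icc 0 t)
      (fun s hs => ((S.continuousAt hs.1).const_mul (y 0)).continuousWithinAt) ?_ ?_
    · rw [interior_Icc]
      exact fun s hs => ((S.hasDerivAt s hs.1.le).const_mul (y 0)).hasDerivWithinAt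
    · rw [interior_Icc]
      intro s hs
      simpa [h1] using hderiv ⟨le_rfl, ht⟩ ⟨hs.1.le, hs.2.le⟩ hs.1.le
  have hle : y 0 * y t ≤ y 0 * y 0 := hmono ⟨le_rfl, ht⟩ ⟨ht, le_rfl⟩ ht
  have hpos := S.zero_mul_nonneg hκ h1 ht hts
  rcases eq_or_ne (y 0) 0 with h0 | h0
  · have h := S.abs_sub_zero_le_of_deriv_zero hκ h1 ht
    simp only [h0, sub_zero, abs_zero, mul_zero, zero_mul, abs_nonpos_iff] at h
    rw [h, h0]
  · refine le_of_mul_le_mul_left ?_ (sq_pos_of_ne_zero h0)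
    nlinarith

theorem sq_sub_sq_le (S : IsRegularSolution (linePotential κ) y y') (hκ : 0 ≤ κ)
    (h1 : y' 0 = 0) (ht : 0 ≤ t) : y t ^ 2 - y 0 ^ 2 ≤ 12 * κ * y 0 ^ 2 * t ^ 2 := by
  rcases le_total (2 * √κ * t) 1 with hts | hts
  · exact (sub_nonpos.2 (S.sq_le_sq_zero hκ h1 ht hts)).trans (by positivity)
  have habs : |y t| ≤ |y 0| * (1 + 2 * √κ * t) := by
    linarith [S.abs_sub_zero_le_of_deriv_zero hκ h1 ht, abs_sub_abs_le_abs_sub (y t) (y 0)]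
  calc y t ^ 2 - y 0 ^ 2 ≤ (|y 0| * (1 + 2 * √κ * t)) ^ 2 - y 0 ^ 2 := by
        rw [← sq_abs (y t)]
        gcongr
    _ = y 0 ^ 2 * (2 * (2 * √κ * t) + (2 * √κ * t) ^ 2) := by
        rw [mul_pow, sq_abs]
        ring
    _ ≤ y 0 ^ 2 * (3 * (2 * √κ * t) ^ 2) := by
        gcongr
        nlinarith
    _ = 12 * κ * y 0 ^ 2 * t ^ 2 := by
        rw [mul_pow, mul_pow, Real.sq_sqrt hκ]
        ring

theorem abs_deriv_le_deriv_zero (S : IsRegularSolution (linePotential κ) y y') (hκ : 0 ≤ κ)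
    (h0 : y 0 = 0) (h1 : 0 ≤ y' 0) (ht : 0 < t) : |y' t| ≤ y' 0 := by
  refine abs_le_of_sq_le_sq ?_ h1
  simpa [h0] using S.deriv_sq_le hκ ht

theorem abs_deriv_sub_le (S : IsRegularSolution (linePotential κ) y y') (hκ : 0 ≤ κ)
    (h0 : y 0 = 0) (h1 : 0 ≤ y' 0) (ht : 0 ≤ t) (ht1 : t ≤ 1) :
    |y' t - y' 0| ≤ 4 * κ * y' 0 := by
  have hy (s : ℝ) (hs : 0 ≤ s) : |y s| ≤ y' 0 * s := by
    simpa [h0] using S.abs_sub_zero_le hs fun r hr _ => S.abs_deriv_le_deriv_zero hκ h0 h1 hr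
  have hsub : |y' t - y' 0| ≤ 4 * κ * y' 0 * (t - 0) := by
    refine abs_sub_le_of_hasDerivAt ht
      (fun s hs => (S.continuousAt_deriv hs.1).continuousWithinAt)
      (fun s hs => S.hasDerivAt_deriv s hs.1) fun s hs => ?_
    calc |-linePotential κ s * y s| = linePotential κ s * |y s| := by
          rw [abs_mul, abs_neg, abs_of_nonneg (linePotential_nonneg hκ s)]
      _ ≤ 4 * κ * y' 0 := by
          gcongr
          · exact linePotential_le hκ s
          · exact (hy s hs.1.le).trans (mul_le_of_le_one_right h1 (hs.2.le.trans ht1))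
  refine hsub.trans ?_
  rw [sub_zero]
  exact mul_le_of_le_one_right (by positivity) ht1

theorem half_deriv_zero_le (S : IsRegularSolution (linePotential κ) y y') (hκ : 0 ≤ κ)
    (hκ' : κ ≤ 1 / 8) (h0 : y 0 = 0) (h1 : 0 ≤ y' 0) : y' 0 / 2 ≤ y 1 := by
  have hsub := abs_sub_le_of_hasDerivAt (f := fun t => y t - y' 0 * t)
    (f' := fun t => y' t - y' 0 * 1) (B := 4 * κ * y' 0) zero_le_one
    (fun s hs => ((S.continuousAt hs.1).sub (by fun_prop)).continuousWithinAt)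
    (fun s hs => (S.hasDerivAt s hs.1.le).fun_sub ((hasDerivAt_id s).const_mul _))
    fun s hs => by simpa using S.abs_deriv_sub_le hκ h0 h1 hs.1.le hs.2.le
  simp only [h0, mul_zero, sub_zero, mul_one] at hsub
  nlinarith [(abs_le.1 hsub).1]

end IsRegularSolution

/-! ### Paths along which the logarithms in the two-point function are controlled -/

/-- The contribution of a path `Z` with derivative `W` to the exponent of the two-point function
`G(a, 0)`. -/
noncomputable def pathTerm (Z W : ℝ → ℂ) (a t : ℝ) : ℂ :=
  (Complex.log (a - conj (Z t)) - Complex.log ((0 : ℝ) - conj (Z t))) * (W t / Z t)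

/-- A path `Z` with continuous derivative `W` such that, for all `s` in a right half-line around
zero, `s - conj Z` avoids the branch cut of the logarithm and the `s`-derivative of
`pathTerm Z W s` is dominated by one integrable function. -/
structure IsAdmissiblePath (Z W : ℝ → ℂ) : Prop where
  hasDerivAt : ∀ t, HasDerivAt Z (W t) t
  continuous_deriv : Continuous W
  exists_dominated : ∃ ε > 0, ∃ g : ℝ → ℝ, Integrable g ∧ ∀ t s : ℝ, -ε < s →
    (s : ℂ) - conj (Z t) ∈ Complex.slitPlane ∧ ‖((s : ℂ) - conj (Z t))⁻¹ * (W t / Z t)‖ ≤ g t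

namespace IsAdmissiblePath

variable {Z W : ℝ → ℂ}

theorem continuous (A : IsAdmissiblePath Z W) : Continuous Z :=
  continuous_iff_continuousAt.2 fun t => (A.hasDerivAt t).continuousAt

theorem mem_slitPlane (A : IsAdmissiblePath Z W) {a : ℝ} (ha : 0 ≤ a) (t : ℝ) :
    (a : ℂ) - conj (Z t) ∈ Complex.slitPlane := by
  obtain ⟨ε, hε, g, -, hbound⟩ := A.exists_dominated
  exact (hbound t a (by linarith)).1

theorem neg_mem_slitPlane (A : IsAdmissiblePath Z W) (t : ℝ) : -Z t ∈ Complex.slitPlane := by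
  simpa [Complex.mem_slitPlane_iff] using A.mem_slitPlane le_rfl t

theorem ne_zero (A : IsAdmissiblePath Z W) (t : ℝ) : Z t ≠ 0 :=
  neg_ne_zero.1 (Complex.slitPlane_ne_zero (A.neg_mem_slitPlane t))

theorem hasDerivAt_pathTerm {s t : ℝ} (hs : (s : ℂ) - conj (Z t) ∈ Complex.slitPlane) :
    HasDerivAt (fun s : ℝ => pathTerm Z W s t) (((s : ℂ) - conj (Z t))⁻¹ * (W t / Z t)) s := by
  have hlog := (Complex.ofRealCLM.hasDerivAt.sub_const (conj (Z t))).clog_real (x := s) hs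
  refine ((hlog.sub_const _).mul_const (W t / Z t)).congr_deriv ?_
  simp

theorem continuous_pathTerm (A : IsAdmissiblePath Z W) {a : ℝ}
    (ha : ∀ t, (a : ℂ) - conj (Z t) ∈ Complex.slitPlane) : Continuous (pathTerm Z W a) := by
  have hlog : ∀ s : ℝ, (∀ t, (s : ℂ) - conj (Z t) ∈ Complex.slitPlane) →
      Continuous fun t => Complex.log ((s : ℂ) - conj (Z t)) := fun s hs =>
    (continuous_const.sub (Complex.continuous_conj.comp A.continuous)).clog hs
  exact ((hlog a ha).sub (hlog 0 (A.mem_slitPlane le_rfl))).mul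
    (A.continuous_deriv.div A.continuous A.ne_zero)

theorem integrable_pathTerm (A : IsAdmissiblePath Z W) {a : ℝ} (ha : 0 ≤ a) :
    Integrable (pathTerm Z W a) := by
  obtain ⟨ε, hε, g, hg, hbound⟩ := A.exists_dominated
  refine (hg.mul_const a).mono' (A.continuous_pathTerm (A.mem_slitPlane ha)).aestronglyMeasurable
    (Eventually.of_forall fun t => ?_)
  have hmvt := Convex.norm_image_sub_le_of_norm_hasDerivWithin_le (s := Icc 0 a)
    (f := fun s : ℝ => pathTerm Z W s t)
    (fun s hs => (hasDerivAt_pathTerm (hbound t s (by linarith [hs.1])).1).hasDerivWithinAt)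
    (fun s hs => (hbound t s (by linarith [hs.1])).2) (convex_Icc 0 a)
    (left_mem_Icc.2 ha) (right_mem_Icc.2 ha)
  have hzero : pathTerm Z W 0 t = 0 := by simp [pathTerm]
  rwa [hzero, sub_zero, sub_zero, Real.norm_of_nonneg ha] at hmvt

theorem neg_conj_inv_mul (A : IsAdmissiblePath Z W) (t : ℝ) :
    (((0 : ℝ) : ℂ) - conj (Z t))⁻¹ * (W t / Z t) = -(W t / Complex.normSq (Z t)) := by
  have hne := A.ne_zero t
  have hconj : conj (Z t) ≠ 0 := (map_ne_zero _).2 hne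
  rw [Complex.normSq_eq_conj_mul_self, Complex.ofReal_zero, zero_sub]
  field_simp

theorem continuous_div_normSq (A : IsAdmissiblePath Z W) :
    Continuous fun t => W t / Complex.normSq (Z t) :=
  A.continuous_deriv.div
    (Complex.continuous_ofReal.comp (Complex.continuous_normSq.comp A.continuous))
    fun t => Complex.ofReal_ne_zero.2 (Complex.normSq_pos.2 (A.ne_zero t)).ne'

theorem integrable_div_normSq (A : IsAdmissiblePath Z W) :
    Integrable fun t => W t / Complex.normSq (Z t) := by
  obtain ⟨ε, hε, g, hg, hbound⟩ := A.exists_dominated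
  refine hg.mono' A.continuous_div_normSq.aestronglyMeasurable (Eventually.of_forall fun t => ?_)
  rw [← norm_neg, ← A.neg_conj_inv_mul]
  exact (hbound t 0 (by linarith)).2

theorem hasDerivAt_integral (A : IsAdmissiblePath Z W) :
    HasDerivAt (fun a : ℝ => ∫ t, pathTerm Z W a t) (-∫ t, W t / Complex.normSq (Z t)) 0 := by
  obtain ⟨ε, hε, g, hg, hbound⟩ := A.exists_dominated
  have hnhds : Ioi (-ε) ∈ 𝓝 (0 : ℝ) := Ioi_mem_nhds (by linarith)
  have h := (hasDerivAt_integral_of_dominated_loc_of_deriv_le (μ := volume) (bound := g)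
    (F := pathTerm Z W) (F' := fun s t => ((s : ℂ) - conj (Z t))⁻¹ * (W t / Z t)) hnhds
    (by
      filter_upwards [hnhds] with s hs
      exact (A.continuous_pathTerm fun t => (hbound t s hs).1).aestronglyMeasurable)
    (A.integrable_pathTerm le_rfl)
    (by
      simp only [A.neg_conj_inv_mul]
      exact A.continuous_div_normSq.neg.aestronglyMeasurable)
    (Eventually.of_forall fun t s hs => (hbound t s hs).2) hg
    (Eventually.of_forall fun t s hs => hasDerivAt_pathTerm (hbound t s hs).1)).2
  simpa only [A.neg_conj_inv_mul, integral_neg] using h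

theorem scale (A : IsAdmissiblePath Z W) {m : ℝ} (hm : 0 < m) :
    IsAdmissiblePath (fun t => m * Z (t / m)) fun t => W (t / m) := by
  have hmc : (m : ℂ) ≠ 0 := Complex.ofReal_ne_zero.2 hm.ne'
  obtain ⟨ε, hε, g, hg, hbound⟩ := A.exists_dominated
  refine ⟨fun t => ?_, A.continuous_deriv.comp (continuous_id.div_const m), m * ε,
    mul_pos hm hε, fun t => (m ^ 2)⁻¹ * g (t / m), (hg.comp_div hm.ne').const_mul _,
    fun t s hs => ?_⟩
  · have h := ((A.hasDerivAt (t / m)).scomp t ((hasDerivAt_id t).div_const m)).const_mul (m : ℂ)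
    refine h.congr_deriv ?_
    rw [one_div, Complex.real_smul, Complex.ofReal_inv, mul_inv_cancel_left₀ hmc]
  · have hscale : (s : ℂ) - conj ((m : ℂ) * Z (t / m)) =
        m * (((s / m : ℝ) : ℂ) - conj (Z (t / m))) := by
      rw [map_mul, Complex.conj_ofReal, mul_sub, Complex.ofReal_div, mul_div_cancel₀ _ hmc]
    have hs' : -ε < s / m := by
      rw [lt_div_iff₀ hm]
      linarith
    obtain ⟨hslit, hle⟩ := hbound (t / m) (s / m) hs'
    rw [hscale]
    refine ⟨?_, ?_⟩
    · rw [Complex.mem_slitPlane_iff] at hslit ⊢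
      rw [Complex.re_ofReal_mul, Complex.im_ofReal_mul]
      exact hslit.imp (mul_pos hm) (mul_ne_zero hm.ne')
    · have hfactor (u v : ℂ) : (m * u)⁻¹ * (v / (m * Z (t / m))) =
          (((m ^ 2)⁻¹ : ℝ) : ℂ) * (u⁻¹ * (v / Z (t / m))) := by
        push_cast
        field_simp
      rw [hfactor, norm_mul, Complex.norm_of_nonneg (by positivity)]
      exact mul_le_mul_of_nonneg_left hle (by positivity)

end IsAdmissiblePath

theorem IsRegularSolution.exists_mul_rpow_le {q y y' : ℝ → ℝ} (S : IsRegularSolution q y y')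
    (h0 : y 0 = 0) (h1 : 0 < y' 0) {β : ℝ} (hβ : 0 ≤ β)
    (hq : ∀ t, 0 < t → q t * t ^ 2 ≤ β * (1 - β)) {r : ℝ} (hr : 0 < r) :
    ∃ c > 0, ∀ t, r ≤ t → c * (1 + t) ^ β ≤ y t := by
  have hyr := S.pos h0 h1 hβ hq hr
  refine ⟨y r * r ^ (-β) * (r / (1 + r)) ^ β, by positivity, fun t ht => ?_⟩
  have ht0 : 0 < t := hr.trans_le ht
  have hle : r / (1 + r) * (1 + t) ≤ t := by
    rw [div_mul_eq_mul_div, div_le_iff₀ (by positivity)]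
    linarith
  calc y r * r ^ (-β) * (r / (1 + r)) ^ β * (1 + t) ^ β
      = y r * r ^ (-β) * (r / (1 + r) * (1 + t)) ^ β := by
        rw [mul_assoc, Real.mul_rpow (by positivity) (by positivity)]
    _ ≤ y r * r ^ (-β) * t ^ β := by gcongr
    _ ≤ y t * t ^ (-β) * t ^ β := mul_le_mul_of_nonneg_right
        (S.monotoneOn_mul_rpow h0 h1 hβ hq (mem_Ioi.2 hr) (mem_Ioi.2 ht0) ht) (by positivity)
    _ = y t := by rw [mul_assoc, ← Real.rpow_add ht0, neg_add_cancel, Real.rpow_zero, mul_one]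

theorem exists_forall_abs_le_re_lt {Z : ℝ → ℂ} (hZ : ContinuousAt Z 0) (h0 : (Z 0).re < 0) :
    ∃ r > 0, ∀ t, |t| ≤ r → (Z t).re < (Z 0).re / 2 := by
  have hre : ContinuousAt (fun t => (Z t).re) 0 := Complex.continuous_re.continuousAt.comp hZ
  obtain ⟨δ, hδ, hball⟩ := Metric.eventually_nhds_iff.1
    (hre.eventually (gt_mem_nhds (show (Z 0).re < (Z 0).re / 2 by linarith)))
  refine ⟨δ / 2, by positivity, fun t ht => hball ?_⟩
  rw [Real.dist_eq, sub_zero]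
  linarith

section Construction

variable {Z W : ℝ → ℂ} {q : ℝ → ℝ} {β : ℝ}

/-- Near zero the real part of `Z` keeps `s - conj Z` away from the cut, and elsewhere its
imaginary part does. -/
theorem exists_slitPlane_and_mul_rpow_le (hZ : ContinuousAt Z 0)
    (S : IsRegularSolution q (fun t => (Z t).im) fun t => (W t).im) (hβ : 0 ≤ β)
    (hq : ∀ t, 0 < t → q t * t ^ 2 ≤ β * (1 - β)) (hodd : ∀ t, (Z (-t)).im = -(Z t).im)
    (h0 : (Z 0).re < 0) (h1 : 0 < (W 0).im) :
    ∃ ε > 0, ∃ c > 0, ∀ t s : ℝ, -ε < s →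
      (s : ℂ) - conj (Z t) ∈ Complex.slitPlane ∧
        c * (1 + |t|) ^ β ≤ ‖(s : ℂ) - conj (Z t)‖ := by
  have him0 : (Z 0).im = 0 := by
    have h := hodd 0
    rw [neg_zero] at h
    linarith
  have habs : ∀ t, |(Z t).im| = |(Z |t|).im| := fun t => by
    rcases abs_choice t with h | h
    · rw [h]
    · rw [h, hodd, abs_neg]
  obtain ⟨r, hr, hnear⟩ := exists_forall_abs_le_re_lt hZ h0
  obtain ⟨c, hc, hfar⟩ := S.exists_mul_rpow_le him0 h1 hβ hq hr
  have hr1 : 0 < (1 + r) ^ β := by positivity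
  refine ⟨-(Z 0).re / 4, by linarith, min c (-(Z 0).re / 4 / (1 + r) ^ β),
    lt_min hc (div_pos (by linarith) hr1), fun t s hs => ?_⟩
  rcases le_total |t| r with ht | ht
  · have hre : -(Z 0).re / 4 < ((s : ℂ) - conj (Z t)).re := by
      simp only [Complex.sub_re, Complex.ofReal_re, Complex.conj_re]
      linarith [hnear t ht]
    refine ⟨Or.inl (by linarith), ?_⟩
    calc min c (-(Z 0).re / 4 / (1 + r) ^ β) * (1 + |t|) ^ β
        ≤ -(Z 0).re / 4 / (1 + r) ^ β * (1 + r) ^ β := by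
          gcongr
          · exact div_nonneg (by linarith) hr1.le
          · exact min_le_right _ _
      _ = -(Z 0).re / 4 := div_mul_cancel₀ _ hr1.ne'
      _ ≤ ‖(s : ℂ) - conj (Z t)‖ := hre.le.trans (Complex.re_le_norm _)
  · have him : |((s : ℂ) - conj (Z t)).im| = |(Z |t|).im| := by simp [habs t]
    have hle : c * (1 + |t|) ^ β ≤ |((s : ℂ) - conj (Z t)).im| := by
      rw [him]
      exact (hfar _ ht).trans (le_abs_self _)
    refine ⟨Or.inr (abs_pos.1 (lt_of_lt_of_le (by positivity) hle)), ?_⟩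
    exact ((mul_le_mul_of_nonneg_right (min_le_left _ _) (by positivity)).trans hle).trans
      (Complex.abs_im_le_norm _)

theorem isAdmissiblePath_of_isRegularSolution {B : ℝ} (hd : ∀ t, HasDerivAt Z (W t) t)
    (hc : Continuous W) (hW : ∀ t, ‖W t‖ ≤ B * (1 + |t|) ^ (1 / 4 : ℝ))
    (S : IsRegularSolution q (fun t => (Z t).im) fun t => (W t).im)
    (hq : ∀ t, 0 < t → q t * t ^ 2 ≤ 7 / 8 * (1 - 7 / 8))
    (hodd : ∀ t, (Z (-t)).im = -(Z t).im) (h0 : (Z 0).re < 0) (h1 : 0 < (W 0).im) :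
    IsAdmissiblePath Z W := by
  obtain ⟨ε, hε, c, hc0, hlower⟩ := exists_slitPlane_and_mul_rpow_le (hd 0).continuousAt S
    (by norm_num) hq hodd h0 h1
  have hint : Integrable fun t : ℝ => B / c ^ 2 * (1 + |t|) ^ (-(3 / 2) : ℝ) := by
    simpa using (integrable_one_add_norm (E := ℝ) (μ := volume) (r := 3 / 2)
      (by norm_num)).const_mul (B / c ^ 2)
  refine ⟨hd, hc, ε, hε, _, hint, fun t s hs => ⟨(hlower t s hs).1, ?_⟩⟩
  have hZ : c * (1 + |t|) ^ (7 / 8 : ℝ) ≤ ‖Z t‖ := by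
    simpa using (hlower t 0 (by linarith)).2
  have ht : (0 : ℝ) < 1 + |t| := by positivity
  rw [norm_mul, norm_inv, norm_div]
  calc ‖(s : ℂ) - conj (Z t)‖⁻¹ * (‖W t‖ / ‖Z t‖)
      ≤ (c * (1 + |t|) ^ (7 / 8 : ℝ))⁻¹ *
        (B * (1 + |t|) ^ (1 / 4 : ℝ) / (c * (1 + |t|) ^ (7 / 8 : ℝ))) := by
        gcongr
        · exact (hlower t s hs).2
        · exact (norm_nonneg _).trans (hW t)
        · exact hW t
    _ = B / c ^ 2 * ((1 + |t|) ^ (1 / 4 : ℝ) /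
          ((1 + |t|) ^ (7 / 8 : ℝ) * (1 + |t|) ^ (7 / 8 : ℝ))) := by field_simp
    _ = B / c ^ 2 * (1 + |t|) ^ (-(3 / 2) : ℝ) := by
        rw [← Real.rpow_add ht, ← Real.rpow_sub ht]
        norm_num

end Construction

/-! ### The continuation along the critical line -/

/-- The point `-1/2 + i t` of the critical line at unit mass. -/
noncomputable def critPoint (t : ℝ) : ℂ := -1 / 2 + Complex.I * t

/-- The continuation along the critical line. -/
noncomputable def critPath (lam : ℝ) (ψ : ℝ → ℝ) (t : ℝ) : ℂ := continuation lam ψ (critPoint t)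

/-- The derivative of `critPath`. -/
noncomputable def critDeriv (lam : ℝ) (ψ : ℝ → ℝ) (t : ℝ) : ℂ :=
  Complex.I * continuationDeriv lam ψ (critPoint t)

theorem critPoint_mem_shiftedSlitPlane (t : ℝ) : critPoint t ∈ shiftedSlitPlane := by
  refine Or.inl ?_
  simp only [critPoint, Complex.add_re, Complex.one_re, Complex.mul_re, Complex.I_re, zero_mul,
    Complex.I_im, Complex.ofReal_im, mul_zero, sub_zero, add_zero]
  norm_num

theorem critPoint_neg (t : ℝ) : critPoint (-t) = conj (critPoint t) := by
  simp [critPoint, Complex.conj_ofNat]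

theorem critPoint_mul_add_one (t : ℝ) :
    critPoint t * (critPoint t + 1) = ((-(t ^ 2 + 1 / 4) : ℝ) : ℂ) := by
  rw [critPoint]
  push_cast
  linear_combination (t : ℂ) ^ 2 * Complex.I_sq

theorem hasDerivAt_critPoint (t : ℝ) : HasDerivAt critPoint Complex.I t := by
  refine ((Complex.ofRealCLM.hasDerivAt.const_mul Complex.I).const_add (-1 / 2)).congr_deriv ?_
  simp

theorem critPath_neg (lam : ℝ) (ψ : ℝ → ℝ) (t : ℝ) :
    critPath lam ψ (-t) = conj (critPath lam ψ t) := by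
  rw [critPath, critPoint_neg, ← conj_continuation, critPath]

theorem critDeriv_neg (lam : ℝ) (ψ : ℝ → ℝ) (t : ℝ) :
    critDeriv lam ψ (-t) = -conj (critDeriv lam ψ t) := by
  simp [critDeriv, critPoint_neg, continuationDeriv, conj_stieltjes, Complex.conj_ofNat]

namespace IsProfile

variable {κ lam : ℝ} {ψ ψ' : ℝ → ℝ}

theorem hasDerivAt_critPath (P : IsProfile κ ψ ψ') (lam t : ℝ) :
    HasDerivAt (critPath lam ψ) (critDeriv lam ψ t) t :=
  ((P.hasDerivAt_continuation lam (critPoint_mem_shiftedSlitPlane t)).comp t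
    (hasDerivAt_critPoint t)).congr_deriv (mul_comm _ _)

theorem hasDerivAt_critDeriv (P : IsProfile κ ψ ψ') (hm : 2 * lam * moment ψ 0 = κ) (t : ℝ) :
    HasDerivAt (critDeriv lam ψ) ((-linePotential κ t) • critPath lam ψ t) t := by
  refine (((P.hasDerivAt_continuationDeriv lam (critPoint_mem_shiftedSlitPlane t)).comp t
    (hasDerivAt_critPoint t)).const_mul Complex.I).congr_deriv ?_
  have hode := P.continuation_ode hm (critPoint_mem_shiftedSlitPlane t)
  rw [critPoint_mul_add_one] at hode
  have hne : t ^ 2 + 1 / 4 ≠ 0 := by positivity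
  have hcancel : -(t ^ 2 + 1 / 4) * -linePotential κ t = κ := by
    rw [linePotential]
    field_simp
  refine mul_left_cancel₀ (Complex.ofReal_ne_zero.2 (neg_ne_zero.2 hne)) ?_
  rw [Complex.real_smul, ← mul_assoc _ (Complex.ofReal _), ← Complex.ofReal_mul, hcancel, critPath]
  linear_combination Complex.I ^ 2 * hode - κ * continuation lam ψ (critPoint t) * Complex.I_sq

theorem continuous_critDeriv (P : IsProfile κ ψ ψ') (hm : 2 * lam * moment ψ 0 = κ) :
    Continuous (critDeriv lam ψ) :=
  continuous_iff_continuousAt.2 fun t => (P.hasDerivAt_critDeriv hm t).continuousAt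

theorem isRegularSolution_critPath (P : IsProfile κ ψ ψ') (hm : 2 * lam * moment ψ 0 = κ)
    (L : ℂ →L[ℝ] ℝ) : IsRegularSolution (linePotential κ) (fun t => L (critPath lam ψ t))
      (fun t => L (critDeriv lam ψ t)) where
  hasDerivAt t _ := L.hasFDerivAt.comp_hasDerivAt t (P.hasDerivAt_critPath lam t)
  hasDerivAt_deriv t _ := (L.hasFDerivAt.comp_hasDerivAt t
    (P.hasDerivAt_critDeriv hm t)).congr_deriv (L.map_smul _ _)
  continuousAt_deriv_zero := (L.continuous.comp (P.continuous_critDeriv hm)).continuousAt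

theorem isRegularSolution_re_critPath (P : IsProfile κ ψ ψ') (hm : 2 * lam * moment ψ 0 = κ) :
    IsRegularSolution (linePotential κ) (fun t => (critPath lam ψ t).re)
      fun t => (critDeriv lam ψ t).re :=
  P.isRegularSolution_critPath hm Complex.reCLM

theorem isRegularSolution_im_critPath (P : IsProfile κ ψ ψ') (hm : 2 * lam * moment ψ 0 = κ) :
    IsRegularSolution (linePotential κ) (fun t => (critPath lam ψ t).im)
      fun t => (critDeriv lam ψ t).im :=
  P.isRegularSolution_critPath hm Complex.imCLM

end IsProfile

/-! ### The centre of the critical line -/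

/-- The integral `∫₀^∞ ψ(t) (t + 1)^{-2} (t + 1/2)^{-n} dt`, which is the Stieltjes transform of the
continuation at the centre `-1/2` of the critical line. -/
noncomputable def halfMoment (ψ : ℝ → ℝ) (n : ℕ) : ℝ :=
  ∫ t in Ioi (0 : ℝ), ψ t • (((t + 1) ^ 2)⁻¹ * ((t + 1 / 2) ^ n)⁻¹)

theorem stieltjes_critPoint_zero (ψ : ℝ → ℝ) (n : ℕ) :
    stieltjes ψ 2 n (critPoint 0) = halfMoment ψ n := by
  rw [stieltjes, halfMoment, ← integral_complex_ofReal]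
  refine integral_congr_ae (Eventually.of_forall fun t => ?_)
  have hshift : critPoint 0 + ((t : ℂ) + 1) = t + 1 / 2 := by
    rw [critPoint, Complex.ofReal_zero]
    ring
  simp [stieltjesKernel, hshift]

/-- The distance from the origin to the centre of the critical path. -/
noncomputable def center (lam : ℝ) (ψ : ℝ → ℝ) : ℝ := 1 / 2 + lam / 4 * halfMoment ψ 1

/-- The speed of the critical path at its centre. -/
noncomputable def centerSpeed (lam : ℝ) (ψ : ℝ → ℝ) : ℝ :=
  1 + lam * (halfMoment ψ 1 + halfMoment ψ 2 / 4)

theorem critPath_zero (lam : ℝ) (ψ : ℝ → ℝ) :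
    critPath lam ψ 0 = ((-center lam ψ : ℝ) : ℂ) := by
  rw [critPath, continuation, stieltjes_critPoint_zero, critPoint, center]
  push_cast
  ring

theorem critDeriv_zero (lam : ℝ) (ψ : ℝ → ℝ) :
    critDeriv lam ψ 0 = Complex.I * ((centerSpeed lam ψ : ℝ) : ℂ) := by
  rw [critDeriv, continuationDeriv, stieltjes_critPoint_zero, stieltjes_critPoint_zero, critPoint,
    centerSpeed]
  push_cast
  ring

theorem halfKernel_le {n : ℕ} (hn : 1 ≤ n) {t : ℝ} (ht : 0 < t) :
    ((t + 1) ^ 2)⁻¹ * ((t + 1 / 2) ^ n)⁻¹ ≤ 2 ^ n * ((t + 1) ^ 3)⁻¹ :=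
  calc ((t + 1) ^ 2)⁻¹ * ((t + 1 / 2) ^ n)⁻¹
      ≤ ((t + 1) ^ 2)⁻¹ * (((t + 1) / 2) ^ n)⁻¹ := by
        gcongr
        linarith
    _ = 2 ^ n * ((t + 1) ^ (2 + n))⁻¹ := by
        rw [div_pow, pow_add]
        field_simp
    _ ≤ 2 ^ n * ((t + 1) ^ 3)⁻¹ := by
        gcongr ?_ * ?_
        exact inv_add_one_pow_anti ht (by omega)

theorem integral_smul_mono {ψ f g : ℝ → ℝ} (hψ : ∀ t, 0 < t → 0 < ψ t)
    (hf : IntegrableOn (fun t => ψ t • f t) (Ioi 0))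
    (hg : IntegrableOn (fun t => ψ t • g t) (Ioi 0)) (h : ∀ t, 0 < t → f t ≤ g t) :
    ∫ t in Ioi (0 : ℝ), ψ t • f t ≤ ∫ t in Ioi (0 : ℝ), ψ t • g t :=
  setIntegral_mono_on hf hg measurableSet_Ioi fun t ht =>
    mul_le_mul_of_nonneg_left (h t ht) (hψ t ht).le

namespace IsProfile

variable {κ lam : ℝ} {ψ ψ' : ℝ → ℝ} {n : ℕ}

theorem pos (P : IsProfile κ ψ ψ') (hκ : κ ≤ 1 / 4) (t : ℝ) (ht : 0 < t) : 0 < ψ t :=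
  hyp_solution_pos hκ P.sol P.zero (P.deriv_zero ▸ one_pos) ht

theorem integrableOn_halfMoment (P : IsProfile κ ψ ψ') (hn : 1 ≤ n) :
    IntegrableOn (fun t => ψ t • (((t + 1) ^ 2)⁻¹ * ((t + 1 / 2) ^ n)⁻¹)) (Ioi 0) := by
  refine P.integrableOn_smul_of_le_div_cube (B := 2 ^ n) ((continuousOn_inv_add_one_pow 2).mul
    (ContinuousOn.inv₀ (by fun_prop) fun t (ht : 0 < t) => by positivity)) fun t ht => ?_
  rw [Real.norm_of_nonneg (by positivity), div_eq_mul_inv]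
  exact halfKernel_le hn ht

theorem moment_pos (P : IsProfile κ ψ ψ') (hκ : κ ≤ 1 / 4) : 0 < moment ψ 0 := by
  have hpos : ∀ t ∈ Ioi (0 : ℝ), 0 < ψ t • ((t + 1) ^ (0 + 3))⁻¹ := fun t (ht : 0 < t) =>
    mul_pos (P.pos hκ t ht) (by positivity)
  rw [moment, setIntegral_pos_iff_support_of_nonneg_ae
    ((ae_restrict_mem measurableSet_Ioi).mono fun t ht => (hpos t ht).le) (P.integrableOn_moment 0)]
  refine lt_of_lt_of_le ?_ (measure_mono fun t ht => ⟨(hpos t ht).ne', ht⟩)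
  simp

theorem halfMoment_le (P : IsProfile κ ψ ψ') (hκ : κ ≤ 1 / 4) (hn : 1 ≤ n) :
    halfMoment ψ n ≤ 2 ^ n * moment ψ 0 := by
  have hint : IntegrableOn (fun t => ψ t • (2 ^ n * ((t + 1) ^ (0 + 3))⁻¹)) (Ioi 0) := by
    simp only [smul_eq_mul, mul_left_comm _ ((2 : ℝ) ^ n)]
    exact (P.integrableOn_moment 0).const_mul (2 ^ n)
  refine (integral_smul_mono (P.pos hκ) (P.integrableOn_halfMoment hn) hint
    fun t ht => halfKernel_le hn ht).trans_eq ?_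
  rw [moment, ← integral_const_mul]
  simp only [smul_eq_mul, mul_left_comm]

theorem halfMoment_nonneg (P : IsProfile κ ψ ψ') (hκ : κ ≤ 1 / 4) (n : ℕ) :
    0 ≤ halfMoment ψ n :=
  setIntegral_nonneg measurableSet_Ioi fun t (ht : 0 < t) =>
    mul_nonneg (P.pos hκ t ht).le (by positivity)

theorem moment_add_halfMoment_le (P : IsProfile κ ψ ψ') (hκ : κ ≤ 1 / 4) :
    moment ψ 0 + halfMoment ψ 1 ≤ 2 * ∫ t in Ioi (0 : ℝ), ψ t • (t * (t + 1) ^ 2)⁻¹ := by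
  have hM := P.integrableOn_moment 0
  have hH := P.integrableOn_halfMoment le_rfl
  rw [moment, halfMoment, ← integral_add hM hH, ← integral_const_mul]
  refine setIntegral_mono_on (hM.add hH) ((P.integrableOn_div_moment 0).const_mul 2)
    measurableSet_Ioi fun t (ht : 0 < t) => ?_
  have hgap : 0 ≤ ψ t * ((3 * t + 2) / (t * (t + 1) ^ 3 * (2 * t + 1))) :=
    mul_nonneg (P.pos hκ t ht).le (by positivity)
  have hsplit : 2 * (t * (t + 1) ^ 2)⁻¹ - (((t + 1) ^ 3)⁻¹ + ((t + 1) ^ 2)⁻¹ * (t + 1 / 2)⁻¹) =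
      (3 * t + 2) / (t * (t + 1) ^ 3 * (2 * t + 1)) := by
    field_simp
    ring
  simp only [smul_eq_mul, zero_add, pow_one]
  rw [← hsplit] at hgap
  linarith

/-- The sign of `κ` decides on which side of `1` the left-hand side lies, which is what excludes
Zimmermann's boundary condition. -/
theorem exists_four_mul_center_mul_moment_eq (P : IsProfile κ ψ ψ')
    (hm : 2 * lam * moment ψ 0 = κ) (hκ : κ ≤ 1 / 4) : ∃ δ, moment ψ 0 / 2 ≤ δ ∧
      4 * center lam ψ * moment ψ 0 = 1 - κ * δ := by
  refine ⟨(∫ t in Ioi (0 : ℝ), ψ t • (t * (t + 1) ^ 2)⁻¹) - halfMoment ψ 1 / 2,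
    by linarith [P.moment_add_halfMoment_le hκ], ?_⟩
  have hmoment := P.moment_eq 0
  simp only [CharP.cast_eq_zero, zero_add, one_mul] at hmoment
  rw [center]
  linear_combination hmoment + halfMoment ψ 1 / 2 * hm

end IsProfile

/-! ### The line integral compared with the straight path -/

theorem critPath_zero_re (lam : ℝ) (ψ : ℝ → ℝ) : (critPath lam ψ 0).re = -center lam ψ := by
  rw [critPath_zero, Complex.ofReal_re]

theorem critPath_zero_im (lam : ℝ) (ψ : ℝ → ℝ) : (critPath lam ψ 0).im = 0 := by
  rw [critPath_zero, Complex.ofReal_im]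

theorem critDeriv_zero_re (lam : ℝ) (ψ : ℝ → ℝ) : (critDeriv lam ψ 0).re = 0 := by
  simp [critDeriv_zero]

theorem critDeriv_zero_im (lam : ℝ) (ψ : ℝ → ℝ) :
    (critDeriv lam ψ 0).im = centerSpeed lam ψ := by
  simp [critDeriv_zero]

theorem norm_critDeriv_abs (lam : ℝ) (ψ : ℝ → ℝ) (t : ℝ) :
    ‖critDeriv lam ψ |t|‖ = ‖critDeriv lam ψ t‖ := by
  rcases abs_choice t with h | h
  · rw [h]
  · rw [h, critDeriv_neg, norm_neg, RCLike.norm_conj]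

theorem normSq_eq_re_sq_add_im_sq (z : ℂ) : Complex.normSq z = z.re ^ 2 + z.im ^ 2 := by
  rw [Complex.normSq_apply, sq, sq]

theorem hasDerivAt_arctan_div_div {y : ℝ → ℝ} {y' t x : ℝ} (hx : 0 < x) (hy : HasDerivAt y y' t) :
    HasDerivAt (fun t => Real.arctan (y t / x) / x) (y' / (x ^ 2 + y t ^ 2)) t := by
  refine ((hy.div_const x).arctan.div_const x).congr_deriv ?_
  have : 0 < x ^ 2 + y t ^ 2 := by positivity
  have : 0 < 1 + (y t / x) ^ 2 := by positivity
  field_simp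

namespace IsRegularSolution

variable {q y y' : ℝ → ℝ} {β t x : ℝ}

theorem deriv_nonneg (S : IsRegularSolution q y y') (h0 : y 0 = 0) (h1 : 0 < y' 0) (hβ : 0 ≤ β)
    (hq : ∀ t, 0 < t → q t * t ^ 2 ≤ β * (1 - β)) (ht : 0 < t) : 0 ≤ y' t :=
  (div_nonneg (mul_nonneg hβ (S.pos h0 h1 hβ hq ht).le) ht.le).trans (S.mul_div_le h0 h1 hβ hq ht)

theorem mul_rpow_le (S : IsRegularSolution q y y') (h0 : y 0 = 0) (h1 : 0 < y' 0) (hβ : 0 ≤ β)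
    (hq : ∀ t, 0 < t → q t * t ^ 2 ≤ β * (1 - β)) (ht : 1 ≤ t) : y 1 * t ^ β ≤ y t := by
  have ht0 : 0 < t := by linarith
  have hmono := S.monotoneOn_mul_rpow h0 h1 hβ hq (mem_Ioi.2 one_pos) (mem_Ioi.2 ht0) ht
  simp only [Real.one_rpow, mul_one] at hmono
  rwa [Real.rpow_neg ht0.le, ← div_eq_mul_inv, le_div_iff₀ (by positivity)] at hmono

theorem tendsto_atTop (S : IsRegularSolution q y y') (h0 : y 0 = 0) (h1 : 0 < y' 0) (hβ : 0 < β)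
    (hq : ∀ t, 0 < t → q t * t ^ 2 ≤ β * (1 - β)) : Tendsto y atTop atTop :=
  tendsto_atTop_mono' atTop (eventually_atTop.2 ⟨1, fun _ ht => S.mul_rpow_le h0 h1 hβ.le hq ht⟩)
    ((tendsto_rpow_atTop hβ).const_mul_atTop (S.pos h0 h1 hβ.le hq one_pos))

theorem tendsto_arctan_div_div (S : IsRegularSolution q y y') (h0 : y 0 = 0) (h1 : 0 < y' 0)
    (hβ : 0 < β) (hq : ∀ t, 0 < t → q t * t ^ 2 ≤ β * (1 - β)) (hx : 0 < x) :
    Tendsto (fun t => Real.arctan (y t / x) / x) atTop (𝓝 (Real.pi / 2 / x)) :=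
  ((Real.tendsto_arctan_atTop.mono_right nhdsWithin_le_nhds).comp
    ((S.tendsto_atTop h0 h1 hβ hq).atTop_div_const hx)).div_const x

theorem integrableOn_deriv_div (S : IsRegularSolution q y y') (h0 : y 0 = 0) (h1 : 0 < y' 0)
    (hβ : 0 < β) (hq : ∀ t, 0 < t → q t * t ^ 2 ≤ β * (1 - β)) (hx : 0 < x) :
    IntegrableOn (fun t => y' t / (x ^ 2 + y t ^ 2)) (Ioi 0) :=
  integrableOn_Ioi_deriv_of_nonneg'
    (fun t ht => hasDerivAt_arctan_div_div hx (S.hasDerivAt t ht))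
    (fun _ ht => div_nonneg (S.deriv_nonneg h0 h1 hβ.le hq ht) (by positivity))
    (S.tendsto_arctan_div_div h0 h1 hβ hq hx)

theorem integral_deriv_div (S : IsRegularSolution q y y') (h0 : y 0 = 0) (h1 : 0 < y' 0)
    (hβ : 0 < β) (hq : ∀ t, 0 < t → q t * t ^ 2 ≤ β * (1 - β)) (hx : 0 < x) :
    ∫ t in Ioi (0 : ℝ), y' t / (x ^ 2 + y t ^ 2) = Real.pi / (2 * x) := by
  rw [integral_Ioi_of_hasDerivAt_of_tendsto'
    (fun t ht => hasDerivAt_arctan_div_div hx (S.hasDerivAt t ht))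
    (S.integrableOn_deriv_div h0 h1 hβ hq hx) (S.tendsto_arctan_div_div h0 h1 hβ hq hx),
    h0, zero_div, Real.arctan_zero, zero_div, sub_zero, div_div]

end IsRegularSolution

theorem IsAdmissiblePath.integrable_im_div_normSq {Z W : ℝ → ℂ} (A : IsAdmissiblePath Z W) :
    Integrable fun t => (W t).im / Complex.normSq (Z t) :=
  A.integrable_div_normSq.im.congr (Eventually.of_forall fun _ => Complex.div_ofReal_im _ _)

/-- Half of the integral along the critical line that gives the derivative at `0` of the exponent
of the two-point function at unit mass. -/
noncomputable def lineIntegral (lam : ℝ) (ψ : ℝ → ℝ) : ℝ :=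
  ∫ t in Ioi (0 : ℝ), (critDeriv lam ψ t).im / Complex.normSq (critPath lam ψ t)

theorem linePotential_mul_sq_le_seven_eighths {κ : ℝ} (hκ : |κ| ≤ 1 / 32) (t : ℝ) :
    linePotential κ t * t ^ 2 ≤ 7 / 8 * (1 - 7 / 8) :=
  linePotential_mul_sq_le (by norm_num) (by linarith [le_abs_self κ]) t

namespace IsProfile

variable {κ lam t : ℝ} {ψ ψ' : ℝ → ℝ} {n : ℕ}

theorem abs_mul_halfMoment_le (P : IsProfile κ ψ ψ') (hm : 2 * lam * moment ψ 0 = κ)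
    (hκ : κ ≤ 1 / 4) (hn : 1 ≤ n) : |lam * halfMoment ψ n| ≤ 2 ^ n * (|κ| / 2) :=
  calc |lam * halfMoment ψ n| = |lam| * halfMoment ψ n := by
        rw [abs_mul, abs_of_nonneg (P.halfMoment_nonneg hκ n)]
    _ ≤ |lam| * (2 ^ n * moment ψ 0) := by gcongr; exact P.halfMoment_le hκ hn
    _ = 2 ^ n * (|κ| / 2) := by
        rw [← hm, abs_mul, abs_mul, abs_of_pos (P.moment_pos hκ), abs_two]
        ring

theorem abs_center_sub_le (P : IsProfile κ ψ ψ') (hm : 2 * lam * moment ψ 0 = κ)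
    (hκ : |κ| ≤ 1 / 32) : |center lam ψ - 1 / 2| ≤ 1 / 4 := by
  have h := P.abs_mul_halfMoment_le hm (by linarith [le_abs_self κ]) le_rfl
  rw [center, abs_le]
  constructor <;> linarith [abs_le.1 h]

theorem abs_centerSpeed_sub_le (P : IsProfile κ ψ ψ') (hm : 2 * lam * moment ψ 0 = κ)
    (hκ : |κ| ≤ 1 / 32) : |centerSpeed lam ψ - 1| ≤ 1 / 2 := by
  have hκ' : κ ≤ 1 / 4 := by linarith [le_abs_self κ]
  have h1 := P.abs_mul_halfMoment_le hm hκ' le_rfl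
  have h2 := P.abs_mul_halfMoment_le hm hκ' one_le_two
  rw [centerSpeed, abs_le]
  constructor <;> linarith [abs_le.1 h1, abs_le.1 h2]

theorem center_pos (P : IsProfile κ ψ ψ') (hm : 2 * lam * moment ψ 0 = κ) (hκ : |κ| ≤ 1 / 32) :
    0 < center lam ψ := by
  linarith [abs_le.1 (P.abs_center_sub_le hm hκ)]

theorem critDeriv_zero_im_pos (P : IsProfile κ ψ ψ') (hm : 2 * lam * moment ψ 0 = κ)
    (hκ : |κ| ≤ 1 / 32) : 0 < (critDeriv lam ψ 0).im := by
  rw [critDeriv_zero_im]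
  linarith [abs_le.1 (P.abs_centerSpeed_sub_le hm hκ)]

theorem one_le_centerSpeed (P : IsProfile κ ψ ψ') (hκ : κ ≤ 1 / 4) (hlam : 0 ≤ lam) :
    1 ≤ centerSpeed lam ψ := by
  have h1 := P.halfMoment_nonneg hκ 1
  have h2 := P.halfMoment_nonneg hκ 2
  rw [centerSpeed]
  exact le_add_of_nonneg_right (by positivity)

theorem critDeriv_im_nonneg (P : IsProfile κ ψ ψ') (hm : 2 * lam * moment ψ 0 = κ)
    (hκ : |κ| ≤ 1 / 32) (ht : 0 < t) : 0 ≤ (critDeriv lam ψ t).im :=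
  (P.isRegularSolution_im_critPath hm).deriv_nonneg (critPath_zero_im lam ψ)
    (P.critDeriv_zero_im_pos hm hκ) (by norm_num)
    (fun t _ => linePotential_mul_sq_le_seven_eighths hκ t) ht

theorem exists_norm_critDeriv_le (P : IsProfile κ ψ ψ') (hm : 2 * lam * moment ψ 0 = κ)
    (hκ : |κ| ≤ 1 / 32) : ∃ B, ∀ t, ‖critDeriv lam ψ t‖ ≤ B * (1 + |t|) ^ (1 / 4 : ℝ) := by
  obtain ⟨B₁, h1⟩ := (P.isRegularSolution_re_critPath hm).exists_abs_deriv_le hκ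
  obtain ⟨B₂, h2⟩ := (P.isRegularSolution_im_critPath hm).exists_abs_deriv_le hκ
  refine ⟨B₁ + B₂, fun t => ?_⟩
  rw [← norm_critDeriv_abs, add_mul]
  exact (Complex.norm_le_abs_re_add_abs_im _).trans
    (add_le_add (h1 _ (abs_nonneg t)) (h2 _ (abs_nonneg t)))

theorem isAdmissiblePath (P : IsProfile κ ψ ψ') (hm : 2 * lam * moment ψ 0 = κ)
    (hκ : |κ| ≤ 1 / 32) : IsAdmissiblePath (critPath lam ψ) (critDeriv lam ψ) := by
  obtain ⟨B, hB⟩ := P.exists_norm_critDeriv_le hm hκ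
  refine isAdmissiblePath_of_isRegularSolution (P.hasDerivAt_critPath lam)
    (P.continuous_critDeriv hm) hB (P.isRegularSolution_im_critPath hm)
    (fun t _ => linePotential_mul_sq_le_seven_eighths hκ t) (fun t => ?_) ?_
    (P.critDeriv_zero_im_pos hm hκ)
  · rw [critPath_neg, Complex.conj_im]
  · rw [critPath_zero_re]
    linarith [P.center_pos hm hκ]

theorem integrableOn_line (P : IsProfile κ ψ ψ') (hm : 2 * lam * moment ψ 0 = κ)
    (hκ : |κ| ≤ 1 / 32) : IntegrableOn (fun t => (critDeriv lam ψ t).im /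
      Complex.normSq (critPath lam ψ t)) (Ioi 0) :=
  (P.isAdmissiblePath hm hκ).integrable_im_div_normSq.integrableOn

theorem integrableOn_straight (P : IsProfile κ ψ ψ') (hm : 2 * lam * moment ψ 0 = κ)
    (hκ : |κ| ≤ 1 / 32) : IntegrableOn (fun t => (critDeriv lam ψ t).im /
      (center lam ψ ^ 2 + (critPath lam ψ t).im ^ 2)) (Ioi 0) :=
  (P.isRegularSolution_im_critPath hm).integrableOn_deriv_div (critPath_zero_im lam ψ)
    (P.critDeriv_zero_im_pos hm hκ) (by norm_num)
    (fun t _ => linePotential_mul_sq_le_seven_eighths hκ t)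
    (P.center_pos hm hκ)

theorem integral_straight (P : IsProfile κ ψ ψ') (hm : 2 * lam * moment ψ 0 = κ)
    (hκ : |κ| ≤ 1 / 32) : ∫ t in Ioi (0 : ℝ), (critDeriv lam ψ t).im /
      (center lam ψ ^ 2 + (critPath lam ψ t).im ^ 2) = Real.pi / (2 * center lam ψ) :=
  (P.isRegularSolution_im_critPath hm).integral_deriv_div (critPath_zero_im lam ψ)
    (P.critDeriv_zero_im_pos hm hκ) (by norm_num)
    (fun t _ => linePotential_mul_sq_le_seven_eighths hκ t)
    (P.center_pos hm hκ)

theorem lineIntegral_lt (P : IsProfile κ ψ ψ') (hm : 2 * lam * moment ψ 0 = κ)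
    (hκ : |κ| ≤ 1 / 32) (hneg : κ < 0) : lineIntegral lam ψ < Real.pi * (2 * moment ψ 0) := by
  have hc := P.center_pos hm hκ
  have hκ' : κ ≤ 1 / 4 := by linarith
  have hle : lineIntegral lam ψ ≤ Real.pi / (2 * center lam ψ) := by
    rw [← P.integral_straight hm hκ]
    refine setIntegral_mono_on (P.integrableOn_line hm hκ) (P.integrableOn_straight hm hκ)
      measurableSet_Ioi fun t ht => ?_
    have hW := P.critDeriv_im_nonneg hm hκ ht
    have hX := (P.isRegularSolution_re_critPath hm).sq_zero_le_sq hneg.le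
      (critDeriv_zero_re lam ψ) ht
    rw [critPath_zero_re, neg_sq] at hX
    rw [normSq_eq_re_sq_add_im_sq]
    gcongr
  obtain ⟨δ, hδ, hcenter⟩ := P.exists_four_mul_center_mul_moment_eq hm hκ'
  have hκδ : κ * δ < 0 := mul_neg_of_neg_of_pos hneg (by linarith [P.moment_pos hκ'])
  refine hle.trans_lt ((div_lt_iff₀ (by positivity)).2 ?_)
  calc Real.pi < Real.pi * (1 - κ * δ) := lt_mul_of_one_lt_right Real.pi_pos (by linarith)
    _ = Real.pi * (2 * moment ψ 0) * (2 * center lam ψ) := by rw [← hcenter]; ring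

end IsProfile

theorem div_sub_div_le_mul_rpow {κ t x X Y W : ℝ} (hκ : 0 ≤ κ) (ht : 0 < t) (hW : 0 ≤ W)
    (hW2 : W ≤ 2) (hY : 1 / 2 * t ^ (7 / 8 : ℝ) ≤ Y) (hX : X ^ 2 - x ^ 2 ≤ 12 * κ * t ^ 2) :
    W / (x ^ 2 + Y ^ 2) - W / (X ^ 2 + Y ^ 2) ≤ 384 * κ * t ^ (-(3 / 2) : ℝ) := by
  have hYpos : 0 < Y := lt_of_lt_of_le (by positivity) hY
  have hsplit : W / (x ^ 2 + Y ^ 2) - W / (X ^ 2 + Y ^ 2) =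
      W * (X ^ 2 - x ^ 2) / ((x ^ 2 + Y ^ 2) * (X ^ 2 + Y ^ 2)) := by
    field_simp
    ring
  have hY4 : 1 / 16 * t ^ (7 / 2 : ℝ) ≤ (x ^ 2 + Y ^ 2) * (X ^ 2 + Y ^ 2) :=
    calc 1 / 16 * t ^ (7 / 2 : ℝ) = (1 / 2 * t ^ (7 / 8 : ℝ)) ^ 4 := by
          rw [mul_pow, ← Real.rpow_mul_natCast ht.le]
          norm_num
      _ ≤ Y ^ 4 := by gcongr
      _ = Y ^ 2 * Y ^ 2 := by ring
      _ ≤ (x ^ 2 + Y ^ 2) * (X ^ 2 + Y ^ 2) :=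
          mul_le_mul (le_add_of_nonneg_left (sq_nonneg x)) (le_add_of_nonneg_left (sq_nonneg X))
            (by positivity) (by positivity)
  have hpow : t ^ (-(3 / 2) : ℝ) * t ^ (7 / 2 : ℝ) = t ^ 2 := by
    rw [← Real.rpow_add ht, ← Real.rpow_natCast t 2]
    norm_num
  rw [hsplit, div_le_iff₀ (by positivity)]
  calc W * (X ^ 2 - x ^ 2) ≤ W * (12 * κ * t ^ 2) := by gcongr
    _ ≤ 2 * (12 * κ * t ^ 2) := by gcongr
    _ = 384 * κ * t ^ (-(3 / 2) : ℝ) * (1 / 16 * t ^ (7 / 2 : ℝ)) := by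
        rw [← hpow]
        ring
    _ ≤ 384 * κ * t ^ (-(3 / 2) : ℝ) * ((x ^ 2 + Y ^ 2) * (X ^ 2 + Y ^ 2)) := by gcongr

theorem integral_Ioi_rpow_neg_three_halves :
    ∫ t in Ioi (10 ^ 8 : ℝ), t ^ (-(3 / 2) : ℝ) = 2 / 10 ^ 4 := by
  have hpow : (10 ^ 8 : ℝ) ^ (-(3 / 2) + 1 : ℝ) = 1 / 10 ^ 4 := by
    rw [← Real.rpow_natCast_mul (by norm_num),
      show ((8 : ℕ) : ℝ) * (-(3 / 2) + 1) = -((4 : ℕ) : ℝ) by norm_num,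
      Real.rpow_neg (by norm_num), Real.rpow_natCast, one_div]
  rw [integral_Ioi_rpow_of_lt (by norm_num) (by norm_num), hpow]
  norm_num

namespace IsProfile

variable {κ lam t : ℝ} {ψ ψ' : ℝ → ℝ}

theorem half_mul_rpow_le_critPath_im (P : IsProfile κ ψ ψ') (hm : 2 * lam * moment ψ 0 = κ)
    (hlam : 0 ≤ lam) (hκ0 : 0 ≤ κ) (hκ : κ ≤ 1 / 32) (ht : 1 ≤ t) :
    1 / 2 * t ^ (7 / 8 : ℝ) ≤ (critPath lam ψ t).im := by
  have hκ' : |κ| ≤ 1 / 32 := by rwa [abs_of_nonneg hκ0]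
  have S := P.isRegularSolution_im_critPath hm
  have hv := P.critDeriv_zero_im_pos hm hκ'
  have hone := S.half_deriv_zero_le hκ0 (by linarith) (critPath_zero_im lam ψ) hv.le
  rw [critDeriv_zero_im] at hone
  have hspeed := P.one_le_centerSpeed (by linarith) hlam
  refine le_trans ?_ (S.mul_rpow_le (critPath_zero_im lam ψ) hv (by norm_num)
    (fun t _ => linePotential_mul_sq_le_seven_eighths hκ' t) ht)
  gcongr
  linarith

theorem straight_sub_line_le_mul_rpow (P : IsProfile κ ψ ψ') (hm : 2 * lam * moment ψ 0 = κ)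
    (hlam : 0 ≤ lam) (hκ0 : 0 ≤ κ) (hκ : κ ≤ 1 / 32) (ht : 1 ≤ t) :
    (critDeriv lam ψ t).im / (center lam ψ ^ 2 + (critPath lam ψ t).im ^ 2) -
      (critDeriv lam ψ t).im / Complex.normSq (critPath lam ψ t) ≤
      384 * κ * t ^ (-(3 / 2) : ℝ) := by
  have hκ' : |κ| ≤ 1 / 32 := by rwa [abs_of_nonneg hκ0]
  have ht0 : 0 < t := by linarith
  have hW := (P.isRegularSolution_im_critPath hm).abs_deriv_le_deriv_zero hκ0
    (critPath_zero_im lam ψ) (P.critDeriv_zero_im_pos hm hκ').le ht0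
  have hX := (P.isRegularSolution_re_critPath hm).sq_sub_sq_le hκ0 (critDeriv_zero_re lam ψ) ht0.le
  have hcenter := P.center_pos hm hκ'
  have hcenter' : center lam ψ ≤ 1 := by linarith [abs_le.1 (P.abs_center_sub_le hm hκ')]
  have hspeed := abs_le.1 (P.abs_centerSpeed_sub_le hm hκ')
  rw [critDeriv_zero_im] at hW
  rw [critPath_zero_re, neg_sq] at hX
  rw [normSq_eq_re_sq_add_im_sq]
  refine div_sub_div_le_mul_rpow hκ0 ht0 (P.critDeriv_im_nonneg hm hκ' ht0)
    (by linarith [le_abs_self (critDeriv lam ψ t).im])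
    (P.half_mul_rpow_le_critPath_im hm hlam hκ0 hκ ht) (hX.trans ?_)
  calc 12 * κ * center lam ψ ^ 2 * t ^ 2 ≤ 12 * κ * 1 * t ^ 2 := by
        gcongr
        exact pow_le_one₀ hcenter.le hcenter'
    _ = 12 * κ * t ^ 2 := by rw [mul_one]

theorem straight_le_line (P : IsProfile κ ψ ψ') (hm : 2 * lam * moment ψ 0 = κ)
    (hκ0 : 0 ≤ κ) (hκ : κ ≤ 1 / 32) (ht : 0 < t) (hκt : 2 * √κ * t ≤ 1) :
    (critDeriv lam ψ t).im / (center lam ψ ^ 2 + (critPath lam ψ t).im ^ 2) ≤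
      (critDeriv lam ψ t).im / Complex.normSq (critPath lam ψ t) := by
  have hκ' : |κ| ≤ 1 / 32 := by rwa [abs_of_nonneg hκ0]
  have hW := P.critDeriv_im_nonneg hm hκ' ht
  have hY := (P.isRegularSolution_im_critPath hm).pos (critPath_zero_im lam ψ)
    (P.critDeriv_zero_im_pos hm hκ') (by norm_num)
    (fun t _ => linePotential_mul_sq_le_seven_eighths hκ' t) ht
  have hX := (P.isRegularSolution_re_critPath hm).sq_le_sq_zero hκ0 (critDeriv_zero_re lam ψ)
    ht.le hκt
  rw [critPath_zero_re, neg_sq] at hX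
  rw [normSq_eq_re_sq_add_im_sq]
  gcongr

theorem pi_div_two_mul_center_le (P : IsProfile κ ψ ψ') (hm : 2 * lam * moment ψ 0 = κ)
    (hlam : 0 ≤ lam) (hκ0 : 0 ≤ κ) (hκ : κ ≤ 1 / 10 ^ 17) :
    Real.pi / (2 * center lam ψ) ≤ lineIntegral lam ψ + 768 / 10 ^ 4 * κ := by
  have hκ1 : κ ≤ 1 / 32 := by linarith
  have hκ' : |κ| ≤ 1 / 32 := by rwa [abs_of_nonneg hκ0]
  have hsqrt : √κ ≤ 1 / (2 * 10 ^ 8) :=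
    (Real.sqrt_le_left (by norm_num)).2 (hκ.trans (by norm_num))
  have htail : IntegrableOn ((Ioi (10 ^ 8)).indicator fun t : ℝ => 384 * κ * t ^ (-(3 / 2) : ℝ))
      (Ioi 0) := by
    refine ((integrable_indicator_iff measurableSet_Ioi).2 ?_).integrableOn
    exact (integrableOn_Ioi_rpow_of_lt (by norm_num) (by norm_num)).const_mul _
  have htail_eq : ∫ t in Ioi 0, (Ioi (10 ^ 8)).indicator
      (fun t : ℝ => 384 * κ * t ^ (-(3 / 2) : ℝ)) t = 768 / 10 ^ 4 * κ := by
    rw [setIntegral_indicator measurableSet_Ioi, inter_eq_right.2 (Ioi_subset_Ioi (by norm_num)),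
      integral_const_mul, integral_Ioi_rpow_neg_three_halves]
    ring
  rw [← P.integral_straight hm hκ', ← htail_eq, lineIntegral,
    ← integral_add (P.integrableOn_line hm hκ') htail]
  refine setIntegral_mono_on (P.integrableOn_straight hm hκ')
    ((P.integrableOn_line hm hκ').add htail) measurableSet_Ioi fun t (ht : 0 < t) => ?_
  by_cases hlarge : t ∈ Ioi (10 ^ 8 : ℝ)
  · rw [indicator_of_mem hlarge]
    have h1 : (1 : ℝ) ≤ t := by linarith [mem_Ioi.1 hlarge]
    linarith [P.straight_sub_line_le_mul_rpow hm hlam hκ0 hκ1 h1]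
  · rw [indicator_of_notMem hlarge, add_zero]
    refine P.straight_le_line hm hκ0 hκ1 ht ?_
    calc 2 * √κ * t ≤ 2 * (1 / (2 * 10 ^ 8)) * 10 ^ 8 := by
          gcongr
          exact not_lt.1 hlarge
      _ = 1 := by norm_num

theorem lt_lineIntegral (P : IsProfile κ ψ ψ') (hm : 2 * lam * moment ψ 0 = κ) (hlam : 0 ≤ lam)
    (hκ0 : 0 < κ) (hκ : κ ≤ 1 / 10 ^ 17) (hmom : 1 / 4 ≤ moment ψ 0) :
    Real.pi * (2 * moment ψ 0) < lineIntegral lam ψ := by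
  have hκ' : |κ| ≤ 1 / 32 := by rw [abs_of_pos hκ0]; linarith
  have hc := P.center_pos hm hκ'
  have hc1 : center lam ψ ≤ 1 := by linarith [abs_le.1 (P.abs_center_sub_le hm hκ')]
  obtain ⟨δ, hδ, hcenter⟩ := P.exists_four_mul_center_mul_moment_eq hm (by linarith)
  have hsplit : Real.pi / (2 * center lam ψ) =
      Real.pi * (2 * moment ψ 0) + Real.pi * κ * δ / (2 * center lam ψ) := by
    field_simp
    linear_combination -hcenter
  have hgain : 3 * κ * (1 / 8) / (2 * 1) ≤ Real.pi * κ * δ / (2 * center lam ψ) := by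
    have hpi := Real.pi_gt_three
    have hδ' : 1 / 8 ≤ δ := by linarith
    gcongr
  linarith [P.pi_div_two_mul_center_le hm hlam hκ0.le hκ]

end IsProfile

/-! ### The two-point function near the boundary -/

theorem integral_eq_two_mul_of_even {f : ℝ → ℝ} (hf : ∀ t, f (-t) = f t) :
    ∫ t, f t = 2 * ∫ t in Ioi (0 : ℝ), f t := by
  rw [← integral_comp_abs]
  congr 1
  funext t
  rcases abs_choice t with h | h <;> rw [h]
  rw [hf]

theorem linePoint_re (μ t : ℝ) : (linePoint μ t).re = -(μ ^ 2 / 2) := by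
  simp [linePoint, ← Complex.ofReal_pow, neg_div]

theorem linePoint_im (μ t : ℝ) : (linePoint μ t).im = t := by
  simp [linePoint, ← Complex.ofReal_pow]

theorem linePoint_neg (μ t : ℝ) : linePoint μ (-t) = conj (linePoint μ t) := by
  apply Complex.ext <;> simp only [linePoint_re, linePoint_im, Complex.conj_re, Complex.conj_im]

theorem linePoint_eq_mul_critPoint {μ : ℝ} (hμ : 0 < μ) (t : ℝ) :
    linePoint μ t = (μ : ℂ) ^ 2 * critPoint (t / μ ^ 2) := by
  have hμc : (μ : ℂ) ≠ 0 := Complex.ofReal_ne_zero.2 hμ.ne'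
  rw [linePoint, critPoint]
  push_cast
  field_simp

theorem hasDerivAt_linePoint (μ t : ℝ) : HasDerivAt (linePoint μ) Complex.I t := by
  refine ((Complex.ofRealCLM.hasDerivAt.const_mul Complex.I).const_add _).congr_deriv ?_
  simp

theorem isRegularSolution_id : IsRegularSolution (fun _ => 0) (fun t => t) fun _ => 1 where
  hasDerivAt t _ := hasDerivAt_id t
  hasDerivAt_deriv t _ := (hasDerivAt_const t (1 : ℝ)).congr_deriv (by simp)
  continuousAt_deriv_zero := continuousAt_const

theorem isAdmissiblePath_linePoint {μ : ℝ} (hμ : 0 < μ) :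
    IsAdmissiblePath (linePoint μ) fun _ => Complex.I := by
  refine isAdmissiblePath_of_isRegularSolution (q := fun _ => 0) (B := 1)
    (hasDerivAt_linePoint μ) continuous_const (fun t => ?_) ?_ (fun t _ => by norm_num)
    (fun t => ?_) ?_ (Complex.I_im ▸ one_pos)
  · rw [Complex.norm_I, one_mul]
    exact Real.one_le_rpow (le_add_of_nonneg_right (abs_nonneg t)) (by norm_num)
  · simpa only [linePoint_im, Complex.I_im] using isRegularSolution_id
  · rw [linePoint_im, linePoint_im]
  · rw [linePoint_re]
    exact neg_lt_zero.2 (by positivity)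

theorem integral_linePoint {μ : ℝ} (hμ : 0 < μ) :
    ∫ t, Complex.I.im / Complex.normSq (linePoint μ t) = 2 * Real.pi / μ ^ 2 := by
  simp only [normSq_eq_re_sq_add_im_sq, linePoint_re, linePoint_im, Complex.I_im, neg_sq]
  rw [integral_eq_two_mul_of_even fun t => by rw [neg_sq],
    isRegularSolution_id.integral_deriv_div rfl one_pos one_pos (fun t _ => by simp)
      (by positivity : 0 < μ ^ 2 / 2)]
  field_simp

namespace IsAdmissiblePath

variable {Z W : ℝ → ℂ} {lam μ : ℝ} {ρ : ℝ → ℝ}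

theorem im_integral_div_normSq (A : IsAdmissiblePath Z W) :
    (∫ t, W t / Complex.normSq (Z t)).im = ∫ t, (W t).im / Complex.normSq (Z t) := by
  rw [← Complex.imCLM_apply, ← Complex.imCLM.integral_comp_comm A.integrable_div_normSq]
  exact integral_congr_ae (Eventually.of_forall fun _ => Complex.div_ofReal_im _ _)

theorem logTerm_eq (A : IsAdmissiblePath Z W) (hconj : ∀ t, Z (-t) = conj (Z t)) {f : ℂ → ℂ}
    (hf : ∀ t, f (linePoint μ t) = Z t) (a t : ℝ) :
    logTerm μ f a 0 t = Complex.log (a - conj (Z t)) * (W t / Z t) := by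
  have hlog : HasDerivAt (fun s : ℝ => Complex.log ((0 : ℝ) - f (linePoint μ s)))
      (W t / Z t) t := by
    simp only [hf, Complex.ofReal_zero, zero_sub]
    exact ((A.hasDerivAt t).fun_neg.clog_real (A.neg_mem_slitPlane t)).congr_deriv
      (neg_div_neg_eq _ _)
  rw [logTerm, hlog.deriv, hf, hconj]

theorem exponentIntegrand_eq (A : IsAdmissiblePath Z W) (hconj : ∀ t, Z (-t) = conj (Z t))
    (hμ : 0 < μ) (hZ : ∀ t, R4 lam μ ρ (linePoint μ t) = Z t) (a : ℝ) :
    exponentIntegrand lam μ ρ a 0 =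
      fun t => pathTerm Z W a t - pathTerm (linePoint μ) (fun _ => Complex.I) a t := by
  have A₀ := isAdmissiblePath_linePoint hμ
  funext t
  rw [exponentIntegrand, A.logTerm_eq hconj hZ, A.logTerm_eq hconj hZ,
    A₀.logTerm_eq (f := id) (linePoint_neg μ) (fun _ => rfl),
    A₀.logTerm_eq (f := id) (linePoint_neg μ) (fun _ => rfl), pathTerm, pathTerm]
  ring

theorem integrable_exponentIntegrand (A : IsAdmissiblePath Z W)
    (hconj : ∀ t, Z (-t) = conj (Z t)) (hμ : 0 < μ)
    (hZ : ∀ t, R4 lam μ ρ (linePoint μ t) = Z t) {a : ℝ} (ha : 0 ≤ a) :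
    Integrable (exponentIntegrand lam μ ρ a 0) := by
  rw [A.exponentIntegrand_eq hconj hμ hZ]
  exact (A.integrable_pathTerm ha).sub ((isAdmissiblePath_linePoint hμ).integrable_pathTerm ha)

theorem twoPoint_eq (A : IsAdmissiblePath Z W) (hconj : ∀ t, Z (-t) = conj (Z t)) (hμ : 0 < μ)
    (hZ : ∀ t, R4 lam μ ρ (linePoint μ t) = Z t) {a : ℝ} (ha : 0 ≤ a) :
    twoPoint lam μ ρ a 0 = (μ : ℂ) ^ 2 * Complex.exp (1 / (2 * Real.pi * Complex.I) *
      ((∫ t, pathTerm Z W a t) - ∫ t, pathTerm (linePoint μ) (fun _ => Complex.I) a t)) /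
      ((μ : ℂ) ^ 2 + a) := by
  rw [twoPoint, A.exponentIntegrand_eq hconj hμ hZ, integral_sub (A.integrable_pathTerm ha)
    ((isAdmissiblePath_linePoint hμ).integrable_pathTerm ha), Complex.ofReal_zero, add_zero]

end IsAdmissiblePath

theorem hasDerivAt_mul_exp_div {m k d : ℂ} {F : ℝ → ℂ} (hm : m ≠ 0) (hF : HasDerivAt F d 0)
    (hF0 : F 0 = 0) :
    HasDerivAt (fun a : ℝ => m * Complex.exp (k * F a) / (m + a)) (k * d - 1 / m) 0 := by
  have hnum := (hF.const_mul k).cexp.const_mul m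
  have hden := Complex.ofRealCLM.hasDerivAt.const_add m (x := (0 : ℝ))
  refine (hnum.fun_div hden (by simpa using hm)).congr_deriv ?_
  simp only [hF0, mul_zero, Complex.exp_zero, Complex.ofRealCLM_apply, Complex.ofReal_zero,
    Complex.ofReal_one, add_zero]
  field_simp

theorem re_one_div_two_pi_I_mul (z : ℂ) :
    (1 / (2 * (Real.pi : ℂ) * Complex.I) * z).re = z.im / (2 * Real.pi) := by
  have hinv : 1 / (2 * (Real.pi : ℂ) * Complex.I) * z =
      ((1 / (2 * Real.pi) : ℝ) : ℂ) * (-Complex.I * z) := by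
    rw [one_div, mul_inv, Complex.inv_I]
    push_cast
    ring
  rw [hinv, Complex.re_ofReal_mul, neg_mul, Complex.neg_re, Complex.I_mul_re, neg_neg]
  ring

/-- The contribution of the straight path cancels the derivative of the prefactor. -/
theorem IsAdmissiblePath.exists_hasDerivWithinAt_twoPoint {Z W : ℝ → ℂ} {lam μ : ℝ} {ρ : ℝ → ℝ}
    (A : IsAdmissiblePath Z W) (hconj : ∀ t, Z (-t) = conj (Z t)) (hμ : 0 < μ)
    (hZ : ∀ t, R4 lam μ ρ (linePoint μ t) = Z t) :
    ∃ d : ℂ, HasDerivWithinAt (fun a : ℝ => twoPoint lam μ ρ a 0) d (Ici 0) 0 ∧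
      d.re = -(∫ t, (W t).im / Complex.normSq (Z t)) / (2 * Real.pi) := by
  have A₀ := isAdmissiblePath_linePoint hμ
  have hμc : (μ : ℂ) ^ 2 ≠ 0 := pow_ne_zero 2 (Complex.ofReal_ne_zero.2 hμ.ne')
  have hexp := hasDerivAt_mul_exp_div (k := 1 / (2 * Real.pi * Complex.I)) hμc
    (A.hasDerivAt_integral.fun_sub A₀.hasDerivAt_integral) (by simp [pathTerm])
  refine ⟨_, hexp.hasDerivWithinAt.congr (fun a ha => A.twoPoint_eq hconj hμ hZ ha)
    (A.twoPoint_eq hconj hμ hZ le_rfl), ?_⟩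
  rw [Complex.sub_re, re_one_div_two_pi_I_mul, Complex.sub_im, Complex.neg_im, Complex.neg_im,
    A.im_integral_div_normSq, A₀.im_integral_div_normSq, integral_linePoint hμ,
    ← Complex.ofReal_pow, ← Complex.ofReal_one, ← Complex.ofReal_div, Complex.ofReal_re]
  field_simp
  ring

theorem integral_scale_critPath {μ : ℝ} (hμ : 0 < μ) (lam : ℝ) (ψ : ℝ → ℝ) :
    ∫ t, (critDeriv lam ψ (t / μ ^ 2)).im /
      Complex.normSq (((μ ^ 2 : ℝ) : ℂ) * critPath lam ψ (t / μ ^ 2)) =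
      2 * lineIntegral lam ψ / μ ^ 2 := by
  set f : ℝ → ℝ := fun t => (critDeriv lam ψ t).im / Complex.normSq (critPath lam ψ t) with hf
  have heven (t : ℝ) : f (-t) = f t := by
    simp only [hf]
    rw [critPath_neg, critDeriv_neg, Complex.neg_im, Complex.conj_im, neg_neg,
      Complex.normSq_conj]
  have hscale := Measure.integral_comp_div f (μ ^ 2)
  rw [integral_eq_two_mul_of_even heven, abs_of_pos (by positivity), smul_eq_mul, hf,
    ← lineIntegral] at hscale
  simp only [Complex.normSq_mul, Complex.normSq_ofReal, div_mul_eq_div_div_swap]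
  rw [integral_div, integral_div, hscale]
  field_simp

theorem IsProfile.twoPoint_boundary {lam μ : ℝ} {ψ ψ' : ℝ → ℝ} (P : IsProfile (kappa lam) ψ ψ')
    (hlam : -(1 / Real.pi) ≤ lam) (hκ : |kappa lam| ≤ 1 / 32) (hμ : 0 < μ)
    (hne : lineIntegral lam ψ ≠ Real.pi * μ ^ 2) :
    (∀ a : ℝ, 0 ≤ a →
      Integrable (fun t : ℝ => exponentIntegrand lam μ (rho lam μ) a 0 t)) ∧
    ∃ d : ℂ, d ≠ -1 ∧
      HasDerivWithinAt (fun a : ℝ => twoPoint lam μ (rho lam μ) a 0) d (Ici 0) 0 := by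
  have A := (P.isAdmissiblePath (P.two_mul_mul_moment_zero hlam) hκ).scale (pow_pos hμ 2)
  have hconj (t : ℝ) : ((μ ^ 2 : ℝ) : ℂ) * critPath lam ψ (-t / μ ^ 2) =
      conj (((μ ^ 2 : ℝ) : ℂ) * critPath lam ψ (t / μ ^ 2)) := by
    rw [neg_div, critPath_neg, map_mul, Complex.conj_ofReal]
  have hZ (t : ℝ) : R4 lam μ (rho lam μ) (linePoint μ t) =
      ((μ ^ 2 : ℝ) : ℂ) * critPath lam ψ (t / μ ^ 2) := by
    rw [linePoint_eq_mul_critPoint hμ, P.R4_eq hlam hμ, critPath, Complex.ofReal_pow]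
  obtain ⟨d, hd, hre⟩ := A.exists_hasDerivWithinAt_twoPoint hconj hμ hZ
  refine ⟨fun a ha => A.integrable_exponentIntegrand hconj hμ hZ ha, d, fun hd1 => hne ?_, hd⟩
  rw [hd1, integral_scale_critPath hμ, Complex.neg_re, Complex.one_re] at hre
  field_simp at hre
  linarith

/-! ### Small coupling -/

theorem kappa_of_le {lam : ℝ} (h : lam ≤ 1 / Real.pi) : kappa lam =
    Real.arcsin (lam * Real.pi) / Real.pi * (1 - Real.arcsin (lam * Real.pi) / Real.pi) :=
  if_pos h

theorem tendsto_kappa : Tendsto kappa (𝓝 0) (𝓝 0) := by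
  have hcont : Continuous fun lam : ℝ => Real.arcsin (lam * Real.pi) / Real.pi *
      (1 - Real.arcsin (lam * Real.pi) / Real.pi) := by
    fun_prop
  have hlim := hcont.tendsto 0
  simp only [zero_mul, Real.arcsin_zero, zero_div] at hlim
  refine hlim.congr' ?_
  filter_upwards [Iio_mem_nhds (one_div_pos.2 Real.pi_pos)] with lam hlam
  exact (kappa_of_le (le_of_lt hlam)).symm

theorem half_le_kappa {lam : ℝ} (h0 : 0 ≤ lam) (h1 : lam ≤ 1 / Real.pi) :
    lam / 2 ≤ kappa lam := by
  have hpi := Real.pi_gt_three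
  have hx : lam * Real.pi ≤ 1 := by rwa [← le_div_iff₀ (by linarith)]
  have hx0 : 0 ≤ lam * Real.pi := by positivity
  have harcsin : lam ≤ Real.arcsin (lam * Real.pi) / Real.pi := by
    rw [le_div_iff₀ (by linarith), Real.le_arcsin_iff_sin_le ⟨by linarith, by linarith⟩
      ⟨by linarith, hx⟩]
    exact Real.sin_le hx0
  have hhalf := arcsin_div_pi_le_half (lam * Real.pi)
  rw [kappa_of_le h1, div_eq_mul_one_div]
  exact mul_le_mul harcsin (by linarith) (by norm_num) (by linarith)

theorem eventually_twoPoint_boundary : ∀ᶠ lam : ℝ in 𝓝[≠] 0, ∀ μ : ℝ, 0 < μ →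
    IsNaturalMass lam μ →
    (∀ a : ℝ, 0 ≤ a → Integrable (fun t : ℝ => exponentIntegrand lam μ (rho lam μ) a 0 t)) ∧
    ∃ d : ℂ, d ≠ -1 ∧
      HasDerivWithinAt (fun a : ℝ => twoPoint lam μ (rho lam μ) a 0) d (Ici 0) 0 := by
  have hpi : 0 < 1 / Real.pi := one_div_pos.2 Real.pi_pos
  have hsmall : ∀ᶠ lam in 𝓝 (0 : ℝ), |kappa lam| < 1 / 10 ^ 17 :=
    tendsto_kappa.abs.eventually_lt_const (by norm_num)
  filter_upwards [nhdsWithin_le_nhds hsmall,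
    nhdsWithin_le_nhds (Ioo_mem_nhds (neg_lt_zero.2 hpi) hpi), self_mem_nhdsWithin]
    with lam hκ hlam (h0 : lam ≠ 0) μ hμ hmass
  obtain ⟨ψ, ψ', P⟩ := exists_isProfile (neg_three_quarters_le_kappa lam)
  have hm := P.two_mul_mul_moment_zero hlam.1.le
  have hμsq : μ ^ 2 = 2 * moment ψ 0 := by
    rw [isNaturalMass_iff.1 hmass, ← hm]
    field_simp
  have hκ' : |kappa lam| ≤ 1 / 32 := by linarith
  refine P.twoPoint_boundary hlam.1.le hκ' hμ ?_
  rw [hμsq]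
  rcases h0.lt_or_gt with hneg | hpos
  · exact (P.lineIntegral_lt hm hκ' (kappa_neg hneg)).ne
  · have hmoment : 1 / 4 ≤ moment ψ 0 := by
      have hhalf := half_le_kappa hpos.le hlam.2.le
      rw [← hm] at hhalf
      exact le_of_mul_le_mul_left (by linarith : 2 * lam * (1 / 4) ≤ _) (by positivity)
    exact (P.lt_lineIntegral hm hpos.le (kappa_pos hpos) (le_of_abs_le hκ.le) hmoment).ne'

end MoyalFour

theorem proposition4p5 :
    -- the hypergeometric function is real and solves the Fredholm equation
    (∀ lam μ : ℝ, -(1 / Real.pi) ≤ lam → 0 < μ →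
      (∀ x : ℝ, 0 ≤ x → ((MoyalFour.rho lam μ x : ℝ) : ℂ) = MoyalFour.hypDensity lam μ x) ∧
      MoyalFour.SolvesFredholm lam μ (MoyalFour.rho lam μ)) ∧
    -- the particular choice of `μ²` is available
    (∀ lam : ℝ, -(1 / Real.pi) ≤ lam → lam ≠ 0 →
      ∃ μ : ℝ, 0 < μ ∧ MoyalFour.IsNaturalMass lam μ) ∧
    -- it is the one for which the natural boundary conditions hold
    (∀ lam μ : ℝ, -(1 / Real.pi) ≤ lam → lam ≠ 0 → 0 < μ →
      IntegrableOn (fun t : ℝ => MoyalFour.rho lam μ t / ((t + μ ^ 2) ^ 2 * t)) (Ioi 0) ∧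
      (MoyalFour.R4 lam μ (MoyalFour.rho lam μ) (-(μ : ℂ) ^ 2) = -1 ↔
        MoyalFour.IsNaturalMass lam μ) ∧
      IntegrableOn (fun t : ℝ => MoyalFour.rho lam μ t / (t + μ ^ 2) ^ 3) (Ioi 0) ∧
      ((∫ t in Ioi (0 : ℝ), MoyalFour.rho lam μ t / (t + μ ^ 2) ^ 3) = 1 / 2 ↔
        MoyalFour.IsNaturalMass lam μ)) ∧
    -- it differs from the condition `∂G(a, 0)/∂a = -1` at `a = 0`
    (∀ᶠ lam : ℝ in 𝓝[≠] 0, ∀ μ : ℝ, 0 < μ → MoyalFour.IsNaturalMass lam μ →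
      (∀ a : ℝ, 0 ≤ a → Integrable
        (fun t : ℝ => MoyalFour.exponentIntegrand lam μ (MoyalFour.rho lam μ) a 0 t)) ∧
      ∃ d : ℂ, d ≠ -1 ∧
        HasDerivWithinAt (fun a : ℝ => MoyalFour.twoPoint lam μ (MoyalFour.rho lam μ) a 0) d
          (Ici 0) 0) := by
  open MoyalFour in
  refine ⟨fun lam μ hlam hμ => ?_, fun lam _ h0 => exists_isNaturalMass h0,
    fun lam μ hlam h0 hμ => ?_, eventually_twoPoint_boundary⟩
  · obtain ⟨ψ, ψ', P⟩ := exists_isProfile (neg_three_quarters_le_kappa lam)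
    refine ⟨fun x hx => ?_, P.solvesFredholm hlam hμ⟩
    rw [rho, P.hypDensity_eq hlam hμ hx, Complex.ofReal_re]
  · obtain ⟨ψ, ψ', P⟩ := exists_isProfile (neg_three_quarters_le_kappa lam)
    exact ⟨P.integrableOn_rho_div_sq_mul_self hlam hμ, P.R4_neg_sq_eq_neg_one_iff hlam h0 hμ,
      P.integrableOn_rho_div_cube hlam hμ, P.integral_rho_div_cube_eq_half_iff hlam h0 hμ⟩
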